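/- **Proposition (Poisson commutativity).** Let $\gamma,\delta\in\mathbb C$ with $0<\operatorname{Im}\gamma<\operatorname{Im}\delta$, put $q=e^{2\pi i\gamma}$, $p=e^{2\pi i\delta}$, and let $\varepsilon\in\mathbb C$ be a constant. Let $$\vartheta_1(x)=-i\,p^{1/8}e^{\pi i x}\sum_{n\in\mathbb Z}(-1)^n p^{n(n+1)/2}e^{2\pi i n x},\qquad p^{1/8}=e^{\pi i\delta/4},\qquad \vartheta_1'=\vartheta_1'(0).$$ Let $\mathcal A$ be the algebra of formal power series over $\mathbb C$ in commuting variables $\lambda_n$ $(n\in\mathbb Z\setminus\{0\})$ in which only finitely many weights occur, where $\lambda_n$ has weight $n$; it is the completion of the polynomial algebra generated by the $\lambda_n$. It is a Poisson algebra under $$\{F,G\}=\sum_{n\ne0}\frac{(1-q^n)(1-p^nq^{-n})}{1-p^n}\,\frac{\partial F}{\partial\lambda_n}\frac{\partial G}{\partial\lambda_{-n}}$$ (for each monomial, only finitely many $n$ contribute to its coefficient), so that $\{\lambda_n,\lambda_m\}=\frac{(1-q^n)(1-p^nq^{-n})}{1-p^n}\,\delta_{n+m,0}$. For real $x$ set $$\eta(x)=\varepsilon\exp\Bigl(\sum_{n\neq0}\lambda_n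 e^{-2\pi i n x}\Bigr),$$ a formal power series in the $\lambda_n$, and for $n=1,2,\dots$ let $$I_n=\frac{(-1)^{n-1}}{n!}\,\frac{(\vartheta_1')^{n-1}\vartheta_1(n\gamma)}{(2\pi i)^{n-1}\vartheta_1(\gamma)^n}\int_{-1/2}^{1/2}\!\!\cdots\int_{-1/2}^{1/2}\prod_{1\le i<j\le n}\frac{\vartheta_1(x_i-x_j)^2}{\vartheta_1(x_i-x_j+\gamma)\,\vartheta_1(x_i-x_j-\gamma)}\;\eta(x_1)\cdots\eta(x_n)\,dx_1\cdots dx_n ,$$ the integral being taken coefficient by coefficient; $I_n$ is an element of $\mathcal A$ (of weight $0$). Then for all positive integers $k$ and $l$, $$\{I_k,I_l\}=0 .$$ -/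

import Mathlib

open Complex MeasureTheory Filter

noncomputable section

namespace EllipticILW

/-! ### The theta function -/

/-- The theta function `ϑ₁(x; δ) = -i p^{1/8} e^{πix} ∑_{n ∈ ℤ} (-1)^n p^{n(n+1)/2} e^{2πinx}`
with `p = e^{2πiδ}`, where `p^{1/8} = e^{πiδ/4}` and `p^{n(n+1)/2} = e^{πiδn(n+1)}`. -/
def theta (δ x : ℂ) : ℂ :=
  -I * cexp (Real.pi * I * δ / 4) * cexp (Real.pi * I * x) *
    ∑' n : ℤ, (-1 : ℂ) ^ n * cexp (Real.pi * I * δ * n * (n + 1)) * cexp (2 * Real.pi * I * n * x)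

lemma theta_add_int (δ x : ℂ) (k : ℤ) :
    theta δ (x + k) = cexp (Real.pi * I * k) * theta δ x := by
  unfold theta
  have h : ∀ n : ℤ, cexp (2 * Real.pi * I * n * (x + k)) = cexp (2 * Real.pi * I * n * x) := by
    intro n
    rw [show 2 * Real.pi * I * n * (x + k) = 2 * Real.pi * I * n * x
      + ((n * k : ℤ) : ℂ) * (2 * Real.pi * I) by push_cast; ring, Complex.exp_add,
      Complex.exp_int_mul_two_pi_mul_I, mul_one]
  simp only [h]
  rw [mul_add, Complex.exp_add]
  ring

/-! ### The Poisson algebra -/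

/-- The index set `ℤ ∖ {0}` of the generators. -/
abbrev Mode : Type := {n : ℤ // n ≠ 0}

/-- The index `-n`. -/
def Mode.opp (n : Mode) : Mode := ⟨-n.1, neg_ne_zero.mpr n.2⟩

@[simp] lemma Mode.coe_opp (n : Mode) : (n.opp : ℤ) = -n := rfl

@[simp] lemma Mode.opp_opp (n : Mode) : n.opp.opp = n := Subtype.ext (neg_neg _)

/-- The structure constant `(1 - q^n)(1 - p^n q^{-n}) / (1 - p^n)` with `q = e^{2πiγ}` and
`p = e^{2πiδ}`. -/
def structConst (γ δ : ℂ) (n : ℤ) : ℂ :=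
  (1 - cexp (2 * Real.pi * I * γ) ^ n) *
      (1 - cexp (2 * Real.pi * I * δ) ^ n * cexp (2 * Real.pi * I * γ) ^ (-n)) /
    (1 - cexp (2 * Real.pi * I * δ) ^ n)

lemma structConst_neg (γ δ : ℂ) (n : ℤ) : structConst γ δ (-n) = -structConst γ δ n := by
  unfold structConst
  have hq : cexp (2 * Real.pi * I * γ) ^ n ≠ 0 := zpow_ne_zero _ (Complex.exp_ne_zero _)
  have hp : cexp (2 * Real.pi * I * δ) ^ n ≠ 0 := zpow_ne_zero _ (Complex.exp_ne_zero _)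
  simp only [neg_neg, zpow_neg]
  generalize cexp (2 * Real.pi * I * γ) ^ n = a at *
  generalize cexp (2 * Real.pi * I * δ) ^ n = b at *
  by_cases hb : b = 1
  · simp [hb]
  · have h1 : 1 - b ≠ 0 := sub_ne_zero.mpr (Ne.symm hb)
    have h2 : 1 - b⁻¹ ≠ 0 := by
      rw [sub_ne_zero]; intro h; exact hb (inv_eq_one.mp h.symm)
    rw [← neg_div, div_eq_div_iff h2 h1]
    field_simp
    ring

/-- Formal power series in the generators `λ_n`, `n ∈ ℤ ∖ {0}`. -/
abbrev Series : Type := MvPowerSeries Mode ℂ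

/-- The weight of a monomial, for which `λ_n` has weight `n`. -/
def wt : (Mode →₀ ℕ) →+ ℤ := Finsupp.weight fun n : Mode => (n : ℤ)

@[simp] lemma wt_single (n : Mode) : wt (Finsupp.single n 1) = n := by
  simp [wt, Finsupp.weight_apply]

/-- The completed algebra generated by the `λ_n`: formal power series in the `λ_n` in which only
finitely many weights occur (infinitely many monomials of the same weight are allowed). -/
def PoissonAlg : Subalgebra ℂ Series where
  carrier := {F | {w | ∃ m, MvPowerSeries.coeff m F ≠ 0 ∧ wt m = w}.Finite}
  mul_mem' := by
    classical
    intro F G hF hG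
    refine (hF.add hG).subset ?_
    rintro w ⟨m, hm, rfl⟩
    rw [MvPowerSeries.coeff_mul] at hm
    obtain ⟨⟨a, b⟩, hab, h⟩ := Finset.exists_ne_zero_of_sum_ne_zero hm
    rw [Finset.HasAntidiagonal.mem_antidiagonal] at hab
    refine ⟨wt a, ⟨a, left_ne_zero_of_mul h, rfl⟩, wt b, ⟨b, right_ne_zero_of_mul h, rfl⟩, ?_⟩
    simp only at hab ⊢
    rw [← map_add, hab]
  add_mem' := by
    intro F G hF hG
    refine (hF.union hG).subset ?_
    rintro w ⟨m, hm, rfl⟩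
    by_contra hw
    simp only [Set.mem_union, Set.mem_ofPred_eq, not_or, not_exists, not_and] at hw
    have h1 : MvPowerSeries.coeff m F = 0 := by
      by_contra h; exact hw.1 m h rfl
    have h2 : MvPowerSeries.coeff m G = 0 := by
      by_contra h; exact hw.2 m h rfl
    exact hm (by rw [map_add, h1, h2, add_zero])
  algebraMap_mem' := by
    classical
    intro r
    refine (Set.finite_singleton (0 : ℤ)).subset ?_
    rintro w ⟨m, hm, rfl⟩
    rw [MvPowerSeries.algebraMap_apply, MvPowerSeries.coeff_C] at hm
    by_cases h : m = 0
    · simp [h]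
    · simp [h] at hm

/-- The generator `λ_n`. -/
def gen (n : Mode) : PoissonAlg :=
  ⟨MvPowerSeries.X n, by
    classical
    refine (Set.finite_singleton (n : ℤ)).subset ?_
    rintro w ⟨m, hm, rfl⟩
    rw [MvPowerSeries.coeff_X] at hm
    by_cases h : m = Finsupp.single n 1
    · simp [h]
    · simp [h] at hm⟩

/-- The Poisson bracket `{F, G} = ∑_n c_n (∂F/∂λ_n) (∂G/∂λ_{-n})`, where `c_n` is the structure
constant. Each coefficient is a finite sum when only finitely many weights occur in `F`, see
`finite_support_bracketTerm`. -/
def bracketFun (γ δ : ℂ) (F G : Series) : Series := fun m =>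
  ∑ᶠ n : Mode, structConst γ δ n *
    MvPowerSeries.coeff m (MvPowerSeries.pderiv ℂ n F * MvPowerSeries.pderiv ℂ n.opp G)

lemma coeff_bracketFun (γ δ : ℂ) (F G : Series) (m : Mode →₀ ℕ) :
    MvPowerSeries.coeff m (bracketFun γ δ F G) =
      ∑ᶠ n : Mode, structConst γ δ n *
        MvPowerSeries.coeff m (MvPowerSeries.pderiv ℂ n F * MvPowerSeries.pderiv ℂ n.opp G) :=
  rfl

lemma finite_modes {F : Series} (hF : F ∈ PoissonAlg) (m : Mode →₀ ℕ) :
    {n : Mode | ∃ a ≤ m, MvPowerSeries.coeff a (MvPowerSeries.pderiv ℂ n F) ≠ 0}.Finite := by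
  have hS : {w | ∃ m, MvPowerSeries.coeff m F ≠ 0 ∧ wt m = w}.Finite := hF
  have hT : (wt '' Set.Iic m).Finite := (Set.finite_Iic m).image _
  refine Set.Finite.of_finite_image (f := Subtype.val) ((hS.sub hT).subset ?_)
    Subtype.val_injective.injOn
  rintro _ ⟨n, ⟨a, ha, h⟩, rfl⟩
  rw [MvPowerSeries.coeff_pderiv] at h
  refine ⟨_, ⟨_, left_ne_zero_of_mul h, rfl⟩, _, ⟨a, ha, rfl⟩, ?_⟩
  simp

lemma coeff_mul_eq_zero {n : Mode} {F G : Series} {m : Mode →₀ ℕ}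
    (h : ∀ a ≤ m, MvPowerSeries.coeff a (MvPowerSeries.pderiv ℂ n F) = 0) :
    MvPowerSeries.coeff m (MvPowerSeries.pderiv ℂ n F * G) = 0 := by
  classical
  rw [MvPowerSeries.coeff_mul]
  refine Finset.sum_eq_zero fun x hx => ?_
  rw [h x.1 (le_iff_exists_add.mpr ⟨x.2, (Finset.HasAntidiagonal.mem_antidiagonal.mp hx).symm⟩),
    zero_mul]

lemma finite_support_bracketTerm (γ δ : ℂ) {F : Series} (hF : F ∈ PoissonAlg) (G : Series)
    (m : Mode →₀ ℕ) :
    (Function.support fun n : Mode => structConst γ δ n * MvPowerSeries.coeff m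
      (MvPowerSeries.pderiv ℂ n F * MvPowerSeries.pderiv ℂ n.opp G)).Finite := by
  refine (finite_modes hF m).subset fun n hn => ?_
  by_contra h
  simp only [Set.mem_ofPred_eq, not_exists, not_and, not_not] at h
  exact hn (by simp only [coeff_mul_eq_zero h, mul_zero])

/-- The bracket restricted to finitely many modes. -/
def bracketFin (γ δ : ℂ) (s : Finset Mode) (F G : Series) : Series :=
  ∑ n ∈ s, structConst γ δ n • (MvPowerSeries.pderiv ℂ n F * MvPowerSeries.pderiv ℂ n.opp G)

lemma eventually_bracketFin (γ δ : ℂ) {F : Series} (hF : F ∈ PoissonAlg) (G : Series)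
    (Gs : Finset Mode → Series)
    (hG : ∀ m, ∀ᶠ s in atTop, MvPowerSeries.coeff m G = MvPowerSeries.coeff m (Gs s))
    (m : Mode →₀ ℕ) :
    ∀ᶠ s in atTop, MvPowerSeries.coeff m (bracketFun γ δ F G) =
      MvPowerSeries.coeff m (bracketFin γ δ s F (Gs s)) := by
  classical
  set T := (finite_modes hF m).toFinset with hT
  have hz : ∀ n ∉ T, ∀ a ≤ m, MvPowerSeries.coeff a (MvPowerSeries.pderiv ℂ n F) = 0 := by
    intro n hn a ha
    by_contra h
    exact hn ((Set.Finite.mem_toFinset _).mpr ⟨a, ha, h⟩)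
  have h1 : ∀ᶠ s in atTop, ∀ n ∈ T, ∀ x ∈ Finset.HasAntidiagonal.antidiagonal m,
      MvPowerSeries.coeff (x.2 + Finsupp.single n.opp 1) G =
        MvPowerSeries.coeff (x.2 + Finsupp.single n.opp 1) (Gs s) := by
    rw [eventually_all_finset]
    intro n _
    rw [eventually_all_finset]
    intro x _
    exact hG _
  filter_upwards [h1, eventually_ge_atTop T] with s hs hTs
  rw [coeff_bracketFun, bracketFin, map_sum,
    finsum_eq_sum_of_support_subset (s := s)]
  · refine Finset.sum_congr rfl fun n _ => ?_
    rw [map_smul, smul_eq_mul]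
    by_cases hn : n ∈ T
    · rw [MvPowerSeries.coeff_mul, MvPowerSeries.coeff_mul]
      congr 1
      refine Finset.sum_congr rfl fun x hx => ?_
      rw [MvPowerSeries.coeff_pderiv _ x.2, MvPowerSeries.coeff_pderiv _ x.2, hs n hn x hx]
    · rw [coeff_mul_eq_zero (hz n hn), coeff_mul_eq_zero (hz n hn)]
  · intro n hn
    by_contra h
    exact hn (by simp only [coeff_mul_eq_zero (hz n fun h' => h (hTs h')), mul_zero])

lemma bracketFun_mem (γ δ : ℂ) {F G : Series} (hF : F ∈ PoissonAlg) (hG : G ∈ PoissonAlg) :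
    bracketFun γ δ F G ∈ PoissonAlg := by
  classical
  have hS : {w | ∃ m, MvPowerSeries.coeff m F ≠ 0 ∧ wt m = w}.Finite := hF
  have hT : {w | ∃ m, MvPowerSeries.coeff m G ≠ 0 ∧ wt m = w}.Finite := hG
  refine (hS.add hT).subset ?_
  rintro w ⟨m, hm, rfl⟩
  rw [coeff_bracketFun] at hm
  obtain ⟨n, hn⟩ : ∃ n : Mode, structConst γ δ n * MvPowerSeries.coeff m
      (MvPowerSeries.pderiv ℂ n F * MvPowerSeries.pderiv ℂ n.opp G) ≠ 0 := by
    by_contra! h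
    exact hm (by simp only [h, finsum_zero])
  have hn := right_ne_zero_of_mul hn
  rw [MvPowerSeries.coeff_mul] at hn
  obtain ⟨⟨a, b⟩, hab, h⟩ := Finset.exists_ne_zero_of_sum_ne_zero hn
  rw [Finset.HasAntidiagonal.mem_antidiagonal] at hab
  simp only [MvPowerSeries.coeff_pderiv] at h hab
  refine ⟨_, ⟨_, left_ne_zero_of_mul (left_ne_zero_of_mul h), rfl⟩,
    _, ⟨_, left_ne_zero_of_mul (right_ne_zero_of_mul h), rfl⟩, ?_⟩
  simp only [map_add, wt_single, Mode.coe_opp, ← hab]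
  ring

/-- The Poisson bracket on the completed algebra, as a bilinear map. -/
def poissonBracket (γ δ : ℂ) : PoissonAlg →ₗ[ℂ] PoissonAlg →ₗ[ℂ] PoissonAlg :=
  LinearMap.mk₂ ℂ (fun F G => ⟨bracketFun γ δ F G, bracketFun_mem γ δ F.2 G.2⟩)
    (by
      intro F F' G
      ext m
      simp only [AddMemClass.coe_add, map_add, coeff_bracketFun]
      rw [← finsum_add_distrib (finite_support_bracketTerm γ δ F.2 _ m)
        (finite_support_bracketTerm γ δ F'.2 _ m)]
      exact finsum_congr fun n => by rw [add_mul, map_add, mul_add])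
    (by
      intro c F G
      ext m
      simp only [SetLike.val_smul, map_smul, coeff_bracketFun, smul_eq_mul]
      rw [mul_finsum]
      exact finsum_congr fun n => by rw [Derivation.map_smul, smul_mul_assoc, map_smul, smul_eq_mul]; ring)
    (by
      intro F G G'
      ext m
      simp only [AddMemClass.coe_add, map_add, coeff_bracketFun]
      rw [← finsum_add_distrib (finite_support_bracketTerm γ δ F.2 _ m)
        (finite_support_bracketTerm γ δ F.2 _ m)]
      exact finsum_congr fun n => by rw [mul_add, map_add, mul_add])
    (by
      intro c F G
      ext m
      simp only [SetLike.val_smul, map_smul, coeff_bracketFun, smul_eq_mul]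
      rw [mul_finsum]
      exact finsum_congr fun n => by rw [Derivation.map_smul, mul_smul_comm, map_smul, smul_eq_mul]; ring)

lemma coe_poissonBracket (γ δ : ℂ) (F G : PoissonAlg) :
    (poissonBracket γ δ F G : Series) = bracketFun γ δ F G := rfl

/-- The defining relation of the generators. -/
lemma poissonBracket_gen (γ δ : ℂ) (n m : Mode) :
    poissonBracket γ δ (gen n) (gen m) =
      algebraMap ℂ PoissonAlg (if (n : ℤ) + m = 0 then structConst γ δ n else 0) := by
  classical
  ext d
  rw [coe_poissonBracket, coeff_bracketFun]
  simp only [gen]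
  rw [finsum_eq_single _ n]
  · rw [MvPowerSeries.pderiv_X_self, one_mul, MvPowerSeries.pderiv_X]
    have : n.opp = m ↔ (n : ℤ) + m = 0 := by
      rw [Subtype.ext_iff, Mode.coe_opp]; omega
    rw [SubalgebraClass.coe_algebraMap, MvPowerSeries.algebraMap_apply, MvPowerSeries.coeff_C,
      Pi.single_apply]
    by_cases h : (n : ℤ) + m = 0
    · rw [if_pos h, if_pos (this.mpr h).symm, MvPowerSeries.coeff_one]
      split_ifs <;> simp
    · rw [if_neg h, if_neg fun h' => h (this.mp h'.symm)]
      simp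
  · intro k hk
    rw [MvPowerSeries.pderiv_X_of_ne hk.symm, zero_mul, map_zero, mul_zero]

lemma poissonBracket_leibniz (γ δ : ℂ) (F G H : PoissonAlg) :
    poissonBracket γ δ F (G * H) =
      poissonBracket γ δ F G * H + G * poissonBracket γ δ F H := by
  classical
  ext m
  have key : ∀ᶠ s in atTop, MvPowerSeries.coeff m (bracketFun γ δ F (G * H)) =
      MvPowerSeries.coeff m (bracketFin γ δ s F G * (H : Series) +
        (G : Series) * bracketFin γ δ s F H) := by
    filter_upwards [eventually_bracketFin γ δ F.2 (G * H : Series) (fun _ => (G * H : Series))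
      (fun _ => Eventually.of_forall fun _ => rfl) m] with s hs
    rw [hs]
    congr 1
    simp only [bracketFin, Finset.sum_mul, Finset.mul_sum, ← Finset.sum_add_distrib]
    refine Finset.sum_congr rfl fun n _ => ?_
    rw [Derivation.leibniz]
    simp only [smul_eq_mul, MvPowerSeries.smul_eq_C_mul]
    ring
  have hcongr : ∀ K : PoissonAlg, ∀ᶠ s in atTop, ∀ x ∈ Finset.HasAntidiagonal.antidiagonal m,
      MvPowerSeries.coeff x.1 (bracketFun γ δ F K) =
        MvPowerSeries.coeff x.1 (bracketFin γ δ s F K) ∧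
      MvPowerSeries.coeff x.2 (bracketFun γ δ F K) =
        MvPowerSeries.coeff x.2 (bracketFin γ δ s F K) := by
    intro K
    rw [eventually_all_finset]
    intro x _
    exact (eventually_bracketFin γ δ F.2 K (fun _ => K)
      (fun _ => Eventually.of_forall fun _ => rfl) x.1).and
      (eventually_bracketFin γ δ F.2 K (fun _ => K)
      (fun _ => Eventually.of_forall fun _ => rfl) x.2)
  obtain ⟨s, h1, h2, h3⟩ := (key.and ((hcongr G).and (hcongr H))).exists
  simp only [AddMemClass.coe_add, MulMemClass.coe_mul, coe_poissonBracket]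
  rw [h1, map_add, map_add]
  simp only [MvPowerSeries.coeff_mul]
  congr 1
  · exact Finset.sum_congr rfl fun x hx => by rw [(h2 x hx).1]
  · exact Finset.sum_congr rfl fun x hx => by rw [(h3 x hx).2]

lemma sum_opp {M : Type*} [AddCommMonoid M] {s : Finset Mode} (hs : ∀ n ∈ s, n.opp ∈ s)
    (f : Mode → M) : ∑ n ∈ s, f n.opp = ∑ n ∈ s, f n :=
  Finset.sum_bij' (fun n _ => n.opp) (fun n _ => n.opp) hs hs (by simp) (by simp) (by simp)

lemma exists_opp_closed {P : Finset Mode → Prop} (h : ∀ᶠ s in atTop, P s) :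
    ∃ s, P s ∧ ∀ n ∈ s, n.opp ∈ s := by
  classical
  obtain ⟨t, ht⟩ := eventually_atTop.mp h
  refine ⟨t ∪ t.image Mode.opp, ht _ Finset.subset_union_left, fun n hn => ?_⟩
  rw [Finset.mem_union, Finset.mem_image] at hn ⊢
  rcases hn with hn | ⟨k, hk, rfl⟩
  · exact Or.inr ⟨n, hn, rfl⟩
  · exact Or.inl (by simpa using hk)

lemma poissonBracket_antisymm (γ δ : ℂ) (F G : PoissonAlg) :
    poissonBracket γ δ F G = -poissonBracket γ δ G F := by
  ext m
  have hF := eventually_bracketFin γ δ F.2 G (fun _ => G)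
    (fun _ => Eventually.of_forall fun _ => rfl) m
  have hG := eventually_bracketFin γ δ G.2 F (fun _ => F)
    (fun _ => Eventually.of_forall fun _ => rfl) m
  obtain ⟨s, ⟨h1, h2⟩, hs⟩ := exists_opp_closed (hF.and hG)
  rw [NegMemClass.coe_neg, map_neg, coe_poissonBracket, coe_poissonBracket, h1, h2, ← map_neg]
  congr 1
  simp only [bracketFin]
  rw [← sum_opp hs, ← Finset.sum_neg_distrib]
  refine Finset.sum_congr rfl fun n _ => ?_
  rw [Mode.coe_opp, structConst_neg, Mode.opp_opp, neg_smul, mul_comm]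

lemma pderiv_comm (n k : Mode) (F : Series) :
    MvPowerSeries.pderiv ℂ n (MvPowerSeries.pderiv ℂ k F) =
      MvPowerSeries.pderiv ℂ k (MvPowerSeries.pderiv ℂ n F) := by
  ext m
  by_cases h : n = k
  · rw [h]
  · simp only [MvPowerSeries.coeff_pderiv, Finsupp.add_apply,
      Finsupp.single_eq_of_ne h, Finsupp.single_eq_of_ne (Ne.symm h), add_zero]
    rw [add_right_comm]
    ring

lemma bracketFin_jacobi (γ δ : ℂ) {s : Finset Mode} (hs : ∀ n ∈ s, n.opp ∈ s) (F G H : Series) :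
    bracketFin γ δ s F (bracketFin γ δ s G H) + bracketFin γ δ s G (bracketFin γ δ s H F) +
      bracketFin γ δ s H (bracketFin γ δ s F G) = 0 := by
  let a (F G H : Series) : Series := ∑ n ∈ s, ∑ k ∈ s,
    MvPowerSeries.C (structConst γ δ n * structConst γ δ k) * (MvPowerSeries.pderiv ℂ n F *
      MvPowerSeries.pderiv ℂ n.opp (MvPowerSeries.pderiv ℂ k G) *
      MvPowerSeries.pderiv ℂ k.opp H)
  let b (F G H : Series) : Series := ∑ n ∈ s, ∑ k ∈ s,
    MvPowerSeries.C (structConst γ δ n * structConst γ δ k) * (MvPowerSeries.pderiv ℂ n F *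
      MvPowerSeries.pderiv ℂ k G *
      MvPowerSeries.pderiv ℂ n.opp (MvPowerSeries.pderiv ℂ k.opp H))
  have hab : ∀ F G H, bracketFin γ δ s F (bracketFin γ δ s G H) = a F G H + b F G H := by
    intro F G H
    simp only [bracketFin, a, b, map_sum, ← Finset.sum_add_distrib, Finset.mul_sum,
      Finset.smul_sum]
    refine Finset.sum_congr rfl fun n _ => Finset.sum_congr rfl fun k _ => ?_
    rw [Derivation.map_smul, Derivation.leibniz]
    simp only [smul_eq_mul, MvPowerSeries.smul_eq_C_mul, map_mul]
    ring
  have hanti : ∀ F G H, a G H F = -b F G H := by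
    intro F G H
    simp only [a, b]
    rw [Finset.sum_comm, ← sum_opp hs, ← Finset.sum_neg_distrib]
    refine Finset.sum_congr rfl fun n _ => ?_
    rw [← Finset.sum_neg_distrib]
    refine Finset.sum_congr rfl fun k _ => ?_
    rw [Mode.coe_opp, structConst_neg, Mode.opp_opp, pderiv_comm k.opp n.opp]
    simp only [map_mul, map_neg]
    ring
  rw [hab, hab, hab, hanti F G H, hanti G H F, hanti H F G]
  ring

lemma poissonBracket_jacobi (γ δ : ℂ) (F G H : PoissonAlg) :
    poissonBracket γ δ F (poissonBracket γ δ G H) +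
      poissonBracket γ δ G (poissonBracket γ δ H F) +
      poissonBracket γ δ H (poissonBracket γ δ F G) = 0 := by
  ext m
  have key : ∀ F G H : PoissonAlg, ∀ᶠ s in atTop,
      MvPowerSeries.coeff m (bracketFun γ δ F (bracketFun γ δ G H)) =
        MvPowerSeries.coeff m (bracketFin γ δ s F (bracketFin γ δ s G H)) := fun F G H =>
    eventually_bracketFin γ δ F.2 _ _ (eventually_bracketFin γ δ G.2 H (fun _ => H)
      (fun _ => Eventually.of_forall fun _ => rfl)) m
  obtain ⟨s, ⟨h1, h2, h3⟩, hs⟩ :=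
    exists_opp_closed ((key F G H).and ((key G H F).and (key H F G)))
  simp only [AddMemClass.coe_add, coe_poissonBracket, map_add, ZeroMemClass.coe_zero]
  rw [h1, h2, h3, ← map_add, ← map_add, bracketFin_jacobi γ δ hs]

/-! ### The field `η` and the integrals `I_n` -/

/-- The formal series `∑_{n ≠ 0} λ_n e^{-2πinx}` (for each monomial, at most one term of the sum
contributes). -/
def logField (x : ℝ) : Series := fun m =>
  ∑ᶠ n : Mode, cexp (-(2 * Real.pi * I * (n : ℤ) * x)) *
    MvPowerSeries.coeff m (MvPowerSeries.X n : Series)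

lemma coeff_logField_single (x : ℝ) (n : Mode) :
    MvPowerSeries.coeff (Finsupp.single n 1) (logField x) =
      cexp (-(2 * Real.pi * I * (n : ℤ) * x)) := by
  classical
  change ∑ᶠ k : Mode, _ = _
  rw [finsum_eq_single _ n, MvPowerSeries.coeff_X, if_pos rfl, mul_one]
  intro k hk
  rw [MvPowerSeries.coeff_X, if_neg, mul_zero]
  intro h
  exact hk (Finsupp.single_left_injective one_ne_zero h).symm

lemma coeff_logField_of_ne (x : ℝ) {m : Mode →₀ ℕ} (hm : ∀ n, m ≠ Finsupp.single n 1) :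
    MvPowerSeries.coeff m (logField x) = 0 := by
  classical
  change ∑ᶠ k : Mode, _ = _
  refine finsum_eq_zero_of_forall_eq_zero fun n => ?_
  rw [MvPowerSeries.coeff_X, if_neg (hm n), mul_zero]

/-- `η(x) = ε exp (∑_{n ≠ 0} λ_n e^{-2πinx})`, a formal power series in the `λ_n`. -/
def eta (ε : ℂ) (x : ℝ) : Series :=
  ε • (PowerSeries.exp ℂ).subst (logField x)

lemma hasSubst_logField (x : ℝ) : PowerSeries.HasSubst (logField x) := by
  refine PowerSeries.HasSubst.of_constantCoeff_zero ?_
  rw [← MvPowerSeries.coeff_zero_eq_constantCoeff_apply]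
  refine coeff_logField_of_ne x fun n h => ?_
  exact one_ne_zero (Finsupp.single_eq_zero.mp h.symm)

/-- The kernel `∏_{i<j} ϑ₁(x_i - x_j)² / (ϑ₁(x_i - x_j + γ) ϑ₁(x_i - x_j - γ))`. -/
def kernel (γ δ : ℂ) {n : ℕ} (x : Fin n → ℝ) : ℂ :=
  ∏ i, ∏ j ∈ Finset.Ioi i, theta δ (x i - x j) ^ 2 /
    (theta δ (x i - x j + γ) * theta δ (x i - x j - γ))

/-- The constant `(-1)^{n-1} (1/n!) ϑ₁'(0)^{n-1} ϑ₁(nγ) / ((2πi)^{n-1} ϑ₁(γ)^n)`, for `n ≥ 1`. -/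
def prefactor (γ δ : ℂ) (n : ℕ) : ℂ :=
  (-1) ^ (n - 1) * (1 / (n.factorial : ℂ)) *
    (deriv (theta δ) 0 ^ (n - 1) * theta δ (n * γ) /
      ((2 * Real.pi * I) ^ (n - 1) * theta δ γ ^ n))

/-- The quantity `I_n` as a formal power series in the `λ_m`; the multiple integral over
`[-1/2, 1/2]^n` of the series-valued integrand is taken coefficient by coefficient. -/
def hamiltonianSeries (γ δ ε : ℂ) (n : ℕ) : Series := fun m =>
  prefactor γ δ n *
    ∫ x : Fin n → ℝ in Set.univ.pi fun _ => Set.Ioc (-1 / 2 : ℝ) (1 / 2),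
      kernel γ δ x * MvPowerSeries.coeff m (∏ i, eta ε (x i))

/-! ### The series `I_n` lie in the Poisson algebra: they have weight zero -/

/-- Translation by `t` multiplies `λ_n` by `e^{-2πint}`. -/
lemma eta_add (ε : ℂ) (x t : ℝ) :
    eta ε (x + t) =
      MvPowerSeries.rescale (fun n : Mode => cexp (-(2 * Real.pi * I * (n : ℤ) * t))) (eta ε x) := by
  set r : Mode → ℂ := fun n => cexp (-(2 * Real.pi * I * (n : ℤ) * t)) with hr
  have hL : logField (x + t) = MvPowerSeries.rescale r (logField x) := by
    ext m
    rw [MvPowerSeries.coeff_rescale]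
    by_cases h : ∃ n, m = Finsupp.single n 1
    · obtain ⟨n, rfl⟩ := h
      rw [coeff_logField_single, coeff_logField_single, Finsupp.prod_single_index (by simp),
        pow_one, hr, ← Complex.exp_add]
      congr 1
      push_cast
      ring
    · push Not at h
      rw [coeff_logField_of_ne _ h, coeff_logField_of_ne _ h, mul_zero]
  ext m
  rw [MvPowerSeries.coeff_rescale, eta, eta, map_smul, map_smul,
    PowerSeries.coeff_subst (hasSubst_logField _), PowerSeries.coeff_subst (hasSubst_logField _),
    smul_eq_mul, smul_eq_mul, mul_left_comm]
  congr 1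
  rw [mul_finsum]
  refine finsum_congr fun d => ?_
  rw [hL, ← map_pow, MvPowerSeries.coeff_rescale, smul_eq_mul, smul_eq_mul]
  ring

lemma coeff_prod_eta_add {n : ℕ} (ε : ℂ) (x : Fin n → ℝ) (t : ℝ) (m : Mode →₀ ℕ) :
    MvPowerSeries.coeff m (∏ i, eta ε (x i + t)) =
      cexp (-(2 * Real.pi * I * (wt m) * t)) * MvPowerSeries.coeff m (∏ i, eta ε (x i)) := by
  simp only [eta_add, ← map_prod, MvPowerSeries.coeff_rescale]
  congr 1
  simp only [wt, Finsupp.weight_apply, Finsupp.prod, Finsupp.sum, ← Complex.exp_nat_mul,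
    ← Complex.exp_sum]
  congr 1
  push_cast
  rw [Finset.mul_sum, Finset.sum_mul, ← Finset.sum_neg_distrib]
  refine Finset.sum_congr rfl fun k _ => ?_
  simp only [nsmul_eq_mul]
  push_cast
  ring

lemma eta_add_int (ε : ℂ) (x : ℝ) (k : ℤ) : eta ε (x + k) = eta ε x := by
  rw [eta_add]
  have : (fun n : Mode => cexp (-(2 * Real.pi * I * (n : ℤ) * ((k : ℝ) : ℂ)))) = 1 := by
    funext n
    rw [Pi.one_apply, show -(2 * Real.pi * I * (n : ℤ) * ((k : ℝ) : ℂ)) =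
      ((-(n * k) : ℤ) : ℂ) * (2 * Real.pi * I) by push_cast; ring,
      Complex.exp_int_mul_two_pi_mul_I]
  rw [this, MvPowerSeries.rescale_one, RingHom.id_apply]

lemma kernel_add_int (γ δ : ℂ) {n : ℕ} (x : Fin n → ℝ) (k : Fin n → ℤ) :
    kernel γ δ (fun i => x i + k i) = kernel γ δ x := by
  unfold kernel
  refine Finset.prod_congr rfl fun i _ => Finset.prod_congr rfl fun j _ => ?_
  have h0 : (((x i + k i : ℝ) : ℂ) - ((x j + k j : ℝ) : ℂ)) =
      ((x i : ℂ) - x j) + ((k i - k j : ℤ) : ℂ) := by push_cast; ring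
  have h1 : ((x i : ℂ) - x j) + ((k i - k j : ℤ) : ℂ) + γ =
      ((x i : ℂ) - x j + γ) + ((k i - k j : ℤ) : ℂ) := by ring
  have h2 : ((x i : ℂ) - x j) + ((k i - k j : ℤ) : ℂ) - γ =
      ((x i : ℂ) - x j - γ) + ((k i - k j : ℤ) : ℂ) := by ring
  rw [h0, h1, h2, theta_add_int, theta_add_int, theta_add_int]
  have hc : cexp (Real.pi * I * ((k i - k j : ℤ) : ℂ)) ≠ 0 := Complex.exp_ne_zero _
  rw [show ∀ c a b d : ℂ, (c * a) ^ 2 / ((c * b) * (c * d)) = (c ^ 2 * a ^ 2) / (c ^ 2 * (b * d)) by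
    intros; congr 1 <;> ring, mul_div_mul_left _ _ (pow_ne_zero 2 hc)]

lemma kernel_add (γ δ : ℂ) {n : ℕ} (x : Fin n → ℝ) (t : ℝ) :
    kernel γ δ (fun i => x i + t) = kernel γ δ x := by
  unfold kernel
  refine Finset.prod_congr rfl fun i _ => Finset.prod_congr rfl fun j _ => ?_
  have h0 : (((x i + t : ℝ) : ℂ) - ((x j + t : ℝ) : ℂ)) = ((x i : ℂ) - x j) := by push_cast; ring
  rw [h0]

/-- Vectors with integer coordinates. -/
def intLattice (n : ℕ) : AddSubgroup (Fin n → ℝ) :=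
  ((Int.castAddHom ℝ).compLeft (Fin n)).range

lemma isAddFundamentalDomain_box (n : ℕ) (v : ℝ) :
    IsAddFundamentalDomain (intLattice n)
      (Set.univ.pi fun _ : Fin n => Set.Ioc v (v + 1)) volume := by
  refine IsAddFundamentalDomain.mk'
    (MeasurableSet.univ_pi fun _ => measurableSet_Ioc).nullMeasurableSet fun x => ?_
  choose k hk huniq using fun i => existsUnique_add_zsmul_mem_Ioc (zero_lt_one' ℝ) (x i) v
  refine ⟨⟨fun i => (k i : ℝ), k, rfl⟩, ?_, ?_⟩
  · intro i _
    have := hk i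
    simp only [zsmul_eq_mul, mul_one] at this
    change (k i : ℝ) + x i ∈ _
    rwa [add_comm (k i : ℝ)]
  · rintro ⟨_, k', rfl⟩ h
    ext i
    have h' : ((k' i : ℤ) : ℝ) + x i ∈ Set.Ioc v (v + 1) := h i trivial
    have := huniq i (k' i) (by simpa [add_comm] using h')
    change ((k' i : ℤ) : ℝ) = (k i : ℝ)
    rw [this]

instance (n : ℕ) : Countable (intLattice n) := by
  have : Countable (Set.range ((Int.castAddHom ℝ).compLeft (Fin n))) :=
    (Set.countable_range _).to_subtype
  exact this

lemma integral_box_translate {n : ℕ} (f : (Fin n → ℝ) → ℂ)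
    (hf : ∀ (x : Fin n → ℝ) (k : Fin n → ℤ), f (fun i => x i + k i) = f x) (t : ℝ) :
    ∫ x in Set.univ.pi fun _ => Set.Ioc (-1 / 2 : ℝ) (1 / 2), f (fun i => x i + t) =
      ∫ x in Set.univ.pi fun _ => Set.Ioc (-1 / 2 : ℝ) (1 / 2), f x := by
  have h1 := (measurePreserving_add_right (volume : Measure (Fin n → ℝ))
    (fun _ => t)).setIntegral_preimage_emb
    (MeasurableEquiv.addRight (fun _ : Fin n => t)).measurableEmbedding f
    (Set.univ.pi fun _ => Set.Ioc (-1 / 2 + t : ℝ) (1 / 2 + t))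
  have h2 : ((fun x : Fin n → ℝ => x + fun _ => t) ⁻¹'
      (Set.univ.pi fun _ => Set.Ioc (-1 / 2 + t : ℝ) (1 / 2 + t))) =
      Set.univ.pi fun _ => Set.Ioc (-1 / 2 : ℝ) (1 / 2) := by
    ext x
    simp
  rw [h2] at h1
  refine Eq.trans h1 ?_
  have e1 : (1 / 2 + t : ℝ) = (-1 / 2 + t) + 1 := by ring
  have e2 : (1 / 2 : ℝ) = -1 / 2 + 1 := by norm_num
  rw [e1]
  conv_rhs => rw [e2]
  refine (isAddFundamentalDomain_box n _).setIntegral_eq (isAddFundamentalDomain_box n _) ?_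
  rintro ⟨_, k, rfl⟩ x
  rw [← hf x k]
  congr 1
  funext i
  exact add_comm _ _

lemma coeff_hamiltonianSeries_of_wt_ne (γ δ ε : ℂ) (n : ℕ) {m : Mode →₀ ℕ} (hm : wt m ≠ 0) :
    MvPowerSeries.coeff m (hamiltonianSeries γ δ ε n) = 0 := by
  set f : (Fin n → ℝ) → ℂ := fun x => kernel γ δ x * MvPowerSeries.coeff m (∏ i, eta ε (x i))
    with hf
  change prefactor γ δ n *
    (∫ x in Set.univ.pi fun _ => Set.Ioc (-1 / 2 : ℝ) (1 / 2), f x) = 0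
  set J := ∫ x in Set.univ.pi fun _ => Set.Ioc (-1 / 2 : ℝ) (1 / 2), f x with hJ
  have hper : ∀ (x : Fin n → ℝ) (k : Fin n → ℤ), f (fun i => x i + k i) = f x := by
    intro x k
    simp only [hf, kernel_add_int, eta_add_int]
  set t : ℝ := 1 / (2 * wt m) with ht
  have hexp : cexp (-(2 * Real.pi * I * (wt m) * t)) = -1 := by
    have : (wt m : ℂ) ≠ 0 := by exact_mod_cast hm
    rw [show -(2 * Real.pi * I * (wt m) * (t : ℂ)) = -(Real.pi * I) by
      rw [ht]; push_cast; field_simp, Complex.exp_neg, Complex.exp_pi_mul_I]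
    norm_num
  have h := integral_box_translate f hper t
  have h' : ∀ x : Fin n → ℝ, f (fun i => x i + t) = -1 * f x := by
    intro x
    simp only [hf, kernel_add, coeff_prod_eta_add, hexp]
    ring
  simp only [h'] at h
  rw [integral_const_mul, ← hJ] at h
  have : J = 0 := by linear_combination (-1 / 2 : ℂ) * h
  rw [this, mul_zero]

/-- The quantity `I_n`, as an element of the Poisson algebra. -/
def hamiltonian (γ δ ε : ℂ) (n : ℕ) : PoissonAlg :=
  ⟨hamiltonianSeries γ δ ε n, by
    refine (Set.finite_singleton (0 : ℤ)).subset ?_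
    rintro w ⟨m, hm, rfl⟩
    by_contra h
    exact hm (coeff_hamiltonianSeries_of_wt_ne γ δ ε n h)⟩

end EllipticILW

end

noncomputable section

namespace EllipticILW

open Topology

/-! ### Doubly periodic functions -/

/-! Since `∂η(x)/∂λ_n = e^{-2πinx} η(x)`, the bracket `{I_k, I_l}` is, up to prefactors, an integral
over `k + l` variables: the two kernels, times `∑ K(x_i - y_j)`, times the product of all the `η`.
Here `K(u) = ∑ c_n e^{-2πinu}`, with `c_n` the structure constants. Its Abel sum is `-(2πi)⁻¹ (L(u -
γ) + L(u + γ) - 2 L(u))`, where `L` is the logarithmic derivative of the theta function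
(`tendsto_regKernel`). The product of the `η` is symmetric in all `k + l` variables, so the rest of
the integrand may be averaged over the `k`-element sets `I` of variables that play the role of the
`x_i`. This average vanishes identically.

The vanishing (`IsOddTheta.sum_pairProd_logDerivDiff`) is the derivative at `β = 0` of an identity
for `v(x) = f(x + γ) f(x + β - γ) / (f(x) f(x + β))`: the sum over `I` of `∏ v(z_i - z_j)`, with `i
∈ I` and `j ∉ I`, is unchanged when `v(x)` becomes `v(-x)` (`IsTwoPole.splitDiff_eq_zero`). The
difference of the two sums is elliptic in each variable, and its residues are multiples of the same
difference for two points fewer. By induction it has no poles, so it is constant in each variable.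
Replacing the `z_i` by `w - z_i` one after another therefore leaves it unchanged, but this
reflection also reverses its sign.

The Fourier series of `K` does not converge and `K` has a pole on the diagonal, so the factor
`r^{|n|}` is inserted and `r` tends to `1` from below. For a fixed monomial only finitely many modes
contribute, hence the bracket is recovered in the limit (`finsum_bracketTerm_eq_zero`). Dominated
convergence is available after averaging: `K` is odd, and the weights attached to `(i, j)` and `(j,
i)` differ by at most a multiple of the chordal distance of `z_i` and `z_j`, which absorbs the pole
uniformly in `r` (`exists_norm_sum_splitWeight_le`).

The theta function enters through the product `oddProd`, to which it is proportional. The value of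
the factor is irrelevant, and if it were zero every `I_n` with `n > 0` would vanish. -/

/-- The lattice generated by `1` and `δ`. -/
def lattice (δ : ℂ) : AddSubgroup ℂ := AddSubgroup.closure {1, δ}

lemma mem_lattice {δ x : ℂ} : x ∈ lattice δ ↔ ∃ m n : ℤ, (m : ℂ) + n * δ = x := by
  simp [lattice, AddSubgroup.mem_closure_pair]

lemma int_mem_lattice (δ : ℂ) (m : ℤ) : (m : ℂ) ∈ lattice δ :=
  mem_lattice.mpr ⟨m, 0, by simp⟩

lemma add_lattice_eq {δ : ℂ} {α : Type*} {h : ℂ → α} (h1 : ∀ x, h (x + 1) = h x)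
    (h2 : ∀ x, h (x + δ) = h x) {l : ℂ} (hl : l ∈ lattice δ) (x : ℂ) : h (x + l) = h x := by
  revert x
  induction hl using AddSubgroup.closure_induction with
  | mem l hl =>
    rcases hl with rfl | rfl
    · exact h1
    · exact h2
  | zero => simp
  | add a b _ _ ha hb => intro x; rw [← add_assoc, hb, ha]
  | neg a _ ha => intro x; rw [← ha (x + -a), neg_add_cancel_right]

lemma limUnder_eq_of_continuousAt {h : ℂ → ℂ} {x : ℂ} (hx : ContinuousAt h x) :
    limUnder (𝓝[≠] x) h = h x :=
  (hx.tendsto.mono_left nhdsWithin_le_nhds).limUnder_eq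

/-- Passing to the punctured limit at every point repairs all removable singularities at once and,
unlike a change of values at chosen points, visibly respects periods. -/
lemma differentiable_limUnder {h : ℂ → ℂ} {S : Set ℂ} (hS : ∀ x, ∀ᶠ y in 𝓝[≠] x, y ∉ S)
    (hd : ∀ x ∉ S, DifferentiableAt ℂ h x)
    (hlim : ∀ x ∈ S, Tendsto (fun y => (y - x) * h y) (𝓝[≠] x) (𝓝 0)) :
    Differentiable ℂ fun x => limUnder (𝓝[≠] x) h := by
  intro x
  have hlim' : Tendsto (fun y => (y - x) * h y) (𝓝[≠] x) (𝓝 0) := by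
    by_cases hx : x ∈ S
    · exact hlim x hx
    · have : Tendsto (fun y => (y - x) * h y) (𝓝 x) (𝓝 ((x - x) * h x)) :=
        ((continuous_id.sub continuous_const).tendsto x).mul (hd x hx).continuousAt.tendsto
      rw [sub_self, zero_mul] at this
      exact this.mono_left nhdsWithin_le_nhds
  -- The growth condition of Riemann's removable singularity theorem; subtracting the constant `h x`
  -- is harmless because `(z - x) * h x` tends to zero.
  have ho : (fun z => h z - h x) =o[𝓝[≠] x] fun z => (z - x)⁻¹ := by
    rw [Asymptotics.isLittleO_iff_tendsto']
    · have h0 : Tendsto (fun y => (y - x) * h x) (𝓝[≠] x) (𝓝 0) := by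
        have : Tendsto (fun y => (y - x) * h x) (𝓝 x) (𝓝 ((x - x) * h x)) :=
          ((continuous_id.sub continuous_const).mul continuous_const).tendsto x
        rw [sub_self, zero_mul] at this
        exact this.mono_left nhdsWithin_le_nhds
      have := hlim'.sub h0
      rw [sub_zero] at this
      refine this.congr fun y => ?_
      rw [div_inv_eq_mul]
      ring
    · filter_upwards [self_mem_nhdsWithin] with y hy h0
      exact absurd h0 (inv_ne_zero (sub_ne_zero.mpr hy))
  obtain ⟨s, hs, hxs, hsS⟩ : ∃ s : Set ℂ, IsOpen s ∧ x ∈ s ∧ ∀ y ∈ s, y ≠ x → y ∉ S := by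
    have := hS x
    rw [eventually_nhdsWithin_iff, eventually_nhds_iff] at this
    obtain ⟨t, ht, hto, hxt⟩ := this
    exact ⟨t, hto, hxt, fun y hy hne => ht y hy hne⟩
  have hdiff := differentiableOn_update_limUnder_of_isLittleO (hs.mem_nhds hxs)
    (fun y hy => (hd y (hsS y hy.1 hy.2)).differentiableWithinAt) ho
  refine (hdiff.differentiableAt (hs.mem_nhds hxs)).congr_of_eventuallyEq ?_
  filter_upwards [hs.mem_nhds hxs] with y hy
  by_cases hyx : y = x
  · subst hyx; simp
  · rw [Function.update_of_ne hyx]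
    exact limUnder_eq_of_continuousAt (hd y (hsS y hy hyx)).continuousAt

lemma limUnder_add_period {h : ℂ → ℂ} {l : ℂ} (hl : ∀ x, h (x + l) = h x) (x : ℂ) :
    limUnder (𝓝[≠] (x + l)) h = limUnder (𝓝[≠] x) h := by
  have : map (fun y => y + l) (𝓝[≠] x) = 𝓝[≠] (x + l) := by
    have h2 := (Homeomorph.addRight l).isEmbedding.map_nhdsWithin_eq {x}ᶜ x
    rw [Set.image_compl_eq (Homeomorph.addRight l).bijective, Set.image_singleton] at h2
    exact h2
  unfold limUnder
  rw [← this, map_map]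
  congr 2
  funext y
  exact hl y

/-- A real-linear combination of `1` and `δ`. -/
lemma exists_real_coords {δ : ℂ} (hδ : 0 < δ.im) (x : ℂ) : ∃ a b : ℝ, x = a + b * δ := by
  refine ⟨x.re - x.im / δ.im * δ.re, x.im / δ.im, ?_⟩
  apply Complex.ext
  · simp
  · simp [hδ.ne']

/-- Liouville: all values are attained on the closed period parallelogram, which is compact. -/
lemma eq_of_differentiable_of_doublyPeriodic {δ : ℂ} (hδ : 0 < δ.im) {h : ℂ → ℂ}
    (hd : Differentiable ℂ h) (h1 : ∀ x, h (x + 1) = h x) (h2 : ∀ x, h (x + δ) = h x)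
    (x y : ℂ) : h x = h y := by
  refine hd.apply_eq_apply_of_bounded ?_ x y
  have hc : IsCompact ((fun ab : ℝ × ℝ => h (ab.1 + ab.2 * δ)) ''
      (Set.Icc 0 1 ×ˢ Set.Icc 0 1)) := by
    refine (isCompact_Icc.prod isCompact_Icc).image ?_
    exact hd.continuous.comp (by fun_prop)
  refine hc.isBounded.subset ?_
  rintro _ ⟨x, rfl⟩
  obtain ⟨a, b, rfl⟩ := exists_real_coords hδ x
  refine ⟨(Int.fract a, Int.fract b), ⟨⟨Int.fract_nonneg _, (Int.fract_lt_one _).le⟩,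
    ⟨Int.fract_nonneg _, (Int.fract_lt_one _).le⟩⟩, ?_⟩
  have hl : ((⌊a⌋ : ℤ) : ℂ) + (⌊b⌋ : ℤ) * δ ∈ lattice δ := mem_lattice.mpr ⟨_, _, rfl⟩
  change h ((Int.fract a : ℝ) + (Int.fract b : ℝ) * δ) = h (a + b * δ)
  rw [← add_lattice_eq h1 h2 hl]
  congr 1
  have ha : (a : ℂ) = (⌊a⌋ : ℤ) + (Int.fract a : ℝ) := by
    exact_mod_cast (Int.floor_add_fract a).symm
  have hb : (b : ℂ) = (⌊b⌋ : ℤ) + (Int.fract b : ℝ) := by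
    exact_mod_cast (Int.floor_add_fract b).symm
  rw [ha, hb]
  ring_nf

/-- A doubly periodic function all of whose singularities are isolated and removable is constant
outside its singularities. -/
lemma eq_of_doublyPeriodic {δ : ℂ} (hδ : 0 < δ.im) {h : ℂ → ℂ} {S : Set ℂ}
    (hS : ∀ x, ∀ᶠ y in 𝓝[≠] x, y ∉ S) (hd : ∀ x ∉ S, DifferentiableAt ℂ h x)
    (h1 : ∀ x, h (x + 1) = h x) (h2 : ∀ x, h (x + δ) = h x)
    (hlim : ∀ x ∈ S, Tendsto (fun y => (y - x) * h y) (𝓝[≠] x) (𝓝 0))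
    {x y : ℂ} (hx : x ∉ S) (hy : y ∉ S) : h x = h y := by
  have := eq_of_differentiable_of_doublyPeriodic hδ (differentiable_limUnder hS hd hlim)
    (limUnder_add_period h1) (limUnder_add_period h2) x y
  simpa only [limUnder_eq_of_continuousAt (hd x hx).continuousAt,
    limUnder_eq_of_continuousAt (hd y hy).continuousAt] using this

/-! ### The product form of the theta function -/

/-- `e(x) = e^{2πix}`. -/
def e (x : ℂ) : ℂ := cexp (2 * Real.pi * I * x)

lemma e_ne_zero (x : ℂ) : e x ≠ 0 := Complex.exp_ne_zero _

lemma e_add (x y : ℂ) : e (x + y) = e x * e y := by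
  rw [e, mul_add, Complex.exp_add]; rfl

lemma e_neg (x : ℂ) : e (-x) = (e x)⁻¹ := by
  rw [e, mul_neg, Complex.exp_neg]; rfl

lemma e_sub (x y : ℂ) : e (x - y) = e x / e y := by
  rw [sub_eq_add_neg, e_add, e_neg, div_eq_mul_inv]

lemma e_zero : e 0 = 1 := by simp [e]

lemma e_eq_one_iff {x : ℂ} : e x = 1 ↔ ∃ n : ℤ, x = n := by
  rw [e, Complex.exp_eq_one_iff]
  have h : (2 * Real.pi * I : ℂ) ≠ 0 := Complex.two_pi_I_ne_zero
  refine exists_congr fun n => ?_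
  rw [mul_comm (n : ℂ), mul_right_inj' h]

lemma e_int (n : ℤ) : e n = 1 := e_eq_one_iff.mpr ⟨n, rfl⟩

lemma e_one : e 1 = 1 := by simpa using e_int 1

lemma e_int_mul (n : ℤ) (x : ℂ) : e (n * x) = e x ^ n := by
  rw [e, e, ← Complex.exp_int_mul]; congr 1; ring

lemma e_nat_mul (n : ℕ) (x : ℂ) : e (n * x) = e x ^ n := by
  exact_mod_cast e_int_mul n x

lemma norm_e (x : ℂ) : ‖e x‖ = Real.exp (-(2 * Real.pi * x.im)) := by
  rw [e, Complex.norm_exp]; congr 1; simp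

lemma norm_e_lt_one {x : ℂ} (hx : 0 < x.im) : ‖e x‖ < 1 := by
  rw [norm_e, Real.exp_lt_one_iff]; have := Real.pi_pos; nlinarith [mul_pos this hx]

lemma norm_e_ofReal (x : ℝ) : ‖e x‖ = 1 := by simp [norm_e]

lemma differentiable_e : Differentiable ℂ e := by unfold e; fun_prop

lemma deriv_e (x : ℂ) : deriv e x = 2 * Real.pi * I * e x := by
  have : HasDerivAt e (cexp (2 * Real.pi * I * x) * (2 * Real.pi * I * 1)) x :=
    ((hasDerivAt_id x).const_mul _).cexp
  rw [this.deriv, e]; ring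

/-- The infinite product `∏_{m ≥ 0} (1 - p^m z)`. -/
def qProd (p z : ℂ) : ℂ := ∏' m : ℕ, (1 - p ^ m * z)

/-- The sum `∑_{m ≥ 0} p^m z / (1 - p^m z)`. -/
def lambert (p z : ℂ) : ℂ := ∑' m : ℕ, p ^ m * z / (1 - p ^ m * z)

section qProd

variable {p : ℂ} (hp : ‖p‖ < 1)
include hp

lemma summable_norm_pow_mul (z : ℂ) : Summable fun m : ℕ => ‖-(p ^ m * z)‖ := by
  simp only [norm_neg, norm_mul, norm_pow]
  exact (summable_geometric_of_lt_one (norm_nonneg _) hp).mul_right _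

lemma multipliable_qProd (z : ℂ) : Multipliable fun m : ℕ => 1 - p ^ m * z := by
  simp only [sub_eq_add_neg]
  exact multipliable_one_add_of_summable (summable_norm_pow_mul hp z)

lemma qProd_eq (z : ℂ) : qProd p z = (1 - z) * qProd p (p * z) := by
  have h2 : ∀ m : ℕ, 1 - p ^ m * (p * z) = 1 - p ^ (m + 1) * z := fun m => by ring
  have h : Multipliable fun m : ℕ => 1 - p ^ (m + 1) * z :=
    (multipliable_qProd hp (p * z)).congr h2
  have h3 := tprod_eq_zero_mul' (f := fun m : ℕ => 1 - p ^ m * z) h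
  rw [pow_zero, one_mul] at h3
  rw [qProd, h3, qProd, tprod_congr h2]

lemma multipliableLocallyUniformlyOn_qProd :
    MultipliableLocallyUniformlyOn (fun (m : ℕ) z => 1 - p ^ m * z) Set.univ := by
  use fun z => ∏' m : ℕ, (1 - p ^ m * z)
  simp_rw [sub_eq_add_neg]
  apply hasProdLocallyUniformlyOn_of_forall_compact isOpen_univ
  intro K _ hcK
  obtain ⟨R, hR⟩ := hcK.isBounded.exists_norm_le
  refine ((summable_geometric_of_lt_one (norm_nonneg _) hp).mul_right R).hasProdUniformlyOn_nat_one_add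
    hcK (.of_forall fun n x hx => ?_) (fun _ => by fun_prop)
  rw [norm_neg, norm_mul, norm_pow]
  exact mul_le_mul_of_nonneg_left (hR x hx) (by positivity)

lemma differentiable_qProd : Differentiable ℂ (qProd p) := by
  rw [← differentiableOn_univ]
  exact (multipliableLocallyUniformlyOn_qProd hp).hasProdLocallyUniformlyOn.differentiableOn
    (.of_forall fun _ => by simpa [Finset.prod_fn] using
      DifferentiableOn.finsetProd (fun _ _ => by fun_prop)) isOpen_univ

lemma qProd_ne_zero_iff {z : ℂ} : qProd p z ≠ 0 ↔ ∀ m : ℕ, p ^ m * z ≠ 1 := by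
  constructor
  · intro h m hm
    refine h ?_
    unfold qProd
    refine (hasProd_zero_of_exists_eq_zero ⟨m, ?_⟩).tprod_eq
    rw [hm, sub_self]
  · intro h
    unfold qProd
    simp_rw [sub_eq_add_neg]
    refine tprod_one_add_ne_zero_of_summable (fun m h0 => h m ?_) (summable_norm_pow_mul hp z)
    linear_combination -h0

lemma qProd_ne_zero_of_norm_lt {z : ℂ} (hz : ‖z‖ < 1) : qProd p z ≠ 0 := by
  rw [qProd_ne_zero_iff hp]
  intro m h
  have : ‖p ^ m * z‖ < 1 := by
    rw [norm_mul, norm_pow]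
    exact mul_lt_one_of_nonneg_of_lt_one_right (pow_le_one₀ (norm_nonneg _) hp.le)
      (norm_nonneg _) hz
  rw [h, norm_one] at this
  exact lt_irrefl _ this

lemma tendsto_pow_mul_zero (z : ℂ) : Tendsto (fun m : ℕ => p ^ m * z) atTop (𝓝 0) := by
  have := (tendsto_pow_atTop_nhds_zero_of_norm_lt_one hp).mul_const z
  rwa [zero_mul] at this

lemma summable_lambert (z : ℂ) : Summable fun m : ℕ => p ^ m * z / (1 - p ^ m * z) := by
  refine Summable.of_norm_bounded_eventually_nat
    (g := fun m => 2 * ‖-(p ^ m * z)‖) ((summable_norm_pow_mul hp z).mul_left 2) ?_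
  have h := (tendsto_pow_mul_zero hp z).norm
  rw [norm_zero] at h
  filter_upwards [h.eventually_lt_const (show (0 : ℝ) < 1 / 2 by norm_num)] with m hm
  rw [norm_div, norm_neg]
  have h1 : 1 / 2 ≤ ‖1 - p ^ m * z‖ := by
    have := norm_sub_norm_le (1 : ℂ) (p ^ m * z)
    rw [norm_one] at this
    linarith
  rw [div_le_iff₀ (by linarith)]
  nlinarith [norm_nonneg (p ^ m * z)]

lemma lambert_eq (z : ℂ) : lambert p z = z / (1 - z) + lambert p (p * z) := by
  unfold lambert
  rw [(summable_lambert hp z).tsum_eq_zero_add]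
  simp only [pow_zero, one_mul, pow_succ, mul_assoc]

lemma mul_logDeriv_qProd {z : ℂ} (hz : qProd p z ≠ 0) :
    z * logDeriv (qProd p) z = -lambert p z := by
  have hne := (qProd_ne_zero_iff hp).mp hz
  have hl : ∀ m : ℕ, logDeriv (fun z => 1 - p ^ m * z) z = -(p ^ m / (1 - p ^ m * z)) := by
    intro m
    have : HasDerivAt (fun z : ℂ => 1 - p ^ m * z) (-(p ^ m * 1)) z :=
      ((hasDerivAt_id z).const_mul (p ^ m)).const_sub 1
    rw [logDeriv_apply, this.deriv]
    ring
  have hmul : ∀ m : ℕ, z * logDeriv (fun z => 1 - p ^ m * z) z =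
      -(p ^ m * z / (1 - p ^ m * z)) := fun m => by rw [hl]; ring
  have hs : Summable fun m : ℕ => logDeriv (fun z => 1 - p ^ m * z) z := by
    by_cases h0 : z = 0
    · subst h0
      simp only [hl, mul_zero, sub_zero, div_one]
      exact (summable_geometric_of_norm_lt_one hp).neg
    · rw [← summable_mul_left_iff h0]
      simp only [hmul]
      exact (summable_lambert hp z).neg
  have := logDeriv_tprod_eq_tsum isOpen_univ (Set.mem_univ z)
    (f := fun (m : ℕ) z => 1 - p ^ m * z) (fun m h => hne m (by linear_combination -h))
    (fun _ => by fun_prop) hs (multipliableLocallyUniformlyOn_qProd hp) hz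
  change logDeriv (qProd p) z = _ at this
  rw [this, ← tsum_mul_left]
  simp only [hmul, tsum_neg]
  rfl

/-- The Lambert series expansion. -/
lemma hasSum_lambert {z : ℂ} (hz : ‖z‖ < 1) :
    HasSum (fun n : ℕ => z ^ (n + 1) / (1 - p ^ (n + 1))) (lambert p z) := by
  -- Each Lambert term is a geometric series. The resulting double series converges absolutely, and
  -- summing over `m` first gives the other expansion.
  have hs : Summable fun x : ℕ × ℕ => (p ^ x.1 * z) ^ (x.2 + 1) := by
    have hb : Summable fun x : ℕ × ℕ => ‖p‖ ^ x.1 * (‖z‖ ^ x.2 * ‖z‖) :=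
      (summable_geometric_of_lt_one (norm_nonneg _) hp).mul_of_nonneg
        ((summable_geometric_of_lt_one (norm_nonneg _) hz).mul_right _)
        (fun _ => by positivity) (fun _ => by positivity)
    refine Summable.of_norm_bounded hb fun x => ?_
    rw [norm_pow, norm_mul, norm_pow, mul_pow, pow_succ ‖z‖]
    refine mul_le_mul_of_nonneg_right ?_ (by positivity)
    exact pow_le_of_le_one (by positivity) (pow_le_one₀ (norm_nonneg _) hp.le) (by omega)
  have h1 : ∀ m : ℕ, HasSum (fun n : ℕ => (p ^ m * z) ^ (n + 1))
      (p ^ m * z / (1 - p ^ m * z)) := by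
    intro m
    have hm : ‖p ^ m * z‖ < 1 := by
      rw [norm_mul, norm_pow]
      exact mul_lt_one_of_nonneg_of_lt_one_right (pow_le_one₀ (norm_nonneg _) hp.le)
        (norm_nonneg _) hz
    simpa only [pow_succ', div_eq_mul_inv] using
      (hasSum_geometric_of_norm_lt_one hm).mul_left (p ^ m * z)
  have h2 : ∀ n : ℕ, HasSum (fun m : ℕ => (p ^ m * z) ^ (n + 1))
      (z ^ (n + 1) / (1 - p ^ (n + 1))) := by
    intro n
    have hn : ‖p ^ (n + 1)‖ < 1 := by
      rw [norm_pow]; exact pow_lt_one₀ (norm_nonneg _) hp (by omega)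
    have := (hasSum_geometric_of_norm_lt_one hn).mul_left (z ^ (n + 1))
    rw [← div_eq_mul_inv] at this
    refine this.congr_fun fun m => ?_
    rw [mul_pow, ← pow_mul, ← pow_mul, mul_comm m]
    ring
  have h3 : HasSum (fun m : ℕ => p ^ m * z / (1 - p ^ m * z)) (∑' x : ℕ × ℕ, (p ^ x.1 * z) ^ (x.2 + 1)) :=
    hs.hasSum.prod_fiberwise h1
  have h4 : HasSum (fun n : ℕ => z ^ (n + 1) / (1 - p ^ (n + 1)))
      (∑' x : ℕ × ℕ, (p ^ x.1 * z) ^ (x.2 + 1)) :=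
    ((Equiv.prodComm ℕ ℕ).hasSum_iff.mpr hs.hasSum).prod_fiberwise h2
  rwa [lambert, h3.tsum_eq]

end qProd

/-! ### Odd theta functions -/

/-- Entire odd functions with the quasi-periodicity of the first theta function and simple zeros
exactly at the lattice points. -/
structure IsOddTheta (δ : ℂ) (f : ℂ → ℂ) : Prop where
  differentiable : Differentiable ℂ f
  neg : ∀ x, f (-x) = -f x
  add_one : ∀ x, f (x + 1) = -f x
  add_tau : ∀ x, f (x + δ) = -(cexp (-(Real.pi * I * δ)) * (e x)⁻¹ * f x)
  eq_zero_iff : ∀ x, f x = 0 ↔ x ∈ lattice δ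
  deriv_ne_zero : deriv f 0 ≠ 0

/-- The product `e^{-πix} ∏_{m ≥ 0} (1 - p^m e^{2πix}) (1 - p^{m+1} e^{-2πix})`. -/
def oddProd (δ x : ℂ) : ℂ :=
  cexp (-(Real.pi * I * x)) * qProd (e δ) (e x) * qProd (e δ) (e δ / e x)

lemma cexp_pi_mul_sq (x : ℂ) : cexp (Real.pi * I * x) * cexp (Real.pi * I * x) = e x := by
  rw [← Complex.exp_add, e]; congr 1; ring

lemma cexp_neg_pi_mul (x : ℂ) :
    cexp (-(Real.pi * I * x)) = cexp (Real.pi * I * x) * (e x)⁻¹ := by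
  rw [← cexp_pi_mul_sq, mul_inv, ← mul_assoc, mul_inv_cancel₀ (Complex.exp_ne_zero _), one_mul,
    Complex.exp_neg]

section

variable {δ : ℂ} (hδ : 0 < δ.im)
include hδ

/-- With `z = e x`, one product loses the factor `1 - z` and the other gains `1 - z⁻¹`, and `1 - z⁻¹
= -z⁻¹ (1 - z)`. Both the oddness and the `δ`-quasi-periodicity of `oddProd` reduce to this. -/
lemma qProd_e_mul_eq (x : ℂ) : qProd (e δ) (e δ * e x) * qProd (e δ) (e x)⁻¹ =
    -(e x)⁻¹ * (qProd (e δ) (e x) * qProd (e δ) (e δ / e x)) := by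
  have hp := norm_e_lt_one hδ
  rw [qProd_eq hp (e x), qProd_eq hp (e x)⁻¹, ← div_eq_mul_inv]
  have := e_ne_zero x
  field_simp
  ring

lemma differentiable_oddProd : Differentiable ℂ (oddProd δ) := by
  have hp := norm_e_lt_one hδ
  have h1 : Differentiable ℂ fun x => e δ / e x := fun x =>
    (differentiableAt_const _).div differentiable_e.differentiableAt (e_ne_zero x)
  exact ((by fun_prop : Differentiable ℂ fun x : ℂ => cexp (-(Real.pi * I * x))).mul
    ((differentiable_qProd hp).comp differentiable_e)).mul ((differentiable_qProd hp).comp h1)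

/-- The first product vanishes on the rows `-mδ + ℤ` and the second on the rows `(m + 1)δ + ℤ`, for
`m ≥ 0`; together these are all rows of the lattice. -/
lemma oddProd_eq_zero_iff (x : ℂ) : oddProd δ x = 0 ↔ x ∈ lattice δ := by
  have hp := norm_e_lt_one hδ
  have key : ∀ y : ℂ, qProd (e δ) (e y) = 0 ↔ ∃ m : ℕ, ∃ n : ℤ, m * δ + y = n := by
    intro y
    rw [← not_iff_not, ← Ne, qProd_ne_zero_iff hp]
    push Not
    refine forall_congr' fun m => ?_
    rw [← e_nat_mul, ← e_add, Ne, e_eq_one_iff, not_exists]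
  have h0 : oddProd δ x = 0 ↔ qProd (e δ) (e x) = 0 ∨ qProd (e δ) (e (δ - x)) = 0 := by
    rw [oddProd, mul_eq_zero, mul_eq_zero, e_sub]
    simp [Complex.exp_ne_zero]
  rw [h0, key, key, mem_lattice]
  constructor
  · rintro (⟨m, n, h⟩ | ⟨m, n, h⟩)
    · exact ⟨n, -m, by push_cast; linear_combination -h⟩
    · exact ⟨-n, m + 1, by push_cast; linear_combination h⟩
  · rintro ⟨m, n, h⟩
    rcases le_or_gt n 0 with hn | hn
    · obtain ⟨k, rfl⟩ := Int.exists_eq_neg_ofNat hn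
      exact Or.inl ⟨k, m, by push_cast at h; linear_combination -h⟩
    · obtain ⟨k, rfl⟩ := Int.eq_succ_of_zero_lt hn
      exact Or.inr ⟨k, -m, by push_cast at h ⊢; linear_combination h⟩

lemma deriv_oddProd_zero : deriv (oddProd δ) 0 ≠ 0 := by
  have hp := norm_e_lt_one hδ
  -- The zero at the origin comes from the factor `1 - e x` of the first product; `g` collects the
  -- remaining factors, none of which vanishes there.
  set g : ℂ → ℂ := fun x => cexp (-(Real.pi * I * x)) * qProd (e δ) (e δ * e x) *
    qProd (e δ) (e δ / e x) with hg
  have hfg : oddProd δ = fun x => (1 - e x) * g x := by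
    funext x
    rw [oddProd, qProd_eq hp (e x), hg]
    ring
  have hgd : DifferentiableAt ℂ g 0 := by
    have h1 : DifferentiableAt ℂ (fun x => e δ / e x) 0 :=
      (differentiableAt_const _).div differentiable_e.differentiableAt (e_ne_zero 0)
    have h2 : DifferentiableAt ℂ (fun x => e δ * e x) 0 :=
      differentiable_e.differentiableAt.const_mul _
    exact ((by fun_prop : DifferentiableAt ℂ (fun x : ℂ => cexp (-(Real.pi * I * x))) 0).mul
      ((differentiable_qProd hp _).comp 0 h2)).mul ((differentiable_qProd hp _).comp 0 h1)
  have h3 : HasDerivAt (fun x => 1 - e x) (-(2 * Real.pi * I)) 0 := by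
    have := (differentiable_e 0).hasDerivAt.const_sub 1
    rwa [deriv_e, e_zero, mul_one] at this
  have h4 := h3.mul hgd.hasDerivAt
  rw [hfg]
  have h5 := h4.deriv
  change deriv (fun x => (1 - e x) * g x) 0 = _ at h5
  rw [h5, e_zero, sub_self, zero_mul, add_zero, hg]
  simp only [e_zero, mul_zero, neg_zero, Complex.exp_zero, mul_one, div_one, one_mul]
  have := qProd_ne_zero_of_norm_lt hp hp
  simp [Real.pi_ne_zero, this]

lemma isOddTheta_oddProd : IsOddTheta δ (oddProd δ) where
  differentiable := differentiable_oddProd hδ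
  neg x := by
    have h := qProd_e_mul_eq hδ x
    rw [oddProd, oddProd, e_neg, div_inv_eq_mul, mul_assoc,
      mul_comm (qProd (e δ) (e x)⁻¹), h, mul_neg, neg_neg, cexp_neg_pi_mul]
    ring
  add_one x := by
    have h1 : cexp (-(Real.pi * I * (x + 1))) = -cexp (-(Real.pi * I * x)) := by
      rw [mul_add, neg_add, Complex.exp_add, mul_one, Complex.exp_neg (Real.pi * I),
        Complex.exp_pi_mul_I]
      norm_num
    rw [oddProd, oddProd, h1, e_add, e_one, mul_one]
    ring
  add_tau x := by
    have h := qProd_e_mul_eq hδ x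
    have h1 : cexp (-(Real.pi * I * (x + δ))) =
        cexp (-(Real.pi * I * δ)) * cexp (-(Real.pi * I * x)) := by
      rw [← Complex.exp_add]; congr 1; ring
    rw [oddProd, oddProd, h1, add_comm x, e_add,
      show e δ / (e δ * e x) = (e x)⁻¹ by rw [div_mul_cancel_left₀ (e_ne_zero δ)],
      mul_assoc, h]
    ring
  eq_zero_iff := oddProd_eq_zero_iff hδ
  deriv_ne_zero := deriv_oddProd_zero hδ

end

namespace IsOddTheta

variable {δ : ℂ} {f : ℂ → ℂ} (hf : IsOddTheta δ f)
include hf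

lemma ne_zero {x : ℂ} (hx : x ∉ lattice δ) : f x ≠ 0 := fun h => hx ((hf.eq_zero_iff x).mp h)

lemma map_zero : f 0 = 0 := (hf.eq_zero_iff 0).mpr (zero_mem _)

/-- Discreteness of the lattice: its points are the zeros of an entire function that is not
identically zero, since its derivative at `0` is nonzero. -/
lemma eventually_notMem_lattice (x : ℂ) : ∀ᶠ y in 𝓝[≠] x, y ∉ lattice δ := by
  have ha : AnalyticOnNhd ℂ f Set.univ :=
    fun y _ => hf.differentiable.analyticAt y
  rcases (ha x trivial).eventually_eq_zero_or_eventually_ne_zero with h | h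
  · have h0 := ha.eqOn_zero_of_preconnected_of_eventuallyEq_zero isPreconnected_univ trivial h
    refine absurd ?_ hf.deriv_ne_zero
    have : f = fun _ => 0 := funext fun y => h0 trivial
    rw [this, deriv_const]
  · filter_upwards [h] with y hy hl
    exact hy ((hf.eq_zero_iff y).mpr hl)

lemma eventually_notMem_lattice_sub (x c : ℂ) : ∀ᶠ y in 𝓝[≠] x, y - c ∉ lattice δ := by
  have h := hf.eventually_notMem_lattice (x - c)
  have ht : Tendsto (fun y => y - c) (𝓝[≠] x) (𝓝[≠] (x - c)) := by
    refine tendsto_nhdsWithin_iff.mpr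
      ⟨((continuous_sub_right c).tendsto x).mono_left nhdsWithin_le_nhds, ?_⟩
    filter_upwards [self_mem_nhdsWithin] with y hy h
    exact hy (sub_left_injective h)
  exact ht.eventually h

lemma tendsto_div : Tendsto (fun x => f x / x) (𝓝[≠] 0) (𝓝 (deriv f 0)) := by
  have := hasDerivAt_iff_tendsto_slope_zero.mp (hf.differentiable 0).hasDerivAt
  refine this.congr fun x => ?_
  rw [zero_add, hf.map_zero, sub_zero, smul_eq_mul, inv_mul_eq_div]

lemma tendsto_mul_inv : Tendsto (fun x => x * (f x)⁻¹) (𝓝[≠] 0) (𝓝 (deriv f 0)⁻¹) := by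
  refine (hf.tendsto_div.inv₀ hf.deriv_ne_zero).congr fun x => ?_
  rw [inv_div, div_eq_mul_inv]

end IsOddTheta

/-- Carries a residue from one point to its translates by periods, so that limits need computing at
one representative only. -/
lemma tendsto_punctured_of_add {h : ℂ → ℂ} {l x a : ℂ} (hl : ∀ y, h (y + l) = h y)
    (hx : Tendsto (fun y => (y - x) * h y) (𝓝[≠] x) (𝓝 a)) :
    Tendsto (fun y => (y - (x + l)) * h y) (𝓝[≠] (x + l)) (𝓝 a) := by
  have ht : Tendsto (fun y => y - l) (𝓝[≠] (x + l)) (𝓝[≠] x) := by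
    refine tendsto_nhdsWithin_iff.mpr ⟨?_, ?_⟩
    · have := (continuous_sub_right l).tendsto (x + l)
      rw [add_sub_cancel_right] at this
      exact this.mono_left nhdsWithin_le_nhds
    · filter_upwards [self_mem_nhdsWithin] with y hy h
      exact hy (sub_eq_iff_eq_add.mp h)
  refine (hx.comp ht).congr fun y => ?_
  simp only [Function.comp]
  rw [← hl (y - l), sub_add_cancel]
  ring

/-! ### The theta function as a product -/

/-- The shift by `1/2` produces `(-1)^n`, and the shift by `δ/2` completes `p^{n²/2}` to
`p^{n(n+1)/2}`. -/
lemma theta_eq_jacobiTheta₂ (δ x : ℂ) : theta δ x =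
    -I * cexp (Real.pi * I * δ / 4) * cexp (Real.pi * I * x) *
      jacobiTheta₂ (x + 1 / 2 + δ / 2) δ := by
  rw [theta, jacobiTheta₂]
  congr 1
  refine tsum_congr fun n => ?_
  rw [jacobiTheta₂_term, ← Complex.exp_pi_mul_I, ← Complex.exp_int_mul, ← Complex.exp_add,
    ← Complex.exp_add]
  congr 1
  ring

section

variable {δ : ℂ} (hδ : 0 < δ.im)
include hδ

lemma differentiable_theta : Differentiable ℂ (theta δ) := by
  rw [show theta δ = _ from funext (theta_eq_jacobiTheta₂ δ)]
  intro x
  have h : DifferentiableAt ℂ (fun x => jacobiTheta₂ (x + 1 / 2 + δ / 2) δ) x :=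
    (differentiableAt_jacobiTheta₂_fst _ hδ).comp x (by fun_prop)
  exact (by fun_prop : DifferentiableAt ℂ
    (fun x : ℂ => -I * cexp (Real.pi * I * δ / 4) * cexp (Real.pi * I * x)) x).mul h

omit hδ in
lemma theta_add_one (x : ℂ) : theta δ (x + 1) = -theta δ x := by
  have := theta_add_int δ x 1
  rw [Int.cast_one, mul_one, Complex.exp_pi_mul_I] at this
  rw [this]; ring

omit hδ in
lemma theta_add_tau (x : ℂ) :
    theta δ (x + δ) = -(cexp (-(Real.pi * I * δ)) * (e x)⁻¹ * theta δ x) := by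
  rw [theta_eq_jacobiTheta₂, theta_eq_jacobiTheta₂,
    show x + δ + 1 / 2 + δ / 2 = x + 1 / 2 + δ / 2 + δ by ring, jacobiTheta₂_add_left',
    ← e_neg, e]
  have h : cexp (Real.pi * I * (x + δ)) * cexp (-Real.pi * I * (δ + 2 * (x + 1 / 2 + δ / 2))) =
      -(cexp (-(Real.pi * I * δ)) * cexp (2 * Real.pi * I * -x) * cexp (Real.pi * I * x)) := by
    rw [← Complex.exp_add, ← Complex.exp_add, ← Complex.exp_add, neg_eq_neg_one_mul (cexp _),
      ← Complex.exp_neg_pi_mul_I, ← Complex.exp_add]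
    congr 1
    ring
  linear_combination (-I * cexp (Real.pi * I * δ / 4) *
    jacobiTheta₂ (x + 1 / 2 + δ / 2) δ) * h

omit hδ in
lemma theta_neg (x : ℂ) : theta δ (-x) = -theta δ x := by
  rw [theta_eq_jacobiTheta₂, theta_eq_jacobiTheta₂, ← jacobiTheta₂_neg_left,
    ← jacobiTheta₂_add_left,
    show x + 1 / 2 + δ / 2 = -(-x + 1 / 2 + δ / 2) + 1 + δ by ring, jacobiTheta₂_add_left']
  have h : cexp (Real.pi * I * x) *
      cexp (-Real.pi * I * (δ + 2 * (-(-x + 1 / 2 + δ / 2) + 1))) =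
      -cexp (Real.pi * I * -x) := by
    rw [← Complex.exp_add, neg_eq_neg_one_mul (cexp _), ← Complex.exp_neg_pi_mul_I,
      ← Complex.exp_add]
    congr 1
    ring
  linear_combination (-I * cexp (Real.pi * I * δ / 4) *
    jacobiTheta₂ (-(-x + 1 / 2 + δ / 2) + 1) δ) * h

/-- Both functions have the same multipliers, so their quotient is elliptic. The theta function is
odd and vanishes at `0`, which makes the singularities at lattice points removable. The quotient is
thus constant off the lattice, and continuity gives the equation on the lattice. -/
lemma exists_theta_eq_mul_oddProd : ∃ c : ℂ, ∀ x, theta δ x = c * oddProd δ x := by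
  have hf := isOddTheta_oddProd hδ
  have h1 : ∀ x, theta δ (x + 1) / oddProd δ (x + 1) = theta δ x / oddProd δ x := fun x => by
    rw [theta_add_one, hf.add_one, neg_div_neg_eq]
  have h2 : ∀ x, theta δ (x + δ) / oddProd δ (x + δ) = theta δ x / oddProd δ x := fun x => by
    rw [theta_add_tau, hf.add_tau, neg_div_neg_eq, mul_div_mul_left]
    exact mul_ne_zero (Complex.exp_ne_zero _) (inv_ne_zero (e_ne_zero x))
  have h0 : theta δ 0 = 0 := by
    have := theta_neg (δ := δ) 0
    rw [neg_zero] at this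
    linear_combination (1 / 2 : ℂ) * this
  have hlim0 : Tendsto (fun y => (y - 0) * (theta δ y / oddProd δ y)) (𝓝[≠] 0) (𝓝 0) := by
    have := hf.tendsto_mul_inv.mul
      (((differentiable_theta hδ).continuous.tendsto 0).mono_left nhdsWithin_le_nhds)
    rw [h0, mul_zero] at this
    refine this.congr fun y => ?_
    rw [sub_zero]
    ring
  obtain ⟨x0, hx0⟩ := (hf.eventually_notMem_lattice 0).exists
  have key : ∀ x ∉ lattice δ, theta δ x / oddProd δ x = theta δ x0 / oddProd δ x0 := by
    intro x hx
    refine eq_of_doublyPeriodic hδ (h := fun x => theta δ x / oddProd δ x)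
      (S := lattice δ) hf.eventually_notMem_lattice ?_ h1 h2 ?_ hx hx0
    · intro y hy
      exact (differentiable_theta hδ y).div (hf.differentiable y) (hf.ne_zero hy)
    · intro y hy
      have := tendsto_punctured_of_add (x := 0) (fun z => add_lattice_eq h1 h2 hy z) hlim0
      simpa only [zero_add] using this
  refine ⟨theta δ x0 / oddProd δ x0, fun x => ?_⟩
  have hcont : Continuous fun x => theta δ x - theta δ x0 / oddProd δ x0 * oddProd δ x :=
    (differentiable_theta hδ).continuous.sub (hf.differentiable.continuous.const_mul _)
  have hlim : Tendsto (fun x => theta δ x - theta δ x0 / oddProd δ x0 * oddProd δ x)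
      (𝓝[≠] x) (𝓝 0) := by
    refine tendsto_const_nhds.congr' ?_
    filter_upwards [hf.eventually_notMem_lattice x] with y hy
    rw [← key y hy, div_mul_cancel₀ _ (hf.ne_zero hy), sub_self]
  exact sub_eq_zero.mp (tendsto_nhds_unique
    ((hcont.tendsto x).mono_left nhdsWithin_le_nhds) hlim)

end

/-! ### A symmetric-function identity for elliptic functions -/

section splitSum

variable {ι : Type*} [DecidableEq ι]

/-- `∏_{i ∈ I, j ∈ s ∖ I} v(z_i - z_j)`. -/
def splitProd (v : ℂ → ℂ) (z : ι → ℂ) (s I : Finset ι) : ℂ :=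
  ∏ i ∈ I, ∏ j ∈ s \ I, v (z i - z j)

/-- `∑_{I ⊆ s} c_{|I|} ∏_{i ∈ I, j ∈ s ∖ I} v(z_i - z_j)`. -/
def splitSum (v : ℂ → ℂ) (c : ℕ → ℂ) (s : Finset ι) (z : ι → ℂ) : ℂ :=
  ∑ I ∈ s.powerset, c I.card * splitProd v z s I

/-- Elliptic functions with at most simple poles at `0` and `-β` and symmetric under
`x ↦ -x - β`. -/
structure IsTwoPole (δ β ρ : ℂ) (v : ℂ → ℂ) : Prop where
  add_one : ∀ x, v (x + 1) = v x
  add_tau : ∀ x, v (x + δ) = v x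
  differentiableAt : ∀ x, x ∉ lattice δ → x + β ∉ lattice δ → DifferentiableAt ℂ v x
  reflect : ∀ x, v (-x - β) = v x
  tendsto_zero : Tendsto (fun x => x * v x) (𝓝[≠] 0) (𝓝 ρ)

lemma tendsto_neg_punctured_zero : Tendsto (fun x : ℂ => -x) (𝓝[≠] 0) (𝓝[≠] 0) := by
  refine tendsto_nhdsWithin_iff.mpr ⟨?_, ?_⟩
  · have := (continuous_neg (G := ℂ)).tendsto 0
    rw [neg_zero] at this
    exact this.mono_left nhdsWithin_le_nhds
  · filter_upwards [self_mem_nhdsWithin] with y hy h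
    exact hy (neg_eq_zero.mp h)

lemma tendsto_sub_punctured (c : ℂ) : Tendsto (fun x : ℂ => x - c) (𝓝[≠] c) (𝓝[≠] 0) := by
  refine tendsto_nhdsWithin_iff.mpr ⟨?_, ?_⟩
  · have := (continuous_sub_right c).tendsto c
    rw [sub_self] at this
    exact this.mono_left nhdsWithin_le_nhds
  · filter_upwards [self_mem_nhdsWithin] with y hy h
    exact hy (sub_eq_zero.mp h)

namespace IsTwoPole

variable {δ β ρ : ℂ} {v : ℂ → ℂ} (hv : IsTwoPole δ β ρ v)
include hv

/-- Makes every residue computation for `v` available for its reflection, that is, for the other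
side of the identity. -/
lemma neg : IsTwoPole δ (-β) (-ρ) fun x => v (-x) where
  add_one x := by rw [← hv.add_one, neg_add, neg_add_cancel_right]
  add_tau x := by rw [← hv.add_tau, neg_add, neg_add_cancel_right]
  differentiableAt x h1 h2 := by
    have h : DifferentiableAt ℂ v (-x) := by
      refine hv.differentiableAt _ (fun h => h1 (neg_mem_iff.mp h)) fun h => h2 ?_
      rw [← neg_mem_iff]
      simpa [add_comm] using h
    exact h.comp x differentiableAt_id.neg
  reflect x := by
    rw [← hv.reflect]
    congr 1
    ring
  tendsto_zero := by
    refine (hv.tendsto_zero.comp tendsto_neg_punctured_zero).neg.congr fun x => ?_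
    simp

lemma add_lattice {l : ℂ} (hl : l ∈ lattice δ) (x : ℂ) : v (x + l) = v x :=
  add_lattice_eq hv.add_one hv.add_tau hl x

lemma sub_lattice {l : ℂ} (hl : l ∈ lattice δ) (x : ℂ) : v (x - l) = v x := by
  rw [sub_eq_add_neg, hv.add_lattice (neg_mem hl)]

end IsTwoPole

/-- The points `z_i`, `i ∈ s`, are in general position with respect to shifts by `β`. -/
def Generic (δ β : ℂ) (s : Finset ι) (z : ι → ℂ) : Prop :=
  ∀ i ∈ s, ∀ j ∈ s, i ≠ j → ∀ m : ℤ, |m| ≤ 2 → z i - z j + m * β ∉ lattice δ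

omit [DecidableEq ι] in
lemma Generic.mono {δ β : ℂ} {s t : Finset ι} {z : ι → ℂ} (h : Generic δ β s z) (hts : t ⊆ s) :
    Generic δ β t z :=
  fun i hi j hj => h i (hts hi) j (hts hj)

omit [DecidableEq ι] in
lemma Generic.neg_beta {δ β : ℂ} {s : Finset ι} {z : ι → ℂ} (h : Generic δ β s z) :
    Generic δ (-β) s z := by
  intro i hi j hj hij m hm
  have := h i hi j hj hij (-m) (by rwa [abs_neg])
  rwa [Int.cast_neg, neg_mul, ← mul_neg] at this

lemma sum_powerset_insert_insert {M : Type*} [AddCommMonoid M] {a b : ι} {t : Finset ι}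
    (hab : a ≠ b) (ha : a ∉ t) (hb : b ∉ t) (g : Finset ι → M) :
    ∑ I ∈ (insert a (insert b t)).powerset, g I =
      ∑ J ∈ t.powerset, (g J + g (insert b J) + (g (insert a J) + g (insert a (insert b J)))) := by
  rw [Finset.sum_powerset_insert (by simp [hab, ha]), Finset.sum_powerset_insert hb,
    Finset.sum_powerset_insert hb]
  simp only [Finset.sum_add_distrib]

section split

variable (v : ℂ → ℂ) (z : ι → ℂ) {a b : ι} {t J : Finset ι} (hab : a ≠ b) (ha : a ∉ t)
  (hb : b ∉ t) (hJ : J ⊆ t) (x : ℂ)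
include hab ha hb hJ

lemma splitProd_none : splitProd v (Function.update z a x) (insert a (insert b t)) J =
    (∏ i ∈ J, v (z i - x)) * (∏ i ∈ J, v (z i - z b)) * splitProd v z t J := by
  have haJ : a ∉ J := fun h => ha (hJ h)
  have hbJ : b ∉ J := fun h => hb (hJ h)
  unfold splitProd
  rw [Finset.insert_sdiff_of_notMem _ haJ, Finset.insert_sdiff_of_notMem _ hbJ,
    ← Finset.prod_mul_distrib, ← Finset.prod_mul_distrib]
  refine Finset.prod_congr rfl fun i hi => ?_
  have hia : i ≠ a := fun h => haJ (h ▸ hi)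
  rw [Finset.prod_insert (by simp [hab, ha]), Finset.prod_insert (by simp [hb]),
    Function.update_self, Function.update_of_ne hia, Function.update_of_ne hab.symm, mul_assoc]
  congr 2
  refine Finset.prod_congr rfl fun j hj => ?_
  rw [Function.update_of_ne]
  rintro rfl
  exact ha (Finset.mem_sdiff.mp hj).1

lemma splitProd_right : splitProd v (Function.update z a x) (insert a (insert b t)) (insert b J) =
    v (z b - x) * (∏ j ∈ t \ J, v (z b - z j)) * (∏ i ∈ J, v (z i - x)) * splitProd v z t J := by
  have haJ : a ∉ J := fun h => ha (hJ h)
  have hbJ : b ∉ J := fun h => hb (hJ h)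
  unfold splitProd
  have hs : insert a (insert b t) \ insert b J = insert a (t \ J) := by
    ext i
    simp only [Finset.mem_sdiff, Finset.mem_insert]
    constructor
    · tauto
    · rintro (rfl | ⟨h1, h2⟩)
      · tauto
      · exact ⟨Or.inr (Or.inr h1), by rintro (rfl | h) <;> tauto⟩
  have hj : ∀ j ∈ t \ J, j ≠ a := by
    rintro j hj rfl
    exact ha (Finset.mem_sdiff.mp hj).1
  rw [hs, Finset.prod_insert hbJ, Finset.prod_insert (by simp [ha]), Function.update_self,
    Function.update_of_ne hab.symm, Finset.prod_congr rfl fun j h => by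
      rw [Function.update_of_ne (hj j h)], mul_assoc _ (∏ i ∈ J, v (z i - x)),
      ← Finset.prod_mul_distrib]
  congr 1
  refine Finset.prod_congr rfl fun i hi => ?_
  have hia : i ≠ a := fun h => haJ (h ▸ hi)
  rw [Finset.prod_insert (by simp [ha]), Function.update_self, Function.update_of_ne hia]
  congr 1
  exact Finset.prod_congr rfl fun j h => by rw [Function.update_of_ne (hj j h)]

lemma splitProd_left : splitProd v (Function.update z a x) (insert a (insert b t)) (insert a J) =
    v (x - z b) * (∏ j ∈ t \ J, v (x - z j)) * (∏ i ∈ J, v (z i - z b)) * splitProd v z t J := by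
  have haJ : a ∉ J := fun h => ha (hJ h)
  have hbJ : b ∉ J := fun h => hb (hJ h)
  unfold splitProd
  have hs : insert a (insert b t) \ insert a J = insert b (t \ J) := by
    ext i
    simp only [Finset.mem_sdiff, Finset.mem_insert]
    constructor
    · tauto
    · rintro (rfl | ⟨h1, h2⟩)
      · exact ⟨Or.inr (Or.inl rfl), by rintro (h | h); exacts [hab h.symm, hbJ h]⟩
      · exact ⟨Or.inr (Or.inr h1), by rintro (rfl | h) <;> tauto⟩
  have hj : ∀ j ∈ t \ J, j ≠ a := by
    rintro j hj rfl
    exact ha (Finset.mem_sdiff.mp hj).1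
  rw [hs, Finset.prod_insert haJ, Finset.prod_insert (by simp [hb]), Function.update_self,
    Function.update_of_ne hab.symm, Finset.prod_congr rfl fun j h => by
      rw [Function.update_of_ne (hj j h)], mul_assoc _ (∏ i ∈ J, v (z i - z b)),
      ← Finset.prod_mul_distrib]
  congr 1
  refine Finset.prod_congr rfl fun i hi => ?_
  have hia : i ≠ a := fun h => haJ (h ▸ hi)
  rw [Finset.prod_insert (by simp [hb]), Function.update_of_ne hia, Function.update_of_ne hab.symm]
  congr 1
  exact Finset.prod_congr rfl fun j h => by rw [Function.update_of_ne (hj j h)]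

lemma splitProd_both :
    splitProd v (Function.update z a x) (insert a (insert b t)) (insert a (insert b J)) =
      (∏ j ∈ t \ J, v (x - z j)) * (∏ j ∈ t \ J, v (z b - z j)) * splitProd v z t J := by
  have haJ : a ∉ J := fun h => ha (hJ h)
  have hbJ : b ∉ J := fun h => hb (hJ h)
  unfold splitProd
  have hs : insert a (insert b t) \ insert a (insert b J) = t \ J := by
    ext i
    simp only [Finset.mem_sdiff, Finset.mem_insert]
    constructor
    · tauto
    · rintro ⟨h1, h2⟩
      exact ⟨Or.inr (Or.inr h1), by rintro (rfl | rfl | h) <;> tauto⟩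
  have hj : ∀ j ∈ t \ J, j ≠ a := by
    rintro j hj rfl
    exact ha (Finset.mem_sdiff.mp hj).1
  rw [hs, Finset.prod_insert (by simp [hab, haJ]), Finset.prod_insert hbJ, Function.update_self,
    Function.update_of_ne hab.symm, mul_assoc]
  congr 1
  · exact Finset.prod_congr rfl fun j h => by rw [Function.update_of_ne (hj j h)]
  congr 1
  · exact Finset.prod_congr rfl fun j h => by rw [Function.update_of_ne (hj j h)]
  refine Finset.prod_congr rfl fun i hi => ?_
  have hia : i ≠ a := fun h => haJ (h ▸ hi)
  rw [Function.update_of_ne hia]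
  exact Finset.prod_congr rfl fun j h => by rw [Function.update_of_ne (hj j h)]

end split

/-- The limit of `(x - x₀) ∑_I ⋯` when `z_a = x` approaches `x₀`, in terms of the limits of
`(x - x₀) v(x - z_b)` and `(x - x₀) v(z_b - x)`. -/
lemma tendsto_splitSum_update {v : ℂ → ℂ} {z : ι → ℂ} {a b : ι} {t : Finset ι} (hab : a ≠ b)
    (ha : a ∉ t) (hb : b ∉ t) (c : ℕ → ℂ) {x₀ r₁ r₂ : ℂ}
    (hc₁ : ∀ j ∈ t, ContinuousAt (fun x => v (x - z j)) x₀)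
    (hc₂ : ∀ j ∈ t, ContinuousAt (fun x => v (z j - x)) x₀)
    (h₁ : Tendsto (fun x => (x - x₀) * v (x - z b)) (𝓝[≠] x₀) (𝓝 r₁))
    (h₂ : Tendsto (fun x => (x - x₀) * v (z b - x)) (𝓝[≠] x₀) (𝓝 r₂)) :
    Tendsto (fun x => (x - x₀) *
        splitSum v c (insert a (insert b t)) (Function.update z a x)) (𝓝[≠] x₀)
      (𝓝 (∑ J ∈ t.powerset, c (J.card + 1) * splitProd v z t J *
        (r₂ * (∏ j ∈ t \ J, v (z b - z j)) * (∏ i ∈ J, v (z i - x₀)) +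
          r₁ * (∏ j ∈ t \ J, v (x₀ - z j)) * (∏ i ∈ J, v (z i - z b))))) := by
  have h0 : Tendsto (fun x : ℂ => x - x₀) (𝓝[≠] x₀) (𝓝 0) :=
    (tendsto_sub_punctured x₀).mono_right nhdsWithin_le_nhds
  simp only [splitSum, sum_powerset_insert_insert hab ha hb, Finset.mul_sum]
  refine tendsto_finsetSum _ fun J hJ => ?_
  rw [Finset.mem_powerset] at hJ
  have haJ : a ∉ J := fun h => ha (hJ h)
  have hbJ : b ∉ J := fun h => hb (hJ h)
  have hα : Tendsto (fun x => ∏ j ∈ t \ J, v (x - z j)) (𝓝[≠] x₀)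
      (𝓝 (∏ j ∈ t \ J, v (x₀ - z j))) :=
    tendsto_finsetProd _ fun j hj => (hc₁ j (Finset.mem_sdiff.mp hj).1).tendsto.mono_left
      nhdsWithin_le_nhds
  have hω : Tendsto (fun x => ∏ i ∈ J, v (z i - x)) (𝓝[≠] x₀) (𝓝 (∏ i ∈ J, v (z i - x₀))) :=
    tendsto_finsetProd _ fun j hj => (hc₂ j (hJ hj)).tendsto.mono_left nhdsWithin_le_nhds
  -- The four summands have neither `a` nor `b`, only `b`, only `a`, or both in `I`. In the first
  -- and last, `v` is never evaluated at `±(x - z b)`, so the factor `x - x₀` kills them.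
  have hlim := ((((h0.mul hω).mul_const (c J.card * (∏ i ∈ J, v (z i - z b)) *
      splitProd v z t J)).add ((h₂.mul hω).mul_const
        (c (J.card + 1) * (∏ j ∈ t \ J, v (z b - z j)) * splitProd v z t J))).add
      (((h₁.mul hα).mul_const
        (c (J.card + 1) * (∏ i ∈ J, v (z i - z b)) * splitProd v z t J)).add
      ((h0.mul hα).mul_const (c (J.card + 2) * (∏ j ∈ t \ J, v (z b - z j)) *
        splitProd v z t J))))
  have e1 : (insert b J).card = J.card + 1 := Finset.card_insert_of_notMem hbJ
  have e2 : (insert a J).card = J.card + 1 := Finset.card_insert_of_notMem haJ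
  have e3 : (insert a (insert b J)).card = J.card + 2 := by
    rw [Finset.card_insert_of_notMem (by simp [hab, haJ]), e1]
  refine (hlim.congr fun x => ?_).trans (le_of_eq ?_)
  · rw [splitProd_none v z hab ha hb hJ, splitProd_right v z hab ha hb hJ,
      splitProd_left v z hab ha hb hJ, splitProd_both v z hab ha hb hJ, e1, e2, e3]
    ring
  · congr 1
    ring

/-! ### Residues of the split sum in one variable -/

section poles

variable {δ β ρ : ℂ} {v : ℂ → ℂ} (hv : IsTwoPole δ β ρ v) {z : ι → ℂ} {a b : ι} {t : Finset ι}
  (hab : a ≠ b) (ha : a ∉ t) (hb : b ∉ t) (hz : Generic δ β (insert b t) z) (c : ℕ → ℂ)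
include hv

lemma IsTwoPole.continuousAt_sub {x₀ w : ℂ} (h1 : x₀ - w ∉ lattice δ)
    (h2 : x₀ - w + β ∉ lattice δ) : ContinuousAt (fun x => v (x - w)) x₀ :=
  ContinuousAt.comp (f := fun x => x - w) (hv.differentiableAt _ h1 h2).continuousAt
    (continuous_sub_right w).continuousAt

lemma IsTwoPole.continuousAt_sub' {x₀ w : ℂ} (h1 : w - x₀ ∉ lattice δ)
    (h2 : w - x₀ + β ∉ lattice δ) : ContinuousAt (fun x => v (w - x)) x₀ :=
  ContinuousAt.comp (f := fun x => w - x) (hv.differentiableAt _ h1 h2).continuousAt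
    (continuous_sub_left w).continuousAt

include hb hz in
lemma IsTwoPole.continuousAt_aux {k : ℤ} (hk : |k| ≤ 1) {j : ι} (hj : j ∈ t) :
    ContinuousAt (fun x => v (x - z j)) (z b + k * β) ∧
      ContinuousAt (fun x => v (z j - x)) (z b + k * β) := by
  have hjb : b ≠ j := by rintro rfl; exact hb hj
  have hbj := hz b (by simp) j (by simp [hj]) hjb
  have hbj' := hz j (by simp [hj]) b (by simp) hjb.symm
  rw [abs_le] at hk
  refine ⟨hv.continuousAt_sub ?_ ?_, hv.continuousAt_sub' ?_ ?_⟩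
  -- Avoiding the poles `0` and `-β` of `v` involves the multiples `k`, `k + 1`, `-k`, `-k + 1` of
  -- `β`; this is where the bound `2` in `Generic` comes from.
  · convert hbj k (abs_le.mpr (by omega)) using 1; ring_nf
  · convert hbj (k + 1) (abs_le.mpr (by omega)) using 1; push_cast; ring_nf
  · convert hbj' (-k) (abs_le.mpr (by omega)) using 1; push_cast; ring_nf
  · convert hbj' (-k + 1) (abs_le.mpr (by omega)) using 1; push_cast; ring_nf

lemma IsTwoPole.reflect_sub (x y : ℂ) : v (x - β - y) = v (y - x) := by
  rw [← hv.reflect]; congr 1; ring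

lemma IsTwoPole.reflect_sub' (x y : ℂ) : v (y - (x + β)) = v (x - y) := by
  rw [← hv.reflect]; congr 1; ring

include hab ha hb hz

/-- At `z_a = z_b` the sets `J ∪ {a}` and `J ∪ {b}` have opposite residues, so the pole cancels for
each `J` separately, within a single split sum. -/
lemma IsTwoPole.tendsto_splitSum_self :
    Tendsto (fun x => (x - z b) *
      splitSum v c (insert a (insert b t)) (Function.update z a x)) (𝓝[≠] z b) (𝓝 0) := by
  have hc := fun j (hj : j ∈ t) => hv.continuousAt_aux hb hz (k := 0) (by simp) hj
  simp only [Int.cast_zero, zero_mul, add_zero] at hc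
  have h1 : Tendsto (fun x => (x - z b) * v (x - z b)) (𝓝[≠] z b) (𝓝 ρ) :=
    hv.tendsto_zero.comp (tendsto_sub_punctured (z b))
  have h2 : Tendsto (fun x => (x - z b) * v (z b - x)) (𝓝[≠] z b) (𝓝 (-ρ)) := by
    refine (hv.neg.tendsto_zero.comp (tendsto_sub_punctured (z b))).congr fun x => ?_
    simp
  refine (tendsto_splitSum_update hab ha hb c (fun j hj => (hc j hj).1)
    (fun j hj => (hc j hj).2) h1 h2).trans (le_of_eq ?_)
  congr 1
  refine Finset.sum_eq_zero fun J _ => ?_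
  ring

variable (hβ : β ∉ lattice δ) (hβ' : 2 * β ∉ lattice δ)
include hβ hβ'

/-- Only sets containing `a` but not `b` contribute. By reflection `v(z_b - β - z_j) = v(z_j -
z_b)`, so the products over `J` and `t \ J` merge into one over `t`, independent of `J`. What
remains is the split sum for `t`, with `c` shifted to account for `a`. -/
lemma IsTwoPole.tendsto_splitSum_sub :
    Tendsto (fun x => (x - (z b - β)) *
      splitSum v c (insert a (insert b t)) (Function.update z a x)) (𝓝[≠] (z b - β))
      (𝓝 (-ρ * (∏ j ∈ t, v (z j - z b)) * splitSum v (fun n => c (n + 1)) t z)) := by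
  have hc := fun j (hj : j ∈ t) => hv.continuousAt_aux hb hz (k := -1) (by simp) hj
  simp only [Int.cast_neg, Int.cast_one, neg_mul, one_mul, ← sub_eq_add_neg] at hc
  have h1 : Tendsto (fun x => (x - (z b - β)) * v (x - z b)) (𝓝[≠] (z b - β)) (𝓝 (-ρ)) := by
    refine (hv.neg.tendsto_zero.comp (tendsto_sub_punctured (z b - β))).congr fun x => ?_
    simp only [Function.comp]
    rw [← hv.reflect (x - z b)]
    congr 2
    ring
  -- In the opposite orientation the argument tends to `β`, which avoids the poles `0` and `-β`
  -- because neither `β` nor `2 * β` is a lattice point.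
  have h2 : Tendsto (fun x => (x - (z b - β)) * v (z b - x)) (𝓝[≠] (z b - β)) (𝓝 0) := by
    have hcont : ContinuousAt (fun x => v (z b - x)) (z b - β) := by
      refine hv.continuousAt_sub' ?_ ?_
      · rwa [sub_sub_cancel]
      · rwa [sub_sub_cancel, ← two_mul]
    have := (((tendsto_sub_punctured (z b - β)).mono_right nhdsWithin_le_nhds).mul
      (hcont.tendsto.mono_left nhdsWithin_le_nhds))
    rwa [zero_mul] at this
  refine (tendsto_splitSum_update hab ha hb c (fun j hj => (hc j hj).1)
    (fun j hj => (hc j hj).2) h1 h2).trans (le_of_eq ?_)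
  congr 1
  rw [splitSum, Finset.mul_sum]
  refine Finset.sum_congr rfl fun J hJ => ?_
  simp only [hv.reflect_sub]
  rw [← Finset.prod_sdiff (Finset.mem_powerset.mp hJ)]
  ring

/-- The mirror image of `tendsto_splitSum_sub`: now the sets containing `b` but not `a` carry the
pole. -/
lemma IsTwoPole.tendsto_splitSum_add :
    Tendsto (fun x => (x - (z b + β)) *
      splitSum v c (insert a (insert b t)) (Function.update z a x)) (𝓝[≠] (z b + β))
      (𝓝 (ρ * (∏ j ∈ t, v (z b - z j)) * splitSum v (fun n => c (n + 1)) t z)) := by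
  have hc := fun j (hj : j ∈ t) => hv.continuousAt_aux hb hz (k := 1) (by simp) hj
  simp only [Int.cast_one, one_mul] at hc
  have h2 : Tendsto (fun x => (x - (z b + β)) * v (z b - x)) (𝓝[≠] (z b + β)) (𝓝 ρ) := by
    refine (hv.tendsto_zero.comp (tendsto_sub_punctured (z b + β))).congr fun x => ?_
    simp only [Function.comp]
    rw [← hv.reflect (z b - x)]
    congr 2
    ring
  have h1 : Tendsto (fun x => (x - (z b + β)) * v (x - z b)) (𝓝[≠] (z b + β)) (𝓝 0) := by
    have hcont : ContinuousAt (fun x => v (x - z b)) (z b + β) := by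
      refine hv.continuousAt_sub ?_ ?_
      · rwa [add_sub_cancel_left]
      · rwa [add_sub_cancel_left, ← two_mul]
    have := (((tendsto_sub_punctured (z b + β)).mono_right nhdsWithin_le_nhds).mul
      (hcont.tendsto.mono_left nhdsWithin_le_nhds))
    rwa [zero_mul] at this
  refine (tendsto_splitSum_update hab ha hb c (fun j hj => (hc j hj).1)
    (fun j hj => (hc j hj).2) h1 h2).trans (le_of_eq ?_)
  congr 1
  rw [splitSum, Finset.mul_sum]
  refine Finset.sum_congr rfl fun J hJ => ?_
  simp only [hv.reflect_sub']
  rw [← Finset.prod_sdiff (Finset.mem_powerset.mp hJ)]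
  ring

/-- The antisymmetrised sum has no pole at `z_a = z_b + kβ`, provided that it vanishes for the
remaining points. -/
lemma IsTwoPole.tendsto_splitSum_antisymm
    (ih : splitSum v (fun n => c (n + 1)) t z =
      splitSum (fun x => v (-x)) (fun n => c (n + 1)) t z) {k : ℤ} (hk : |k| ≤ 1) :
    Tendsto (fun x => (x - (z b + k * β)) *
      (splitSum v c (insert a (insert b t)) (Function.update z a x) -
        splitSum (fun x => v (-x)) c (insert a (insert b t)) (Function.update z a x)))
      (𝓝[≠] (z b + k * β)) (𝓝 0) := by
  have hz' := hz.neg_beta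
  have hm : -β ∉ lattice δ := fun h => hβ (neg_mem_iff.mp h)
  have hm' : 2 * -β ∉ lattice δ := fun h => hβ' (by rw [mul_neg] at h; exact neg_mem_iff.mp h)
  have hk' : k = 0 ∨ k = 1 ∨ k = -1 := by rw [abs_le] at hk; omega
  simp only [mul_sub]
  rcases hk' with rfl | rfl | rfl
  · have := (hv.tendsto_splitSum_self hab ha hb hz c).sub
      (hv.neg.tendsto_splitSum_self hab ha hb hz' c)
    rw [sub_zero] at this
    simpa only [Int.cast_zero, zero_mul, add_zero] using this
  -- The reflection has `-β` in place of `β`, so its residue at `z_b + β` is given by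
  -- `tendsto_splitSum_sub`. The products over `t` agree, and `ih` identifies the remaining factors.
  · have := (hv.tendsto_splitSum_add hab ha hb hz c hβ hβ').sub
      (sub_neg_eq_add (z b) β ▸ hv.neg.tendsto_splitSum_sub hab ha hb hz' c hm hm')
    rw [← ih] at this
    simpa only [Int.cast_one, one_mul, neg_neg, neg_sub, sub_self] using this
  · have := (hv.tendsto_splitSum_sub hab ha hb hz c hβ hβ').sub
      ((sub_eq_add_neg (z b) β).symm ▸ hv.neg.tendsto_splitSum_add hab ha hb hz' c hm hm')
    rw [← ih] at this
    simpa only [Int.cast_neg, Int.cast_one, neg_mul, one_mul, ← sub_eq_add_neg, neg_sub,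
      sub_self] using this

end poles

end splitSum

/-! ### Ellipticity and vanishing of the antisymmetrised sum -/

section splitSum

variable {ι : Type*} [DecidableEq ι]

lemma eventually_notMem_lattice_sub {δ : ℂ} (hδ : 0 < δ.im) (x c : ℂ) :
    ∀ᶠ y in 𝓝[≠] x, y - c ∉ lattice δ :=
  (isOddTheta_oddProd hδ).eventually_notMem_lattice_sub x c

/-- The difference of `v(z_i - z_j)` sums with `v` and its reflection. -/
def splitDiff (v : ℂ → ℂ) (c : ℕ → ℂ) (s : Finset ι) (z : ι → ℂ) : ℂ :=
  splitSum v c s z - splitSum (fun x => v (-x)) c s z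

namespace IsTwoPole

variable {δ β ρ : ℂ} {v : ℂ → ℂ} (hv : IsTwoPole δ β ρ v)
include hv

lemma splitSum_update_add (c : ℕ → ℂ) (s : Finset ι) (z : ι → ℂ) (a : ι) (x : ℂ) {l : ℂ}
    (hl : l ∈ lattice δ) :
    splitSum v c s (Function.update z a (x + l)) = splitSum v c s (Function.update z a x) := by
  have key : ∀ i j, v (Function.update z a (x + l) i - Function.update z a (x + l) j) =
      v (Function.update z a x i - Function.update z a x j) := by
    intro i j
    by_cases hi : i = a <;> by_cases hj : j = a
    · subst hi; subst hj; simp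
    · subst hi
      rw [Function.update_self, Function.update_self, Function.update_of_ne hj,
        Function.update_of_ne hj, add_sub_right_comm, hv.add_lattice hl]
    · subst hj
      rw [Function.update_self, Function.update_self, Function.update_of_ne hi,
        Function.update_of_ne hi, ← sub_sub, hv.sub_lattice hl]
    · rw [Function.update_of_ne hj, Function.update_of_ne hi, Function.update_of_ne hi,
        Function.update_of_ne hj]
  simp only [splitSum, splitProd, key]

lemma splitDiff_update_add (c : ℕ → ℂ) (s : Finset ι) (z : ι → ℂ) (a : ι) (x : ℂ) {l : ℂ}
    (hl : l ∈ lattice δ) :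
    splitDiff v c s (Function.update z a (x + l)) = splitDiff v c s (Function.update z a x) := by
  rw [splitDiff, hv.splitSum_update_add c s z a x hl, hv.neg.splitSum_update_add c s z a x hl,
    splitDiff]

lemma differentiableAt_splitSum_update (c : ℕ → ℂ) {s : Finset ι} {z : ι → ℂ} {a : ι}
    (hz : Generic δ β (s.erase a) z) {x : ℂ}
    (hx : ∀ b ∈ s.erase a, ∀ m : ℤ, |m| ≤ 1 → x - (z b + m * β) ∉ lattice δ) :
    DifferentiableAt ℂ (fun x => splitSum v c s (Function.update z a x)) x := by
  refine DifferentiableAt.fun_sum fun I hI => DifferentiableAt.const_mul ?_ _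
  rw [Finset.mem_powerset] at hI
  refine DifferentiableAt.fun_finsetProd fun i hi => DifferentiableAt.fun_finsetProd fun j hj => ?_
  have his := hI hi
  obtain ⟨hjs, hjI⟩ := Finset.mem_sdiff.mp hj
  have hij : i ≠ j := by rintro rfl; exact hjI hi
  by_cases hia : i = a
  · subst hia
    have hj' : j ∈ s.erase i := by simp [hij.symm, hjs]
    simp only [Function.update_self, Function.update_of_ne hij.symm]
    have h1 := hx j hj' 0 (by simp)
    have h2 := hx j hj' (-1) (by simp)
    have h : DifferentiableAt ℂ v (x - z j) := by
      refine hv.differentiableAt _ (by simpa using h1) ?_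
      convert h2 using 1
      push_cast
      ring_nf
    exact h.comp x (differentiableAt_id.sub_const _)
  · have hi' : i ∈ s.erase a := by simp [hia, his]
    by_cases hja : j = a
    · subst hja
      simp only [Function.update_self, Function.update_of_ne hij]
      have h1 := hx i hi' 0 (by simp)
      have h2 := hx i hi' 1 (by simp)
      have h : DifferentiableAt ℂ v (z i - x) := by
        refine hv.differentiableAt _ (fun h => h1 ?_) (fun h => h2 ?_)
        · rw [← neg_mem_iff]
          simpa using h
        · rw [← neg_mem_iff]
          convert h using 1
          push_cast
          ring
      exact h.comp x (differentiableAt_id.const_sub _)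
    · simp only [Function.update_of_ne hia, Function.update_of_ne hja]
      exact differentiableAt_const _

/-- The antisymmetrised sum does not depend on `z_a`, provided that it vanishes for fewer
points. -/
lemma splitDiff_update_eq (hδ : 0 < δ.im) (hβ : β ∉ lattice δ) (hβ' : 2 * β ∉ lattice δ)
    {s : Finset ι} (ih : ∀ t ⊂ s, ∀ (c : ℕ → ℂ) z, Generic δ β t z → splitDiff v c t z = 0)
    (c : ℕ → ℂ) {z : ι → ℂ} {a : ι} (ha : a ∈ s) (hz : Generic δ β (s.erase a) z) {x y : ℂ}
    (hx : ∀ b ∈ s.erase a, ∀ m : ℤ, |m| ≤ 1 → x - (z b + m * β) ∉ lattice δ)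
    (hy : ∀ b ∈ s.erase a, ∀ m : ℤ, |m| ≤ 1 → y - (z b + m * β) ∉ lattice δ) :
    splitDiff v c s (Function.update z a x) = splitDiff v c s (Function.update z a y) := by
  set S : Set ℂ := {x | ∃ b ∈ s.erase a, ∃ m : ℤ, |m| ≤ 1 ∧ x - (z b + m * β) ∈ lattice δ} with hS
  have hmem : ∀ x, x ∉ S ↔
      ∀ b ∈ s.erase a, ∀ m : ℤ, |m| ≤ 1 → x - (z b + m * β) ∉ lattice δ := by
    intro x
    simp only [hS, Set.mem_ofPred_eq, not_exists, not_and]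
  have hper : ∀ {l : ℂ}, l ∈ lattice δ → ∀ x, splitDiff v c s (Function.update z a (x + l)) =
      splitDiff v c s (Function.update z a x) :=
    fun hl x => hv.splitDiff_update_add c s z a x hl
  refine eq_of_doublyPeriodic hδ (h := fun x => splitDiff v c s (Function.update z a x)) (S := S)
    ?_ ?_ (hper (by simpa using int_mem_lattice δ 1))
    (hper (mem_lattice.mpr ⟨0, 1, by simp⟩)) ?_ ((hmem x).mpr hx) ((hmem y).mpr hy)
  · intro x
    simp only [hmem]
    rw [eventually_all_finset]
    intro b _
    have : ∀ᶠ y in 𝓝[≠] x, ∀ m ∈ Finset.Icc (-1 : ℤ) 1, y - (z b + m * β) ∉ lattice δ := by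
      rw [eventually_all_finset]
      exact fun m _ => eventually_notMem_lattice_sub hδ x _
    filter_upwards [this] with y hy m hm
    exact hy m (by rw [abs_le] at hm; simpa using hm)
  · intro x hx
    rw [hmem] at hx
    refine (hv.differentiableAt_splitSum_update c hz hx).sub
      (hv.neg.differentiableAt_splitSum_update c hz.neg_beta fun b hb m hm => ?_)
    have := hx b hb (-m) (by rwa [abs_neg])
    rwa [Int.cast_neg, neg_mul, ← mul_neg] at this
  · rintro x ⟨b, hb, m, hm, hl⟩
    -- The residue at a translate of `z_b` concerns the points of `t` with shifted coefficients,
    -- which is why the induction hypothesis has to cover all sequences `c`.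
    set t := (s.erase a).erase b with ht
    have hab : a ≠ b := (Finset.ne_of_mem_erase hb).symm
    have hat : a ∉ t := by simp [ht]
    have hbt : b ∉ t := by simp [ht]
    have hbs : insert b t = s.erase a := Finset.insert_erase hb
    have hs : s = insert a (insert b t) := by rw [hbs, Finset.insert_erase ha]
    have hts : t ⊂ s := by
      rw [hs]
      exact (Finset.ssubset_insert hbt).trans (Finset.ssubset_insert (by simp [hab, hat]))
    rw [← hbs] at hz
    have h0 := sub_eq_zero.mp (ih t hts (fun n => c (n + 1)) z
      (hz.mono (Finset.subset_insert _ _)))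
    have hlim := hv.tendsto_splitSum_antisymm hab hat hbt hz c hβ hβ' h0 hm
    rw [← hs] at hlim
    have := tendsto_punctured_of_add (hper hl) hlim
    rwa [add_sub_cancel] at this

omit [DecidableEq ι] hv in
-- Finitely many translates of the lattice must be avoided, and each is discrete. With such a `w`,
-- any mixture of points `z_i` and `w - z_j` stays in general position.
lemma exists_reflection_generic (hδ : 0 < δ.im) (β : ℂ) (s : Finset ι) (z : ι → ℂ) :
    ∃ w : ℂ, ∀ i ∈ s, ∀ j ∈ s, ∀ m : ℤ, |m| ≤ 2 → z i - (w - z j) + m * β ∉ lattice δ := by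
  have : ∀ᶠ w in 𝓝[≠] (0 : ℂ), ∀ i ∈ s, ∀ j ∈ s, ∀ m ∈ Finset.Icc (-2 : ℤ) 2,
      w - (z i + z j + m * β) ∉ lattice δ := by
    simp only [eventually_all_finset]
    exact fun i _ j _ m _ => eventually_notMem_lattice_sub hδ 0 _
  obtain ⟨w, hw⟩ := this.exists
  refine ⟨w, fun i hi j hj m hm h => hw i hi j hj m (by rw [abs_le] at hm; simpa using hm) ?_⟩
  rw [← neg_mem_iff]
  convert h using 1
  ring

/-- For points in general position, the sum over all `I ⊆ s` of
`c_{|I|} ∏_{i ∈ I, j ∈ s ∖ I} v(z_i - z_j)` is invariant under `v(x) ↦ v(-x)`. -/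
theorem splitDiff_eq_zero (hδ : 0 < δ.im) (hβ : β ∉ lattice δ) (hβ' : 2 * β ∉ lattice δ)
    (s : Finset ι) : ∀ (c : ℕ → ℂ) (z : ι → ℂ), Generic δ β s z → splitDiff v c s z = 0 := by
  induction s using Finset.strongInduction with
  | H s ih =>
    intro c z hz
    obtain ⟨w, hw⟩ := exists_reflection_generic hδ β s z
    set z' : ι → ℂ := fun i => w - z i with hz'
    have hgen : ∀ u : Finset ι, Generic δ β s (u.piecewise z' z) := by
      intro u i hi j hj hij m hm
      by_cases hiu : i ∈ u <;> by_cases hju : j ∈ u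
      · rw [Finset.piecewise_eq_of_mem _ _ _ hiu, Finset.piecewise_eq_of_mem _ _ _ hju]
        convert hz j hj i hi hij.symm m hm using 2
        simp only [hz']
        ring
      · rw [Finset.piecewise_eq_of_mem _ _ _ hiu, Finset.piecewise_eq_of_notMem _ _ _ hju]
        intro h
        refine hw j hj i hi (-m) (by rwa [abs_neg]) ?_
        rw [← neg_mem_iff]
        convert h using 1
        simp only [hz']
        push_cast
        ring
      · rw [Finset.piecewise_eq_of_notMem _ _ _ hiu, Finset.piecewise_eq_of_mem _ _ _ hju]
        exact hw i hi j hj m hm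
      · rw [Finset.piecewise_eq_of_notMem _ _ _ hiu, Finset.piecewise_eq_of_notMem _ _ _ hju]
        exact hz i hi j hj hij m hm
    have hcond : ∀ (y : ι → ℂ), Generic δ β s y → ∀ a ∈ s,
        ∀ b ∈ s.erase a, ∀ m : ℤ, |m| ≤ 1 → y a - (y b + m * β) ∉ lattice δ := by
      intro y hy a ha b hb m hm
      convert hy a ha b (Finset.mem_of_mem_erase hb) (Finset.ne_of_mem_erase hb).symm (-m)
        (by rw [abs_neg]; omega) using 2
      push_cast
      ring
    -- The points are reflected one at a time; each move changes a single variable and stays among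
    -- the generic configurations of `hgen`.
    have key : ∀ u ⊆ s, splitDiff v c s (u.piecewise z' z) = splitDiff v c s z := by
      intro u
      induction u using Finset.induction_on with
      | empty => simp
      | insert a u hau ihu =>
        intro hus
        have ha : a ∈ s := hus (Finset.mem_insert_self _ _)
        rw [← ihu ((Finset.subset_insert _ _).trans hus), Finset.piecewise_insert]
        set y := u.piecewise z' z with hy
        have hya : y a = z a := Finset.piecewise_eq_of_notMem _ _ _ hau
        have h2 := hv.splitDiff_update_eq hδ hβ hβ' ih c ha
          ((hgen u).mono (Finset.erase_subset _ _)) (x := z' a) (y := y a) ?_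
          (hcond y (hgen u) a ha)
        · rwa [Function.update_eq_self] at h2
        · intro b hb m hm
          have h3 := hcond _ (hgen (insert a u)) a ha b hb m hm
          rw [Finset.piecewise_insert, Function.update_self,
            Function.update_of_ne (Finset.ne_of_mem_erase hb)] at h3
          exact h3
    have h1 := key s subset_rfl
    -- Once all points are reflected, every difference `z_i - z_j` has changed sign, which exchanges
    -- the two split sums.
    have h2 : splitDiff v c s (s.piecewise z' z) = -splitDiff v c s z := by
      have h3 : ∀ u : ℂ → ℂ, splitSum u c s (s.piecewise z' z) =
          splitSum (fun x => u (-x)) c s z := by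
        intro u
        refine Finset.sum_congr rfl fun I hI => ?_
        rw [Finset.mem_powerset] at hI
        congr 1
        refine Finset.prod_congr rfl fun i hi => Finset.prod_congr rfl fun j hj => ?_
        rw [Finset.piecewise_eq_of_mem _ _ _ (hI hi),
          Finset.piecewise_eq_of_mem _ _ _ (Finset.mem_sdiff.mp hj).1]
        congr 1
        simp only [hz']
        ring
      rw [splitDiff, h3, h3, splitDiff]
      simp only [neg_neg]
      ring
    linear_combination (1 / 2 : ℂ) * h2 - (1 / 2 : ℂ) * h1

end IsTwoPole

end splitSum

/-! ### The differentiated identity -/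

/-- The elliptic function `f(x + γ) f(x + β - γ) / (f(x) f(x + β))`. -/
def twoPole (f : ℂ → ℂ) (γ β x : ℂ) : ℂ := f (x + γ) * f (x + β - γ) / (f x * f (x + β))

/-- `f'/f(x - γ) + f'/f(x + γ) - 2 f'/f(x)`. -/
def logDerivDiff (f : ℂ → ℂ) (γ x : ℂ) : ℂ :=
  logDeriv f (x - γ) + logDeriv f (x + γ) - 2 * logDeriv f x

/-- Logarithmic differentiation without division: with derivatives written as `g p x * d p`, the
factors may vanish. -/
lemma hasDerivAt_prod_of_log {α : Type*} (P : Finset α) {g : α → ℂ → ℂ} {d : α → ℂ} {x : ℂ}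
    (h : ∀ p ∈ P, HasDerivAt (g p) (g p x * d p) x) :
    HasDerivAt (fun y => ∏ p ∈ P, g p y) ((∏ p ∈ P, g p x) * ∑ p ∈ P, d p) x := by
  classical
  induction P using Finset.induction_on with
  | empty => simpa using hasDerivAt_const x (1 : ℂ)
  | insert a P ha ih =>
    simp only [Finset.prod_insert ha, Finset.sum_insert ha]
    exact ((h a (Finset.mem_insert_self _ _)).fun_mul
      (ih fun p hp => h p (Finset.mem_insert_of_mem hp))).congr_deriv (by ring)

namespace IsOddTheta

variable {δ : ℂ} {f : ℂ → ℂ} (hf : IsOddTheta δ f)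
include hf

lemma isTwoPole (γ : ℂ) {β : ℂ} (hβ : β ∉ lattice δ) :
    IsTwoPole δ β ((deriv f 0)⁻¹ * (f γ * f (β - γ) / f β)) (twoPole f γ β) where
  add_one x := by
    rw [twoPole, show x + 1 + γ = x + γ + 1 by ring, show x + 1 + β - γ = x + β - γ + 1 by ring,
      show x + 1 + β = x + β + 1 by ring]
    simp only [hf.add_one, neg_mul_neg]
    rfl
  add_tau x := by
    rw [twoPole, show x + δ + γ = x + γ + δ by ring, show x + δ + β - γ = x + β - γ + δ by ring,
      show x + δ + β = x + β + δ by ring]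
    simp only [hf.add_tau, neg_mul_neg]
    have h1 : e (x + γ) * e (x + β - γ) = e x * e (x + β) := by
      rw [← e_add, ← e_add]; congr 1; ring
    set C := cexp (-(Real.pi * I * δ))
    have h2 : (C * (e (x + γ))⁻¹) * (C * (e (x + β - γ))⁻¹) =
        (C * (e x)⁻¹) * (C * (e (x + β))⁻¹) := by
      rw [mul_mul_mul_comm, mul_mul_mul_comm C _ C, ← mul_inv, ← mul_inv, h1]
    have h3 : (C * (e x)⁻¹) * (C * (e (x + β))⁻¹) ≠ 0 := by
      simp [C, e_ne_zero, Complex.exp_ne_zero]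
    rw [mul_mul_mul_comm, h2, mul_mul_mul_comm (C * (e x)⁻¹) (f x), mul_div_mul_left _ _ h3]
    rfl
  differentiableAt x h1 h2 := by
    have hd := hf.differentiable
    have : DifferentiableAt ℂ (fun x => f (x + γ) * f (x + β - γ) / (f x * f (x + β))) x := by
      refine DifferentiableAt.div (by fun_prop) (by fun_prop) ?_
      exact mul_ne_zero (hf.ne_zero h1) (hf.ne_zero h2)
    exact this
  reflect x := by
    rw [twoPole, twoPole, show -x - β + γ = -(x + β - γ) by ring,
      show -x - β + β - γ = -(x + γ) by ring, show -x - β + β = -x by ring,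
      show -x - β = -(x + β) by ring]
    simp only [hf.neg, neg_mul_neg]
    rw [mul_comm, mul_comm (f (x + β))]
  tendsto_zero := by
    have hc : ContinuousAt (fun x => f (x + γ) * f (x + β - γ) / f (x + β)) 0 := by
      have := hf.differentiable.continuous
      refine ContinuousAt.div (by fun_prop) (by fun_prop) ?_
      rw [zero_add]
      exact hf.ne_zero hβ
    have := hf.tendsto_mul_inv.mul (hc.tendsto.mono_left nhdsWithin_le_nhds)
    simp only [zero_add] at this
    refine this.congr fun x => ?_
    rw [twoPole, div_eq_mul_inv, div_eq_mul_inv, mul_inv]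
    ring

lemma logDeriv_neg (x : ℂ) : logDeriv f (-x) = -logDeriv f x := by
  have h : (fun x => f (-x)) = fun x => -f x := funext hf.neg
  have h2 := congrFun (congrArg deriv h) x
  rw [deriv_comp_neg, deriv.fun_neg] at h2
  rw [logDeriv_apply, logDeriv_apply, hf.neg, neg_inj.mp h2, div_neg]

lemma twoPole_zero_neg (γ x : ℂ) : twoPole f γ 0 (-x) = twoPole f γ 0 x := by
  rw [twoPole, twoPole, show -x + γ = -(x + 0 - γ) by ring, show -x + 0 - γ = -(x + γ) by ring,
    add_zero, add_zero]
  simp only [hf.neg, neg_mul_neg]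
  rw [mul_comm]

lemma hasDerivAt_twoPole {γ x : ℂ} (h1 : f x ≠ 0) (h2 : f (x - γ) ≠ 0) :
    HasDerivAt (fun β => twoPole f γ β x)
      (twoPole f γ 0 x * (logDeriv f (x - γ) - logDeriv f x)) 0 := by
  have d1 : HasDerivAt (fun β : ℂ => f (x + β - γ)) (deriv f (x - γ)) 0 := by
    have := (hf.differentiable (x - γ)).hasDerivAt
    have h3 : HasDerivAt (fun β : ℂ => x + β - γ) 1 0 :=
      ((hasDerivAt_id 0).const_add x).sub_const γ
    have h4 : HasDerivAt f (deriv f (x - γ)) (x + 0 - γ) := by rwa [add_zero]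
    have h5 := h4.comp 0 h3
    rwa [mul_one] at h5
  have d2 : HasDerivAt (fun β : ℂ => f (x + β)) (deriv f x) 0 := by
    have := (hf.differentiable x).hasDerivAt
    have h4 : HasDerivAt f (deriv f x) (x + 0) := by rwa [add_zero]
    have h5 := h4.comp 0 ((hasDerivAt_id 0).const_add x)
    rwa [mul_one] at h5
  have d3 := (d1.const_mul (f (x + γ))).div (d2.const_mul (f x))
    (by rw [add_zero]; exact mul_ne_zero h1 h1)
  refine d3.congr_deriv ?_
  simp only [twoPole]
  simp only [add_zero, logDeriv_apply]
  field_simp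

lemma eventually_generic {ι : Type*} {s : Finset ι} {z : ι → ℂ}
    (hz : ∀ i ∈ s, ∀ j ∈ s, i ≠ j → z i - z j ∉ lattice δ) :
    ∀ᶠ β in 𝓝 (0 : ℂ), Generic δ β s z := by
  have : ∀ᶠ β in 𝓝 (0 : ℂ), ∀ i ∈ s, ∀ j ∈ s, ∀ m ∈ Finset.Icc (-2 : ℤ) 2,
      i ≠ j → z i - z j + m * β ∉ lattice δ := by
    simp only [eventually_all_finset]
    intro i hi j hj m _
    by_cases hij : i = j
    · simp [hij]
    · have hc : Continuous fun β : ℂ => f (z i - z j + m * β) :=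
        hf.differentiable.continuous.comp (by fun_prop)
      have h0 : f (z i - z j + m * 0) ≠ 0 := by
        rw [mul_zero, add_zero]
        exact hf.ne_zero (hz i hi j hj hij)
      filter_upwards [hc.continuousAt.eventually_ne h0] with β hβ _ h
      exact hβ ((hf.eq_zero_iff _).mpr h)
  filter_upwards [this] with β hβ i hi j hj hij m hm
  exact hβ i hi j hj m (by rw [abs_le] at hm; simpa using hm) hij

lemma eventually_splitDiff_eq_zero {ι : Type*} [DecidableEq ι] (hδ : 0 < δ.im) (γ : ℂ)
    {s : Finset ι} {z : ι → ℂ} (hz : ∀ i ∈ s, ∀ j ∈ s, i ≠ j → z i - z j ∉ lattice δ)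
    (c : ℕ → ℂ) : ∀ᶠ β in 𝓝 (0 : ℂ), splitDiff (twoPole f γ β) c s z = 0 := by
  -- At `β = 0` the function is even and the identity trivial, while the elliptic argument covers a
  -- punctured neighbourhood. Differentiation at `0` needs the full neighbourhood.
  have h0 : splitDiff (twoPole f γ 0) c s z = 0 := by
    rw [splitDiff]
    simp only [hf.twoPole_zero_neg]
    exact sub_self _
  have h2 : ∀ᶠ β in 𝓝[≠] (0 : ℂ), 2 * β ∉ lattice δ := by
    have ht : Tendsto (fun β : ℂ => 2 * β) (𝓝[≠] 0) (𝓝[≠] 0) := by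
      refine tendsto_nhdsWithin_iff.mpr ⟨?_, ?_⟩
      · have := (continuous_const_mul (2 : ℂ)).tendsto 0
        rw [mul_zero] at this
        exact this.mono_left nhdsWithin_le_nhds
      · filter_upwards [self_mem_nhdsWithin] with y hy h
        exact hy (by simpa using h)
    exact ht.eventually (hf.eventually_notMem_lattice 0)
  have h3 : ∀ᶠ β in 𝓝[≠] (0 : ℂ), splitDiff (twoPole f γ β) c s z = 0 := by
    filter_upwards [hf.eventually_notMem_lattice 0, h2,
      nhdsWithin_le_nhds (hf.eventually_generic hz)] with β hβ hβ' hg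
    exact (hf.isTwoPole γ hβ).splitDiff_eq_zero hδ hβ hβ' s c z hg
  rw [eventually_nhdsWithin_iff] at h3
  filter_upwards [h3] with β hβ
  by_cases h : β = 0
  · rw [h, h0]
  · exact hβ h

/-- Differentiate the identity at `β = 0`. With `L = f'/f`, a factor `v(x)` contributes `L(x - γ) -
L(x)` and a factor `v(-x)` contributes `L(x) - L(x + γ)`; their difference is `logDerivDiff`. -/
lemma sum_splitProd_logDerivDiff {ι : Type*} [DecidableEq ι] (hδ : 0 < δ.im) {γ : ℂ}
    {s : Finset ι} {z : ι → ℂ} (hz : ∀ i ∈ s, ∀ j ∈ s, i ≠ j → z i - z j ∉ lattice δ)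
    (hzγ : ∀ i ∈ s, ∀ j ∈ s, z i - z j - γ ∉ lattice δ) (c : ℕ → ℂ) :
    ∑ I ∈ s.powerset, c I.card * (splitProd (twoPole f γ 0) z s I *
      ∑ i ∈ I, ∑ j ∈ s \ I, logDerivDiff f γ (z i - z j)) = 0 := by
  have hI : ∀ I ⊆ s, ∀ i ∈ I, ∀ j ∈ s \ I, f (z i - z j) ≠ 0 ∧ f (z i - z j - γ) ≠ 0 ∧
      f (-(z i - z j)) ≠ 0 ∧ f (-(z i - z j) - γ) ≠ 0 := by
    intro I hI i hi j hj
    obtain ⟨hjs, hjI⟩ := Finset.mem_sdiff.mp hj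
    have hij : i ≠ j := by rintro rfl; exact hjI hi
    refine ⟨hf.ne_zero (hz i (hI hi) j hjs hij), hf.ne_zero (hzγ i (hI hi) j hjs), ?_, ?_⟩
    · rw [neg_sub]; exact hf.ne_zero (hz j hjs i (hI hi) hij.symm)
    · rw [neg_sub]; exact hf.ne_zero (hzγ j hjs i (hI hi))
  have hd1 : ∀ I ∈ s.powerset, HasDerivAt (fun β => c I.card * splitProd (twoPole f γ β) z s I)
      (c I.card * (splitProd (twoPole f γ 0) z s I * ∑ i ∈ I, ∑ j ∈ s \ I,
        (logDeriv f (z i - z j - γ) - logDeriv f (z i - z j)))) 0 := by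
    intro I hIs
    rw [Finset.mem_powerset] at hIs
    refine HasDerivAt.const_mul _ ?_
    refine hasDerivAt_prod_of_log I fun i hi => hasDerivAt_prod_of_log _ fun j hj => ?_
    have := hI I hIs i hi j hj
    exact hf.hasDerivAt_twoPole this.1 this.2.1
  have hd2 : ∀ I ∈ s.powerset,
      HasDerivAt (fun β => c I.card * splitProd (fun x => twoPole f γ β (-x)) z s I)
      (c I.card * (splitProd (twoPole f γ 0) z s I * ∑ i ∈ I, ∑ j ∈ s \ I,
        (logDeriv f (z i - z j) - logDeriv f (z i - z j + γ)))) 0 := by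
    intro I hIs
    rw [Finset.mem_powerset] at hIs
    refine HasDerivAt.const_mul _ ?_
    have : splitProd (twoPole f γ 0) z s I = splitProd (fun x => twoPole f γ 0 (-x)) z s I := by
      simp only [hf.twoPole_zero_neg]
    rw [this]
    refine hasDerivAt_prod_of_log I fun i hi => hasDerivAt_prod_of_log _ fun j hj => ?_
    have := hI I hIs i hi j hj
    have h := hf.hasDerivAt_twoPole this.2.2.1 this.2.2.2
    refine h.congr_deriv ?_
    congr 1
    rw [show -(z i - z j) - γ = -(z i - z j + γ) by ring, hf.logDeriv_neg, hf.logDeriv_neg]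
    ring
  have hd := (HasDerivAt.fun_sum hd1).sub (HasDerivAt.fun_sum hd2)
  have h0 : HasDerivAt (fun β => splitDiff (twoPole f γ β) c s z) 0 0 :=
    (hasDerivAt_const (0 : ℂ) (0 : ℂ)).congr_of_eventuallyEq
      (hf.eventually_splitDiff_eq_zero hδ γ hz c)
  refine Eq.trans ?_ (hd.unique h0)
  rw [← Finset.sum_sub_distrib]
  refine Finset.sum_congr rfl fun I _ => ?_
  rw [← mul_sub, ← mul_sub]
  congr 2
  simp only [← Finset.sum_sub_distrib]
  refine Finset.sum_congr rfl fun i _ => Finset.sum_congr rfl fun j _ => ?_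
  rw [logDerivDiff]
  ring

end IsOddTheta

/-- `∏_{i ≠ j} h(z_i - z_j)` over `i, j ∈ I`. -/
def pairProd {ι : Type*} [DecidableEq ι] (h : ℂ → ℂ) (z : ι → ℂ) (I : Finset ι) : ℂ :=
  ∏ i ∈ I, ∏ j ∈ I, if i = j then 1 else h (z i - z j)

lemma pairProd_eq {ι : Type*} [DecidableEq ι] (h : ℂ → ℂ) (z : ι → ℂ) {s I : Finset ι}
    (hI : I ⊆ s) : pairProd h z s = pairProd h z I * pairProd h z (s \ I) *
      ∏ i ∈ I, ∏ j ∈ s \ I, (h (z i - z j) * h (z j - z i)) := by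
  have hne : ∀ i ∈ I, ∀ j ∈ s \ I, i ≠ j := by
    rintro i hi j hj rfl
    exact (Finset.mem_sdiff.mp hj).2 hi
  have h1 : ∏ i ∈ I, ∏ j ∈ s \ I, (if i = j then 1 else h (z i - z j)) =
      ∏ i ∈ I, ∏ j ∈ s \ I, h (z i - z j) :=
    Finset.prod_congr rfl fun i hi => Finset.prod_congr rfl fun j hj => if_neg (hne i hi j hj)
  have h2 : ∏ j ∈ s \ I, ∏ i ∈ I, (if j = i then 1 else h (z j - z i)) =
      ∏ i ∈ I, ∏ j ∈ s \ I, h (z j - z i) := by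
    rw [Finset.prod_comm]
    exact Finset.prod_congr rfl fun i hi => Finset.prod_congr rfl fun j hj =>
      if_neg (hne i hi j hj).symm
  simp only [pairProd, Finset.prod_mul_distrib]
  rw [← Finset.prod_sdiff hI]
  simp only [← Finset.prod_sdiff hI, Finset.prod_mul_distrib]
  rw [h1, h2]
  ring

/-- The ratio `f(x) / f(x + γ)`. -/
def shiftRatio (f : ℂ → ℂ) (γ x : ℂ) : ℂ := f x / f (x + γ)

theorem IsOddTheta.sum_pairProd_logDerivDiff {δ : ℂ} {f : ℂ → ℂ} (hf : IsOddTheta δ f)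
    {ι : Type*} [DecidableEq ι] (hδ : 0 < δ.im) {γ : ℂ}
    {s : Finset ι} {z : ι → ℂ} (hz : ∀ i ∈ s, ∀ j ∈ s, i ≠ j → z i - z j ∉ lattice δ)
    (hzγ : ∀ i ∈ s, ∀ j ∈ s, z i - z j - γ ∉ lattice δ) (c : ℕ → ℂ) :
    ∑ I ∈ s.powerset, c I.card * (pairProd (shiftRatio f γ) z I *
      pairProd (shiftRatio f γ) z (s \ I) *
        ∑ i ∈ I, ∑ j ∈ s \ I, logDerivDiff f γ (z i - z j)) = 0 := by
  have key := congrArg (fun x => pairProd (shiftRatio f γ) z s * x)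
    (hf.sum_splitProd_logDerivDiff hδ hz hzγ c)
  simp only [mul_zero] at key
  rw [Finset.mul_sum] at key
  rw [← key]
  refine Finset.sum_congr rfl fun I hI => ?_
  rw [Finset.mem_powerset] at hI
  rw [pairProd_eq _ _ hI]
  -- For `h = shiftRatio f γ`, oddness of `f` gives `h(x) h(-x) = f(x)² / (f(x + γ) f(x - γ))`, the
  -- inverse of `twoPole f γ 0`. Multiplying by the pair product over `s` thus removes the cross
  -- factors.
  have h1 : (∏ i ∈ I, ∏ j ∈ s \ I, (shiftRatio f γ (z i - z j) * shiftRatio f γ (z j - z i))) *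
      splitProd (twoPole f γ 0) z s I = 1 := by
    rw [splitProd, ← Finset.prod_mul_distrib]
    refine Finset.prod_eq_one fun i hi => ?_
    rw [← Finset.prod_mul_distrib]
    refine Finset.prod_eq_one fun j hj => ?_
    obtain ⟨hjs, hjI⟩ := Finset.mem_sdiff.mp hj
    have hij : i ≠ j := by rintro rfl; exact hjI hi
    have n1 := hf.ne_zero (hz i (hI hi) j hjs hij)
    have n2 := hf.ne_zero (hzγ i (hI hi) j hjs)
    have n3 := hf.ne_zero (hzγ j hjs i (hI hi))
    have h3 : f (z i - z j + γ) = -f (z j - z i - γ) := by rw [← hf.neg]; congr 1; ring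
    have h4 : f (z j - z i + γ) = -f (z i - z j - γ) := by rw [← hf.neg]; congr 1; ring
    have h5 : f (z j - z i) = -f (z i - z j) := by rw [← hf.neg]; congr 1; ring
    rw [shiftRatio, shiftRatio, twoPole, add_zero, h3, h4, h5]
    field_simp
  linear_combination (-c I.card * pairProd (shiftRatio f γ) z I *
    pairProd (shiftRatio f γ) z (s \ I) *
      ∑ i ∈ I, ∑ j ∈ s \ I, logDerivDiff f γ (z i - z j)) * h1

/-! ### The regularised kernel of the bracket -/

section

variable {δ : ℂ} (hδ : 0 < δ.im)
include hδ

lemma logDeriv_oddProd {x : ℂ} (hx : x ∉ lattice δ) :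
    logDeriv (oddProd δ) x = 2 * Real.pi * I *
      (-(1 / 2) - lambert (e δ) (e x) + lambert (e δ) (e δ / e x)) := by
  have hp := norm_e_lt_one hδ
  have h0 := (isOddTheta_oddProd hδ).ne_zero hx
  rw [oddProd] at h0
  have hB : qProd (e δ) (e x) ≠ 0 := right_ne_zero_of_mul (left_ne_zero_of_mul h0)
  have hC : qProd (e δ) (e (δ - x)) ≠ 0 := by rw [e_sub]; exact right_ne_zero_of_mul h0
  have hA : HasDerivAt (fun x : ℂ => cexp (-(Real.pi * I * x)))
      (cexp (-(Real.pi * I * x)) * -(Real.pi * I * 1)) x :=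
    (((hasDerivAt_id x).const_mul (Real.pi * I : ℂ)).neg).cexp
  have hA' : logDeriv (fun x : ℂ => cexp (-(Real.pi * I * x))) x = -(Real.pi * I) := by
    rw [logDeriv_apply, hA.deriv, mul_one, mul_div_cancel_left₀ _ (Complex.exp_ne_zero _)]
  have dB : DifferentiableAt ℂ (qProd (e δ) ∘ e) x :=
    (differentiable_qProd hp _).comp x differentiable_e.differentiableAt
  have dg : HasDerivAt (fun x : ℂ => e (δ - x)) (-(2 * Real.pi * I * e (δ - x))) x := by
    have h1 := (differentiable_e (δ - x)).hasDerivAt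
    rw [deriv_e] at h1
    have := h1.comp x ((hasDerivAt_id x).const_sub δ)
    rwa [mul_neg_one] at this
  have dC : DifferentiableAt ℂ (qProd (e δ) ∘ fun x => e (δ - x)) x :=
    (differentiable_qProd hp _).comp x dg.differentiableAt
  have hB' : logDeriv (qProd (e δ) ∘ e) x = -(2 * Real.pi * I * lambert (e δ) (e x)) := by
    rw [logDeriv_comp (differentiable_qProd hp _) differentiable_e.differentiableAt, deriv_e]
    linear_combination (2 * Real.pi * I) * mul_logDeriv_qProd hp hB
  have hC' : logDeriv (qProd (e δ) ∘ fun x => e (δ - x)) x =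
      2 * Real.pi * I * lambert (e δ) (e (δ - x)) := by
    rw [logDeriv_comp (differentiable_qProd hp _) dg.differentiableAt, dg.deriv]
    linear_combination (-(2 * Real.pi * I)) * mul_logDeriv_qProd hp hC
  have hfun : oddProd δ = fun x => (cexp (-(Real.pi * I * x)) * (qProd (e δ) ∘ e) x) *
      (qProd (e δ) ∘ fun x => e (δ - x)) x := by
    funext x
    simp only [oddProd, Function.comp, e_sub]
  rw [hfun, logDeriv_mul (f := fun x => cexp (-(Real.pi * I * x)) * (qProd (e δ) ∘ e) x) x
    (mul_ne_zero (Complex.exp_ne_zero _) hB) hC (hA.differentiableAt.mul dB) dC,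
    logDeriv_mul (f := fun x => cexp (-(Real.pi * I * x))) x (Complex.exp_ne_zero _) hB
      hA.differentiableAt dB, hA', hB', hC', e_sub]
  ring

end

lemma im_eq_of_mem_lattice {δ x : ℂ} (hx : x ∈ lattice δ) : ∃ n : ℤ, x.im = n * δ.im := by
  obtain ⟨m, n, rfl⟩ := mem_lattice.mp hx
  exact ⟨n, by simp⟩

lemma notMem_lattice_of_im {δ x : ℂ} (h0 : 0 < x.im) (h1 : x.im < δ.im) : x ∉ lattice δ := by
  intro hx
  obtain ⟨n, hn⟩ := im_eq_of_mem_lattice hx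
  have hδ : 0 < δ.im := h0.trans h1
  rw [hn] at h0 h1
  have h2 : (0 : ℝ) < n := pos_of_mul_pos_left h0 hδ.le
  have h3 : (n : ℝ) < 1 := by
    by_contra h
    nlinarith
  have h4 : (0 : ℤ) < n := by exact_mod_cast h2
  have h5 : n < (1 : ℤ) := by exact_mod_cast h3
  omega

lemma ofReal_mem_lattice_iff {δ : ℂ} (hδ : 0 < δ.im) {u : ℝ} :
    (u : ℂ) ∈ lattice δ ↔ e u = 1 := by
  rw [e_eq_one_iff]
  constructor
  · intro h
    obtain ⟨m, n, h⟩ := mem_lattice.mp h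
    have hn : (n : ℝ) * δ.im = 0 := by
      have := congrArg Complex.im h
      simpa using this
    have hn' : n = 0 := by
      rcases mul_eq_zero.mp hn with h | h
      · exact_mod_cast h
      · exact absurd h hδ.ne'
    refine ⟨m, ?_⟩
    rw [← h, hn']
    simp
  · rintro ⟨n, h⟩
    rw [h]
    exact int_mem_lattice δ n

section

variable {γ δ : ℂ} (hγ : 0 < γ.im) (hγδ : γ.im < δ.im)
include hγ hγδ

/-- Oddness replaces `u - γ` by `γ - u`. The only Lambert argument of modulus one is then `e u`;
splitting off its first term yields `(1 + e u) / (1 - e u)` and leaves arguments inside the unit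
disc, where Fourier expansion is possible. -/
lemma logDerivDiff_oddProd {u : ℝ} (hu : e u ≠ 1) :
    logDerivDiff (oddProd δ) γ u = 2 * Real.pi * I *
      ((1 + e u) / (1 - e u)
        + (2 * lambert (e δ) (e δ * e u) - lambert (e δ) (e γ * e u)
          - lambert (e δ) (e δ / e γ * e u))
        - (2 * lambert (e δ) (e δ * (e u)⁻¹) - lambert (e δ) (e γ * (e u)⁻¹)
          - lambert (e δ) (e δ / e γ * (e u)⁻¹))) := by
  have hδ : 0 < δ.im := hγ.trans hγδ
  have h1 : (u : ℂ) ∉ lattice δ := fun h => hu ((ofReal_mem_lattice_iff hδ).mp h)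
  have h2 : (u : ℂ) + γ ∉ lattice δ := notMem_lattice_of_im (by simpa) (by simpa)
  have h3 : γ - (u : ℂ) ∉ lattice δ := notMem_lattice_of_im (by simpa) (by simpa)
  rw [logDerivDiff, ← neg_sub γ (u : ℂ), (isOddTheta_oddProd hδ).logDeriv_neg,
    logDeriv_oddProd hδ h1, logDeriv_oddProd hδ h2, logDeriv_oddProd hδ h3,
    lambert_eq (norm_e_lt_one hδ) (e u), e_add, e_sub]
  have h4 : 1 - e u ≠ 0 := sub_ne_zero.mpr hu.symm
  have h5 := e_ne_zero u
  have h6 := e_ne_zero γ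
  rw [show e δ / (e u * e γ) = e δ / e γ * (e u)⁻¹ by field_simp,
    show e δ / (e γ / e u) = e δ / e γ * e u by field_simp,
    div_eq_mul_inv (e γ) (e u), div_eq_mul_inv (e δ) (e u), mul_comm (e u) (e γ)]
  field_simp
  ring

/-- For positive modes the structure constants tend to `1`. The constant part produces the pole of
`K`, and the rest decays exponentially because `p`, `q` and `p/q` have modulus less than one. -/
lemma structConst_sub_one (n : ℕ) : structConst γ δ (n + 1 : ℕ) - 1 =
    2 * (e δ ^ (n + 1) / (1 - e δ ^ (n + 1))) - e γ ^ (n + 1) / (1 - e δ ^ (n + 1)) -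
      (e δ / e γ) ^ (n + 1) / (1 - e δ ^ (n + 1)) := by
  have hδ : 0 < δ.im := hγ.trans hγδ
  have h1 : 1 - e δ ^ (n + 1) ≠ 0 := by
    intro h
    have h2 : ‖e δ ^ (n + 1)‖ < 1 := by
      rw [norm_pow]
      exact pow_lt_one₀ (norm_nonneg _) (norm_e_lt_one hδ) (by omega)
    rw [← sub_eq_zero.mp h, norm_one] at h2
    exact lt_irrefl _ h2
  change (1 - e γ ^ ((n + 1 : ℕ) : ℤ)) * (1 - e δ ^ ((n + 1 : ℕ) : ℤ) *
    e γ ^ (-((n + 1 : ℕ) : ℤ))) / (1 - e δ ^ ((n + 1 : ℕ) : ℤ)) - 1 = _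
  rw [zpow_neg, zpow_natCast, zpow_natCast, div_pow]
  have h3 : e γ ^ (n + 1) ≠ 0 := pow_ne_zero _ (e_ne_zero γ)
  field_simp
  ring

omit hγ in
lemma norm_e_div_lt_one : ‖e δ / e γ‖ < 1 := by
  rw [← e_sub]
  exact norm_e_lt_one (by simpa)

lemma hasSum_structConst_sub_one {z : ℂ} (hz : ‖z‖ = 1) :
    HasSum (fun n : ℕ => (structConst γ δ (n + 1 : ℕ) - 1) * z ^ (n + 1))
      (2 * lambert (e δ) (e δ * z) - lambert (e δ) (e γ * z) -
        lambert (e δ) (e δ / e γ * z)) := by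
  have hδ : 0 < δ.im := hγ.trans hγδ
  have hp := norm_e_lt_one hδ
  have h : ∀ {w : ℂ}, ‖w‖ < 1 → ‖w * z‖ < 1 := fun hw => by rwa [norm_mul, hz, mul_one]
  have := (((hasSum_lambert hp (h hp)).mul_left 2).sub
    (hasSum_lambert hp (h (norm_e_lt_one hγ)))).sub
      (hasSum_lambert hp (h (norm_e_div_lt_one hγδ)))
  refine this.congr_fun fun n => ?_
  rw [structConst_sub_one hγ hγδ, mul_pow, mul_pow, mul_pow]
  ring

lemma summable_norm_structConst_sub_one :
    Summable fun n : ℕ => ‖structConst γ δ (n + 1 : ℕ) - 1‖ := by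
  have := (hasSum_structConst_sub_one hγ hγδ (z := 1) (by simp)).summable.norm
  simpa using this

end

lemma structConst_zero (γ δ : ℂ) : structConst γ δ 0 = 0 := by simp [structConst]

/-- The part of the regularised kernel that remains bounded at the diagonal. -/
def regularPart (γ δ : ℂ) (r u : ℝ) : ℂ :=
  ∑' n : ℕ, (structConst γ δ (n + 1 : ℕ) - 1) * r ^ (n + 1) *
    ((e u)⁻¹ ^ (n + 1) - e u ^ (n + 1))

/-- The Abel regularisation of `∑_n c_n e^{-2πinu}`, in closed form. -/
def regKernel (γ δ : ℂ) (r u : ℝ) : ℂ :=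
  (r * (e u)⁻¹ / (1 - r * (e u)⁻¹) - r * e u / (1 - r * e u)) + regularPart γ δ r u

lemma norm_inv_e_ofReal (u : ℝ) : ‖(e u)⁻¹‖ = 1 := by rw [norm_inv, norm_e_ofReal, inv_one]

lemma regKernel_neg (γ δ : ℂ) (r u : ℝ) : regKernel γ δ r (-u) = -regKernel γ δ r u := by
  have h : regularPart γ δ r (-u) = -regularPart γ δ r u := by
    rw [regularPart, regularPart, ← tsum_neg]
    refine tsum_congr fun n => ?_
    rw [ofReal_neg, e_neg, inv_inv]
    ring
  rw [regKernel, regKernel, h, ofReal_neg, e_neg, inv_inv]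
  ring

/-- Write `1 - z = (1 - r z) + (r - 1) z`; on the unit circle `1 - r ≤ ‖1 - r z‖`, so each piece is
at most `‖1 - r z‖`. This bounds the geometric part of the kernel uniformly in `r`. -/
lemma norm_one_sub_le {r : ℝ} (hr : 0 ≤ r) (hr1 : r ≤ 1) {z : ℂ} (hz : ‖z‖ = 1) :
    ‖1 - z‖ ≤ 2 * ‖1 - r * z‖ := by
  have h1 : ‖1 - z‖ ≤ ‖1 - r * z‖ + ‖(r - 1) * z‖ := by
    rw [show 1 - z = (1 - r * z) + (r - 1) * z by ring]
    exact norm_add_le _ _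
  have h2 : ‖(r - 1) * z‖ = 1 - r := by
    rw [norm_mul, hz, mul_one, ← ofReal_one, ← ofReal_sub, norm_real, Real.norm_eq_abs,
      abs_sub_comm, abs_of_nonneg (by linarith)]
  have h3 : 1 - r ≤ ‖1 - r * z‖ := by
    have := norm_sub_norm_le (1 : ℂ) (r * z)
    rwa [norm_one, norm_mul, hz, mul_one, norm_real, Real.norm_of_nonneg hr] at this
  linarith

lemma norm_geom_le {r : ℝ} (hr : 0 ≤ r) (hr1 : r < 1) {z : ℂ} (hz : ‖z‖ = 1) :
    ‖1 - z‖ * ‖r * z / (1 - r * z)‖ ≤ 2 := by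
  have h1 := norm_one_sub_le hr hr1.le hz
  have h2 : 0 < ‖1 - r * z‖ := by
    rw [norm_pos_iff, sub_ne_zero]
    intro h
    have := congrArg norm h
    rw [norm_one, norm_mul, hz, mul_one, norm_real, Real.norm_of_nonneg hr] at this
    linarith
  rw [norm_div, norm_mul, hz, mul_one, norm_real, Real.norm_of_nonneg hr, mul_div_assoc',
    div_le_iff₀ h2]
  nlinarith [norm_nonneg (1 - z)]

section

variable {γ δ : ℂ} (hγ : 0 < γ.im) (hγδ : γ.im < δ.im)
include hγ hγδ

omit hγ hγδ in
lemma norm_regularPart_term_le {r : ℝ} (hr : 0 ≤ r) (hr1 : r < 1) (u : ℝ) (n : ℕ) :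
    ‖(structConst γ δ (n + 1 : ℕ) - 1) * r ^ (n + 1) * ((e u)⁻¹ ^ (n + 1) - e u ^ (n + 1))‖ ≤
      ‖structConst γ δ (n + 1 : ℕ) - 1‖ * 2 := by
  have h1 : ‖(e u)⁻¹ ^ (n + 1) - e u ^ (n + 1)‖ ≤ 2 := by
    refine (norm_sub_le _ _).trans ?_
    rw [norm_pow, norm_pow, norm_inv_e_ofReal, norm_e_ofReal, one_pow]
    norm_num
  have h2 : ‖(r : ℂ) ^ (n + 1)‖ ≤ 1 := by
    rw [norm_pow, norm_real, Real.norm_of_nonneg hr]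
    exact pow_le_one₀ hr hr1.le
  rw [norm_mul, norm_mul]
  refine mul_le_mul ?_ h1 (norm_nonneg _) (norm_nonneg _)
  exact mul_le_of_le_one_right (norm_nonneg _) h2

lemma exists_norm_regKernel_le : ∃ C : ℝ, ∀ r : ℝ, 0 ≤ r → r < 1 → ∀ u : ℝ,
    ‖1 - e u‖ * ‖regKernel γ δ r u‖ ≤ C := by
  set D := ∑' n : ℕ, ‖structConst γ δ (n + 1 : ℕ) - 1‖ * 2 with hD
  refine ⟨4 + 2 * D, fun r hr hr1 u => ?_⟩
  have h1 := norm_geom_le hr hr1 (norm_e_ofReal u)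
  have h2 := norm_geom_le hr hr1 (norm_inv_e_ofReal u)
  have h3 : ‖1 - (e u)⁻¹‖ = ‖1 - e u‖ := by
    rw [show 1 - (e (u : ℂ))⁻¹ = -((e u)⁻¹ * (1 - e u)) by
      rw [mul_sub, inv_mul_cancel₀ (e_ne_zero _)]; ring, norm_neg, norm_mul, norm_inv_e_ofReal,
      one_mul]
  rw [h3] at h2
  have h4 : ‖regularPart γ δ r u‖ ≤ D :=
    tsum_of_norm_bounded ((summable_norm_structConst_sub_one hγ hγδ).mul_right 2).hasSum
      (norm_regularPart_term_le hr hr1 u)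
  have h5 : ‖1 - e u‖ ≤ 2 := by
    refine (norm_sub_le _ _).trans ?_
    rw [norm_one, norm_e_ofReal]
    norm_num
  have h6 : ‖regKernel γ δ r u‖ ≤ ‖r * (e u)⁻¹ / (1 - r * (e u)⁻¹)‖ +
      ‖r * e u / (1 - r * e u)‖ + ‖regularPart γ δ r u‖ :=
    (norm_add_le _ _).trans (add_le_add_left (norm_sub_le _ _) _)
  have h7 : ‖1 - e u‖ * ‖regularPart γ δ r u‖ ≤ 2 * D :=
    mul_le_mul h5 h4 (norm_nonneg _) (by norm_num)
  have h8 := mul_le_mul_of_nonneg_left h6 (norm_nonneg (1 - e (u : ℂ)))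
  rw [mul_add, mul_add] at h8
  linarith

/-- The geometric terms converge because `e u ≠ 1`, the regular part by dominated convergence. The
limit is the Lambert expansion of `logDerivDiff_oddProd`, up to the factor `-(2πi)⁻¹`. -/
lemma tendsto_regKernel {u : ℝ} (hu : e u ≠ 1) :
    Tendsto (fun r => regKernel γ δ r u) (𝓝[<] 1)
      (𝓝 (-(2 * Real.pi * I)⁻¹ * logDerivDiff (oddProd δ) γ u)) := by
  have hu' : 1 - e u ≠ 0 := sub_ne_zero.mpr hu.symm
  have hu2 : 1 - (e u)⁻¹ ≠ 0 := by
    rw [sub_ne_zero]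
    intro h
    exact hu (inv_eq_one.mp h.symm)
  have hg : ∀ {z : ℂ}, 1 - z ≠ 0 →
      Tendsto (fun r : ℝ => r * z / (1 - r * z)) (𝓝[<] 1) (𝓝 (z / (1 - z))) := by
    intro z hz
    have : ContinuousAt (fun r : ℝ => r * z / (1 - r * z)) 1 := by
      refine ContinuousAt.div (by fun_prop) (by fun_prop) ?_
      simpa using hz
    have h2 := this.tendsto.mono_left (nhdsWithin_le_nhds (s := Set.Iio 1))
    simpa using h2
  have hr : Tendsto (fun r => regularPart γ δ r u) (𝓝[<] 1)
      (𝓝 (∑' n : ℕ, (structConst γ δ (n + 1 : ℕ) - 1) *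
        ((e u)⁻¹ ^ (n + 1) - e u ^ (n + 1)))) := by
    refine tendsto_tsum_of_dominated_convergence
      ((summable_norm_structConst_sub_one hγ hγδ).mul_right 2) (fun n => ?_) ?_
    · have : ContinuousAt (fun r : ℝ => (structConst γ δ (n + 1 : ℕ) - 1) * (r : ℂ) ^ (n + 1) *
          ((e u)⁻¹ ^ (n + 1) - e u ^ (n + 1))) 1 := by fun_prop
      have h2 := this.tendsto.mono_left (nhdsWithin_le_nhds (s := Set.Iio 1))
      simpa only [ofReal_one, one_pow, mul_one] using h2
    · have h0 : ∀ᶠ r : ℝ in 𝓝[<] 1, 0 ≤ r :=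
        nhdsWithin_le_nhds (eventually_ge_nhds one_pos)
      filter_upwards [h0, self_mem_nhdsWithin] with r hr hr1 n
      exact norm_regularPart_term_le hr hr1 u n
  have hs : ∑' n : ℕ, (structConst γ δ (n + 1 : ℕ) - 1) * ((e u)⁻¹ ^ (n + 1) - e u ^ (n + 1)) =
      (2 * lambert (e δ) (e δ * (e u)⁻¹) - lambert (e δ) (e γ * (e u)⁻¹) -
        lambert (e δ) (e δ / e γ * (e u)⁻¹)) -
      (2 * lambert (e δ) (e δ * e u) - lambert (e δ) (e γ * e u) -
        lambert (e δ) (e δ / e γ * e u)) := by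
    have := (hasSum_structConst_sub_one hγ hγδ (norm_inv_e_ofReal u)).sub
      (hasSum_structConst_sub_one hγ hγδ (norm_e_ofReal u))
    rw [← this.tsum_eq]
    exact tsum_congr fun n => by ring
  refine (((hg hu2).sub (hg hu')).add hr).trans (le_of_eq ?_)
  congr 1
  rw [hs, logDerivDiff_oddProd hγ hγδ hu]
  have h5 := e_ne_zero u
  have h6 : (e (u : ℂ))⁻¹ / (1 - (e u)⁻¹) - e u / (1 - e u) = -((1 + e u) / (1 - e u)) := by
    have : e (u : ℂ) - 1 ≠ 0 := sub_ne_zero.mpr hu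
    rw [show (e (u : ℂ))⁻¹ / (1 - (e u)⁻¹) = -(1 / (1 - e u)) by
      rw [← neg_sub (e (u : ℂ)) 1]
      field_simp]
    field_simp
    ring
  rw [h6, neg_mul, ← mul_assoc, inv_mul_cancel₀ Complex.two_pi_I_ne_zero, one_mul]
  ring

lemma hasSum_regKernel {r : ℝ} (hr : 0 ≤ r) (hr1 : r < 1) (u : ℝ) :
    HasSum (fun n : Mode => structConst γ δ n * (r : ℂ) ^ (n : ℤ).natAbs * e (-((n : ℤ) * u)))
      (regKernel γ δ r u) := by
  set f : ℤ → ℂ := fun n => structConst γ δ n * (r : ℂ) ^ n.natAbs * e (-(n * u)) with hf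
  have h0 : f 0 = 0 := by simp only [hf, structConst_zero, zero_mul]
  have hgeom : ∀ {z : ℂ}, ‖z‖ = 1 →
      HasSum (fun n : ℕ => (r * z) ^ (n + 1)) (r * z / (1 - r * z)) := by
    intro z hz
    have h1 : ‖(r : ℂ) * z‖ < 1 := by
      rwa [norm_mul, hz, mul_one, norm_real, Real.norm_of_nonneg hr]
    simpa only [pow_succ', div_eq_mul_inv] using
      (hasSum_geometric_of_norm_lt_one h1).mul_left (r * z)
  have hd : ∀ {z : ℂ}, ‖z‖ = 1 →
      Summable fun n : ℕ => (structConst γ δ (n + 1 : ℕ) - 1) * (r * z) ^ (n + 1) := by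
    intro z hz
    refine Summable.of_norm_bounded (summable_norm_structConst_sub_one hγ hγδ) fun n => ?_
    rw [norm_mul, norm_pow, norm_mul, hz, mul_one, norm_real, Real.norm_of_nonneg hr]
    exact mul_le_of_le_one_right (norm_nonneg _) (pow_le_one₀ hr hr1.le)
  have hsum : ∀ {z : ℂ}, ‖z‖ = 1 →
      HasSum (fun n : ℕ => structConst γ δ (n + 1 : ℕ) * (r * z) ^ (n + 1))
        (r * z / (1 - r * z) +
          ∑' n : ℕ, (structConst γ δ (n + 1 : ℕ) - 1) * (r * z) ^ (n + 1)) := by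
    intro z hz
    refine ((hgeom hz).add (hd hz).hasSum).congr_fun fun n => ?_
    ring
  have h1 : HasSum (fun n : ℕ => f n) (r * (e u)⁻¹ / (1 - r * (e u)⁻¹) +
      ∑' n : ℕ, (structConst γ δ (n + 1 : ℕ) - 1) * (r * (e u)⁻¹) ^ (n + 1)) := by
    rw [← hasSum_nat_add_iff' 1, Finset.sum_range_one, Nat.cast_zero, h0, sub_zero]
    refine (hsum (norm_inv_e_ofReal u)).congr_fun fun n => ?_
    simp only [hf]
    rw [Int.natAbs_natCast, Int.cast_natCast, ← mul_neg, e_nat_mul, e_neg, mul_pow]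
    ring
  have h2 : HasSum (fun n : ℕ => f (-(n + 1 : ℤ))) (-(r * e u / (1 - r * e u) +
      ∑' n : ℕ, (structConst γ δ (n + 1 : ℕ) - 1) * (r * e u) ^ (n + 1))) := by
    refine (hsum (norm_e_ofReal u)).neg.congr_fun fun n => ?_
    simp only [hf]
    rw [structConst_neg, Int.natAbs_neg, show (n + 1 : ℤ) = ((n + 1 : ℕ) : ℤ) by push_cast; rfl,
      Int.natAbs_natCast, Int.cast_neg, Int.cast_natCast,
      show -(-((n + 1 : ℕ) : ℂ) * u) = (n + 1 : ℕ) * (u : ℂ) by ring, e_nat_mul, mul_pow]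
    ring
  have h3 := HasSum.of_nat_of_neg_add_one h1 h2
  have h4 : HasSum (f ∘ ((↑) : Mode → ℤ)) (regKernel γ δ r u) := by
    -- The structure constant at `0` vanishes, so sums over all integers and over the modes agree.
    have : HasSum (({n : ℤ | n ≠ 0} : Set ℤ).indicator f) (regKernel γ δ r u) := by
      rw [Set.indicator_eq_self.mpr]
      · convert h3 using 1
        rw [regKernel, regularPart]
        have : ∑' n : ℕ, (structConst γ δ (n + 1 : ℕ) - 1) * (r : ℂ) ^ (n + 1) *
            ((e u)⁻¹ ^ (n + 1) - e u ^ (n + 1)) =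
            (∑' n : ℕ, (structConst γ δ (n + 1 : ℕ) - 1) * (r * (e u)⁻¹) ^ (n + 1)) -
            ∑' n : ℕ, (structConst γ δ (n + 1 : ℕ) - 1) * (r * e u) ^ (n + 1) := by
          rw [← (hd (norm_inv_e_ofReal u)).tsum_sub (hd (norm_e_ofReal u))]
          exact tsum_congr fun n => by rw [mul_pow, mul_pow]; ring
        rw [this]
        ring
      · intro n hn h
        rw [h] at hn
        exact hn h0
    exact (hasSum_subtype_iff_indicator (s := {n : ℤ | n ≠ 0})).mpr this
  exact h4

lemma summable_norm_structConst_mul_pow {r : ℝ} (hr : 0 ≤ r) (hr1 : r < 1) :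
    Summable fun n : Mode => ‖structConst γ δ n * (r : ℂ) ^ (n : ℤ).natAbs‖ := by
  have := (hasSum_regKernel hγ hγδ hr hr1 0).summable.norm
  simpa [e_zero] using this

end

/-! ### Coefficients of products of the field `η` -/

lemma pderiv_logField (n : Mode) (x : ℝ) :
    MvPowerSeries.pderiv ℂ n (logField x) = MvPowerSeries.C (e (-((n : ℤ) * x))) := by
  classical
  ext m
  rw [MvPowerSeries.coeff_pderiv, MvPowerSeries.coeff_C]
  by_cases hm : m = 0
  · subst hm
    rw [zero_add, coeff_logField_single, if_pos rfl, Finsupp.zero_apply, Nat.cast_zero, zero_add,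
      mul_one, e]
    congr 1
    ring
  · rw [if_neg hm, coeff_logField_of_ne, zero_mul]
    intro k hk
    have hd := congrArg Finsupp.degree hk
    rw [map_add, Finsupp.degree_single, Finsupp.degree_single, add_eq_right,
      Finsupp.degree_eq_zero_iff] at hd
    exact hm hd

/-- The chain rule coefficient by coefficient: the term `d = 0` drops out, and `(d + 1) / (d + 1)! =
1 / d!` turns the shifted exponential series back into itself. -/
lemma pderiv_eta (ε : ℂ) (n : Mode) (x : ℝ) :
    MvPowerSeries.pderiv ℂ n (eta ε x) = e (-((n : ℤ) * x)) • eta ε x := by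
  rw [eta, Derivation.map_smul, smul_comm]
  congr 1
  ext m
  set E := PowerSeries.exp ℂ with hE
  have hL := hasSubst_logField x
  rw [MvPowerSeries.coeff_pderiv, map_smul, PowerSeries.coeff_subst hL,
    PowerSeries.coeff_subst hL, smul_eq_mul, mul_comm, mul_finsum, mul_finsum]
  set g : ℕ → ℂ := fun d =>
    (m n + 1 : ℂ) * (PowerSeries.coeff d E • MvPowerSeries.coeff (m + Finsupp.single n 1)
      (logField x ^ d)) with hg
  have hterm : ∀ d : ℕ, g d = PowerSeries.coeff d E *
      MvPowerSeries.coeff m (MvPowerSeries.pderiv ℂ n (logField x ^ d)) := by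
    intro d
    rw [MvPowerSeries.coeff_pderiv]
    simp only [hg, smul_eq_mul]
    ring
  have h0 : g 0 = 0 := by
    rw [hterm, pow_zero, MvPowerSeries.pderiv_one, map_zero, mul_zero]
  have hsucc : ∀ d : ℕ, g (d + 1) = e (-((n : ℤ) * x)) *
      (PowerSeries.coeff d E • MvPowerSeries.coeff m (logField x ^ d)) := by
    intro d
    have h1 : PowerSeries.coeff (d + 1) E * (d + 1 : ℂ) = PowerSeries.coeff d E := by
      rw [hE, PowerSeries.coeff_exp, PowerSeries.coeff_exp, Nat.factorial_succ]
      have h2 : (d + 1 : ℂ) ≠ 0 := by exact_mod_cast Nat.succ_ne_zero d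
      have h3 : (d.factorial : ℂ) ≠ 0 := by exact_mod_cast Nat.factorial_ne_zero d
      simp only [map_div₀, map_one, map_natCast]
      push_cast
      field_simp
    rw [hterm, Derivation.leibniz_pow, pderiv_logField, Nat.add_sub_cancel, map_nsmul,
      smul_eq_mul, MvPowerSeries.coeff_mul_C, smul_eq_mul, ← h1, nsmul_eq_mul]
    push_cast
    ring
  have hrange : Function.support g ⊆ Set.range Nat.succ := by
    intro d hd
    rcases d with _ | d
    · exact absurd h0 hd
    · exact ⟨d, rfl⟩
  calc ∑ᶠ d, g d = ∑ᶠ d ∈ Set.range Nat.succ, g d := by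
        rw [← finsum_mem_univ]
        refine finsum_mem_inter_support_eq g _ _ ?_
        rw [Set.univ_inter, Set.inter_eq_right.mpr hrange]
    _ = ∑ᶠ d, g (d + 1) := finsum_mem_range Nat.succ_injective
    _ = _ := finsum_congr hsucc

variable {ι : Type*} [Fintype ι]

/-- The power sum `∑_i e^{-2πi n z_i}`. -/
def modeSum (n : ℤ) (z : ι → ℝ) : ℂ := ∑ i, e (-(n * z i))

/-- The coefficient of a monomial in `∏_i η(z_i)`. -/
def etaCoeff (ε : ℂ) (m : Mode →₀ ℕ) (z : ι → ℝ) : ℂ :=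
  MvPowerSeries.coeff m (∏ i, eta ε (z i))

omit [Fintype ι] in
lemma pderiv_prod_eta (ε : ℂ) (n : Mode) (z : ι → ℝ) (s : Finset ι) :
    MvPowerSeries.pderiv ℂ n (∏ i ∈ s, eta ε (z i)) =
      (∑ i ∈ s, e (-((n : ℤ) * z i))) • ∏ i ∈ s, eta ε (z i) := by
  classical
  induction s using Finset.induction_on with
  | empty => simp
  | insert a s ha ih =>
    rw [Finset.prod_insert ha, Finset.sum_insert ha, Derivation.leibniz, ih, pderiv_eta, add_smul,
      smul_eq_mul, smul_eq_mul, mul_smul_comm, mul_smul_comm, mul_comm (∏ i ∈ s, eta ε (z i)),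
      add_comm]

/-- Turns `∂/∂λ_n` into multiplication by a power sum under the integral. As a recursion starting
from `etaCoeff_zero`, it also yields continuity and boundedness of all coefficients. -/
lemma etaCoeff_add_single (ε : ℂ) (n : Mode) (m : Mode →₀ ℕ) (z : ι → ℝ) :
    etaCoeff ε (m + Finsupp.single n 1) z * (m n + 1) = modeSum n z * etaCoeff ε m z := by
  rw [etaCoeff, ← MvPowerSeries.coeff_pderiv, pderiv_prod_eta, map_smul, smul_eq_mul]
  rfl

lemma etaCoeff_zero (ε : ℂ) (z : ι → ℝ) : etaCoeff ε 0 z = ε ^ Fintype.card ι := by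
  have h : ∀ x : ℝ, MvPowerSeries.constantCoeff (eta ε x) = ε := by
    intro x
    have hL := hasSubst_logField x
    have hL0 : MvPowerSeries.constantCoeff (logField x) = 0 := by
      rw [← MvPowerSeries.coeff_zero_eq_constantCoeff_apply]
      exact coeff_logField_of_ne x fun n h =>
        one_ne_zero (Finsupp.single_eq_zero.mp h.symm)
    rw [eta, ← MvPowerSeries.coeff_zero_eq_constantCoeff_apply, map_smul,
      MvPowerSeries.coeff_zero_eq_constantCoeff_apply, PowerSeries.constantCoeff_subst hL,
      finsum_eq_single _ 0]
    · simp
    · intro d hd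
      rw [map_pow, hL0, zero_pow hd, smul_zero]
  rw [etaCoeff, MvPowerSeries.coeff_zero_eq_constantCoeff_apply, map_prod]
  simp [h, Finset.card_univ]

lemma monomial_induction {P : (Mode →₀ ℕ) → Prop} (m : Mode →₀ ℕ) (h0 : P 0)
    (h1 : ∀ m n, P m → P (m + Finsupp.single n 1)) : P m := by
  induction m using Finsupp.induction with
  | zero => exact h0
  | single_add n b m _ _ ih =>
    induction b with
    | zero => simpa using ih
    | succ b ihb =>
      by_cases hb : b = 0
      · subst hb
        rw [add_comm]
        simpa using h1 _ n ih
      · have := h1 _ n (ihb hb)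
        rwa [add_right_comm, ← Finsupp.single_add] at this

lemma continuous_e : Continuous e := differentiable_e.continuous

lemma continuous_modeSum (n : ℤ) : Continuous (modeSum n : (ι → ℝ) → ℂ) := by
  refine continuous_finsetSum _ fun i _ => continuous_e.comp ?_
  fun_prop

lemma norm_modeSum_le (n : ℤ) (z : ι → ℝ) : ‖modeSum n z‖ ≤ Fintype.card ι := by
  refine (norm_sum_le _ _).trans (le_of_eq ?_)
  have : ∀ i, ‖e (-(n * z i))‖ = 1 := fun i => by
    have := norm_e_ofReal (-(n * z i))
    push_cast at this
    exact this
  simp [this]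

lemma etaCoeff_add_single' (ε : ℂ) (n : Mode) (m : Mode →₀ ℕ) (z : ι → ℝ) :
    etaCoeff ε (m + Finsupp.single n 1) z = modeSum n z * etaCoeff ε m z / (m n + 1) := by
  rw [← etaCoeff_add_single, mul_div_cancel_right₀]
  exact_mod_cast Nat.succ_ne_zero (m n)

lemma continuous_etaCoeff (ε : ℂ) (m : Mode →₀ ℕ) :
    Continuous (etaCoeff ε m : (ι → ℝ) → ℂ) := by
  induction m using monomial_induction with
  | h0 =>
    rw [show (etaCoeff ε 0 : (ι → ℝ) → ℂ) = fun _ => ε ^ Fintype.card ι from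
      funext (etaCoeff_zero ε)]
    exact continuous_const
  | h1 m n ih =>
    rw [show (etaCoeff ε (m + Finsupp.single n 1) : (ι → ℝ) → ℂ) =
      fun z => modeSum n z * etaCoeff ε m z / (m n + 1) from funext (etaCoeff_add_single' ε n m)]
    exact ((continuous_modeSum n).mul ih).div_const _

lemma exists_norm_etaCoeff_le (ε : ℂ) (m : Mode →₀ ℕ) :
    ∃ C : ℝ, ∀ z : ι → ℝ, ‖etaCoeff ε m z‖ ≤ C := by
  induction m using monomial_induction with
  | h0 => exact ⟨‖ε ^ Fintype.card ι‖, fun z => by rw [etaCoeff_zero]⟩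
  | h1 m n ih =>
    obtain ⟨C, hC⟩ := ih
    refine ⟨Fintype.card ι * C / ‖(m n + 1 : ℂ)‖, fun z => ?_⟩
    rw [etaCoeff_add_single', norm_div, norm_mul]
    refine div_le_div_of_nonneg_right ?_ (norm_nonneg _)
    exact mul_le_mul (norm_modeSum_le _ _) (hC z) (norm_nonneg _) (Nat.cast_nonneg _)

lemma etaCoeff_comp_perm (ε : ℂ) (m : Mode →₀ ℕ) (σ : Equiv.Perm ι) (z : ι → ℝ) :
    etaCoeff ε m (z ∘ σ) = etaCoeff ε m z := by
  have h : ∏ i, eta ε ((z ∘ σ) i) = ∏ i, eta ε (z i) :=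
    Equiv.prod_comp σ fun i => eta ε (z i)
  rw [etaCoeff, h, etaCoeff]

lemma etaCoeff_sum {κ : Type*} [Fintype κ] (ε : ℂ) (m : Mode →₀ ℕ) (z : ι ⊕ κ → ℝ) :
    etaCoeff ε m z = ∑ ab ∈ Finset.HasAntidiagonal.antidiagonal m,
      etaCoeff ε ab.1 (z ∘ Sum.inl) * etaCoeff ε ab.2 (z ∘ Sum.inr) := by
  have h : ∏ i, eta ε (z i) = (∏ i, eta ε ((z ∘ Sum.inl) i)) * ∏ i, eta ε ((z ∘ Sum.inr) i) :=
    Fintype.prod_sum_type _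
  simp only [etaCoeff]
  rw [h, MvPowerSeries.coeff_mul]

/-! ### Periodic Lipschitz functions -/

lemma norm_e_sub_e (s t : ℝ) : ‖e s - e t‖ = ‖1 - e ((s - t : ℝ) : ℂ)‖ := by
  have h : e (s : ℂ) - e t = -(e t * (1 - e ((s - t : ℝ) : ℂ))) := by
    rw [mul_sub, ← e_add, mul_one]
    push_cast
    rw [add_sub_cancel]
    ring
  rw [h, norm_neg, norm_mul, norm_e_ofReal, one_mul]

/-- The chord is `2 |sin πw|`, and Jordan's inequality bounds `|sin πw|` below by `2 |w|`. -/
lemma four_mul_abs_le_norm_one_sub_e {w : ℝ} (hw : |w| ≤ 1 / 2) : 4 * |w| ≤ ‖1 - e w‖ := by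
  have h1 : e (w : ℂ) = cexp (I * ((2 * Real.pi * w : ℝ) : ℂ)) := by
    rw [e]; congr 1; push_cast; ring
  have hpi := Real.pi_pos
  have h2 := Real.mul_abs_le_abs_sin (x := Real.pi * w) (by
    rw [abs_mul, abs_of_pos hpi]; nlinarith)
  rw [norm_sub_rev, h1, Complex.norm_exp_I_mul_ofReal_sub_one, norm_mul, Real.norm_eq_abs,
    Real.norm_eq_abs, abs_two, show 2 * Real.pi * w / 2 = Real.pi * w by ring]
  rw [abs_mul, abs_of_pos hpi, ← mul_assoc, div_mul_cancel₀ _ hpi.ne'] at h2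
  linarith

/-- A continuously differentiable function of period `1` is bounded, and Lipschitz with respect to
the chordal distance. -/
lemma exists_lipschitz_of_periodic {g : ℝ → ℂ} (hg : ContDiff ℝ 1 g) (hper : g.Periodic 1) :
    (∃ M, ∀ s, ‖g s‖ ≤ M) ∧ ∃ C, ∀ s t, ‖g s - g t‖ ≤ C * ‖e s - e t‖ := by
  constructor
  · obtain ⟨M, hM⟩ := isCompact_Icc.exists_bound_of_continuousOn
      (hg.continuous.continuousOn (s := Set.Icc (0 : ℝ) 1))
    refine ⟨M, fun s => ?_⟩
    have := hM (Int.fract s) ⟨Int.fract_nonneg s, (Int.fract_lt_one s).le⟩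
    rwa [← Int.self_sub_floor, ← mul_one ((⌊s⌋ : ℤ) : ℝ), hper.sub_int_mul_eq] at this
  · obtain ⟨D, hD⟩ := isCompact_Icc.exists_bound_of_continuousOn
      ((hg.continuous_deriv le_rfl).continuousOn (s := Set.Icc (-1 : ℝ) 2))
    have hD0 : 0 ≤ D := (norm_nonneg _).trans (hD 0 ⟨by norm_num, by norm_num⟩)
    refine ⟨D / 4, fun s t => ?_⟩
    -- The representative of `s - t` modulo `1` with `|w| ≤ 1/2`: the point `Int.fract t + w` stays
    -- in `[-1, 2]`, where `D` bounds the derivative, and `4 * |w|` is at most the chord, whence `D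
    -- / 4`.
    set w := s - t - round (s - t) with hw
    have hwabs : |w| ≤ 1 / 2 := abs_sub_round _
    have h1 : e ((s - t : ℝ) : ℂ) = e w := by
      rw [hw, ofReal_sub (s - t), ofReal_intCast, e_sub (((s - t : ℝ)) : ℂ), e_int, div_one]
    have ht : g t = g (Int.fract t) := by
      rw [← Int.self_sub_floor, ← mul_one ((⌊t⌋ : ℤ) : ℝ), hper.sub_int_mul_eq]
    have hs : g s = g (Int.fract t + w) := by
      have : Int.fract t + w = s - ((⌊t⌋ + round (s - t) : ℤ) : ℝ) * 1 := by
        rw [← Int.self_sub_floor, hw]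
        push_cast
        ring
      rw [this, hper.sub_int_mul_eq]
    have hf0 := Int.fract_nonneg t
    have hf1 := (Int.fract_lt_one t).le
    obtain ⟨hw1, hw2⟩ := abs_le.mp hwabs
    have h2 := (convex_Icc (-1 : ℝ) 2).norm_image_sub_le_of_norm_deriv_le
      (f := g) (C := D) (x := Int.fract t) (y := Int.fract t + w)
      (fun x _ => (hg.differentiable one_ne_zero).differentiableAt) hD
      ⟨by linarith, by linarith⟩ ⟨by linarith, by linarith⟩
    rw [add_sub_cancel_left, Real.norm_eq_abs] at h2
    rw [hs, ht, norm_e_sub_e, h1]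
    have h3 := four_mul_abs_le_norm_one_sub_e hwabs
    nlinarith

/-! ### Functions that change little when two coordinates are exchanged -/

section SwapLipschitz

variable {ι : Type*} [DecidableEq ι]

/-- Bounded functions which change under `z_i ↔ z_j` by at most a constant times the chordal
distance of `z_i` and `z_j`. -/
def SwapLipschitz (i j : ι) (F : (ι → ℝ) → ℂ) : Prop :=
  (∃ M, ∀ z, ‖F z‖ ≤ M) ∧
    ∃ C, ∀ z, ‖F (z ∘ Equiv.swap i j) - F z‖ ≤ C * ‖e (z i) - e (z j)‖

namespace SwapLipschitz

variable {i j : ι}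

lemma const (c : ℂ) : SwapLipschitz i j fun _ => c :=
  ⟨⟨‖c‖, fun _ => le_rfl⟩, 0, fun z => by simp⟩

lemma mul {F G : (ι → ℝ) → ℂ} (hF : SwapLipschitz i j F) (hG : SwapLipschitz i j G) :
    SwapLipschitz i j fun z => F z * G z := by
  obtain ⟨⟨M, hM⟩, C, hC⟩ := hF
  obtain ⟨⟨N, hN⟩, D, hD⟩ := hG
  have hM0 : 0 ≤ M := (norm_nonneg _).trans (hM 0)
  have hN0 : 0 ≤ N := (norm_nonneg _).trans (hN 0)
  refine ⟨⟨M * N, fun z => ?_⟩, M * D + N * C, fun z => ?_⟩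
  · rw [norm_mul]
    exact mul_le_mul (hM z) (hN z) (norm_nonneg _) hM0
  · have h1 : F (z ∘ Equiv.swap i j) * G (z ∘ Equiv.swap i j) - F z * G z =
        F (z ∘ Equiv.swap i j) * (G (z ∘ Equiv.swap i j) - G z) +
          G z * (F (z ∘ Equiv.swap i j) - F z) := by ring
    rw [h1]
    refine (norm_add_le _ _).trans ?_
    rw [norm_mul, norm_mul, add_mul, mul_assoc, mul_assoc]
    exact add_le_add (mul_le_mul (hM _) (hD z) (norm_nonneg _) hM0)
      (mul_le_mul (hN _) (hC z) (norm_nonneg _) hN0)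

lemma add {F G : (ι → ℝ) → ℂ} (hF : SwapLipschitz i j F) (hG : SwapLipschitz i j G) :
    SwapLipschitz i j fun z => F z + G z := by
  obtain ⟨⟨M, hM⟩, C, hC⟩ := hF
  obtain ⟨⟨N, hN⟩, D, hD⟩ := hG
  refine ⟨⟨M + N, fun z => (norm_add_le _ _).trans (add_le_add (hM z) (hN z))⟩,
    C + D, fun z => ?_⟩
  rw [add_sub_add_comm, add_mul]
  exact (norm_add_le _ _).trans (add_le_add (hC z) (hD z))

lemma prod {α : Type*} (s : Finset α) {F : α → (ι → ℝ) → ℂ}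
    (h : ∀ a ∈ s, SwapLipschitz i j (F a)) : SwapLipschitz i j fun z => ∏ a ∈ s, F a z := by
  classical
  induction s using Finset.induction_on with
  | empty => simpa using const 1
  | insert a s ha ih =>
    simp only [Finset.prod_insert ha]
    exact (h a (Finset.mem_insert_self _ _)).mul
      (ih fun b hb => h b (Finset.mem_insert_of_mem hb))

lemma sum {α : Type*} (s : Finset α) {F : α → (ι → ℝ) → ℂ}
    (h : ∀ a ∈ s, SwapLipschitz i j (F a)) : SwapLipschitz i j fun z => ∑ a ∈ s, F a z := by
  classical
  induction s using Finset.induction_on with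
  | empty => simpa using const 0
  | insert a s ha ih =>
    simp only [Finset.sum_insert ha]
    exact (h a (Finset.mem_insert_self _ _)).add
      (ih fun b hb => h b (Finset.mem_insert_of_mem hb))

/-- The swap moves each coordinate by at most the chordal distance of `z_i` and `z_j`, hence a
difference of two coordinates by at most twice that. -/
lemma comp_sub {g : ℝ → ℂ} (hg : ContDiff ℝ 1 g) (hper : g.Periodic 1) (a b : ι) :
    SwapLipschitz i j fun z => g (z a - z b) := by
  obtain ⟨⟨M, hM⟩, C, hC⟩ := exists_lipschitz_of_periodic hg hper
  refine ⟨⟨M, fun z => hM _⟩, |C| * 2, fun z => ?_⟩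
  have hswap : ∀ c, ‖e ((z ∘ Equiv.swap i j) c) - e (z c)‖ ≤ ‖e (z i) - e (z j)‖ := by
    intro c
    simp only [Function.comp]
    by_cases hi : c = i
    · rw [hi, Equiv.swap_apply_left, norm_sub_rev]
    · by_cases hj : c = j
      · rw [hj, Equiv.swap_apply_right]
      · rw [Equiv.swap_apply_of_ne_of_ne hi hj, sub_self, norm_zero]
        exact norm_nonneg _
  set y := z ∘ Equiv.swap i j with hy
  have h1 : ‖e ((y a - y b : ℝ) : ℂ) - e ((z a - z b : ℝ) : ℂ)‖ ≤
      2 * ‖e (z i) - e (z j)‖ := by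
    have h2 : e ((y a - y b : ℝ) : ℂ) - e ((z a - z b : ℝ) : ℂ) =
        (e (y a) - e (z a)) * e ((-y b : ℝ) : ℂ) -
          (e (y b) - e (z b)) * (e ((-y b : ℝ) : ℂ) * e ((z a - z b : ℝ) : ℂ)) := by
      have hb := e_ne_zero (y b : ℂ)
      have hb' := e_ne_zero (z b : ℂ)
      push_cast
      rw [e_sub, e_sub, e_neg]
      field_simp
      ring
    rw [h2]
    refine (norm_sub_le _ _).trans ?_
    rw [norm_mul, norm_mul, norm_mul, norm_e_ofReal, norm_e_ofReal, mul_one, mul_one, mul_one,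
      two_mul]
    exact add_le_add (hswap a) (hswap b)
  calc ‖g (y a - y b) - g (z a - z b)‖
      ≤ C * ‖e ((y a - y b : ℝ) : ℂ) - e ((z a - z b : ℝ) : ℂ)‖ := hC _ _
    _ ≤ |C| * ‖e ((y a - y b : ℝ) : ℂ) - e ((z a - z b : ℝ) : ℂ)‖ :=
        mul_le_mul_of_nonneg_right (le_abs_self C) (norm_nonneg _)
    _ ≤ |C| * (2 * ‖e (z i) - e (z j)‖) := mul_le_mul_of_nonneg_left h1 (abs_nonneg C)
    _ = _ := by ring

end SwapLipschitz

end SwapLipschitz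

/-! ### The uniform measure on a box -/

section box

variable (ι : Type*) [Fintype ι]

/-- Lebesgue measure on `(-1/2, 1/2]^ι`. -/
def boxMeasure : Measure (ι → ℝ) :=
  Measure.pi fun _ => (volume : Measure ℝ).restrict (Set.Ioc (-1 / 2) (1 / 2))

lemma boxMeasure_eq : boxMeasure ι =
    (volume : Measure (ι → ℝ)).restrict (Set.univ.pi fun _ => Set.Ioc (-1 / 2) (1 / 2)) := by
  rw [boxMeasure, volume_pi, Measure.restrict_pi_pi]

instance : IsFiniteMeasure (boxMeasure ι) := by
  have : IsFiniteMeasure ((volume : Measure ℝ).restrict (Set.Ioc (-1 / 2) (1 / 2))) := inferInstance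
  unfold boxMeasure
  infer_instance

variable {ι}

lemma integrable_boxMeasure {F : (ι → ℝ) → ℂ} (hF : Continuous F) :
    Integrable F (boxMeasure ι) := by
  rw [boxMeasure_eq]
  have h : IntegrableOn F (Set.Icc (fun _ => -1 / 2) (fun _ => 1 / 2)) :=
    hF.continuousOn.integrableOn_Icc
  refine h.mono_set fun x hx => ?_
  exact ⟨fun i => (hx i trivial).1.le, fun i => (hx i trivial).2⟩

lemma integral_comp_perm (σ : Equiv.Perm ι) (F : (ι → ℝ) → ℂ) :
    ∫ z, F (z ∘ σ) ∂boxMeasure ι = ∫ z, F z ∂boxMeasure ι := by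
  have h := measurePreserving_piCongrLeft
    (fun _ : ι => (volume : Measure ℝ).restrict (Set.Ioc (-1 / 2) (1 / 2))) σ.symm
  have h2 := h.integral_comp (MeasurableEquiv.measurableEmbedding _) F
  rw [boxMeasure, ← h2]
  congr 1
  funext z
  congr 1
  funext i
  have := MeasurableEquiv.piCongrLeft_apply_apply (β := fun _ : ι => ℝ) σ.symm z (σ i)
  rw [Equiv.symm_apply_apply] at this
  exact this.symm

lemma integral_sum_mul {κ : Type*} [Fintype κ] (F : (ι → ℝ) → ℂ) (G : (κ → ℝ) → ℂ) :
    ∫ z, F (z ∘ Sum.inl) * G (z ∘ Sum.inr) ∂boxMeasure (ι ⊕ κ) =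
      (∫ x, F x ∂boxMeasure ι) * ∫ y, G y ∂boxMeasure κ := by
  rw [← integral_prod_mul]
  have h := measurePreserving_sumPiEquivProdPi (X := fun _ : ι ⊕ κ => ℝ)
    (fun _ => (volume : Measure ℝ).restrict (Set.Ioc (-1 / 2) (1 / 2)))
  exact h.integral_comp (MeasurableEquiv.measurableEmbedding _)
    (fun p : (ι → ℝ) × (κ → ℝ) => F p.1 * G p.2)

/-- The set is a translate of a hyperplane. -/
lemma volume_sub_eq_zero {i j : ι} (hij : i ≠ j) (n : ℤ) :
    volume {z : ι → ℝ | z i - z j = n} = 0 := by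
  classical
  let φ : (ι → ℝ) →ₗ[ℝ] ℝ := LinearMap.proj (R := ℝ) (φ := fun _ => ℝ) i - LinearMap.proj j
  have hker : LinearMap.ker φ ≠ ⊤ := by
    intro h
    have h1 : φ (Pi.single i 1) = 0 := by
      rw [← LinearMap.mem_ker, h]
      trivial
    simp [φ, hij.symm] at h1
  have h0 := Measure.addHaar_submodule (volume : Measure (ι → ℝ)) (LinearMap.ker φ) hker
  rw [← measure_preimage_add_right volume (Pi.single i (-(n : ℝ)))] at h0
  convert h0 using 2
  ext z
  simp only [Set.mem_ofPred_eq, Set.mem_preimage, SetLike.mem_coe, LinearMap.mem_ker, φ,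
    LinearMap.sub_apply, LinearMap.proj_apply, Pi.add_apply, Pi.single_eq_same,
    Pi.single_eq_of_ne hij.symm]
  constructor <;> intro h <;> linarith

lemma ae_boxMeasure_ne : ∀ᵐ z ∂boxMeasure ι, ∀ i j, i ≠ j → e ((z i - z j : ℝ) : ℂ) ≠ 1 := by
  rw [boxMeasure_eq]
  refine ae_restrict_of_ae ?_
  rw [ae_all_iff]
  intro i
  rw [ae_all_iff]
  intro j
  by_cases hij : i = j
  · simp [hij]
  have : ∀ᵐ z : ι → ℝ, ∀ n : ℤ, z i - z j ≠ n := by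
    rw [ae_all_iff]
    exact fun n => by
      rw [ae_iff]
      simpa using volume_sub_eq_zero hij n
  filter_upwards [this] with z hz _ h
  obtain ⟨n, hn⟩ := e_eq_one_iff.mp h
  exact hz n (by exact_mod_cast hn)

end box

/-! ### Symmetrisation over splittings of the variables -/

section weights

variable {ι : Type*} [Fintype ι] [DecidableEq ι]

/-- The product of the kernels in the variables `z_i`, `i ∈ I`, and `z_j`, `j ∉ I`. -/
def splitWeight (γ δ : ℂ) (I : Finset ι) (z : ι → ℝ) : ℂ :=
  pairProd (shiftRatio (oddProd δ) γ) (fun i => (z i : ℂ)) I *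
    pairProd (shiftRatio (oddProd δ) γ) (fun i => (z i : ℂ)) (Finset.univ \ I)

/-- `∑_{i ∈ I, j ∉ I} K(z_i - z_j)`. -/
def crossSum (K : ℝ → ℂ) (I : Finset ι) (z : ι → ℝ) : ℂ :=
  ∑ i ∈ I, ∑ j ∈ Finset.univ \ I, K (z i - z j)

/-- The sum of the weights over all `I` with `|I| = k`, `i ∈ I` and `j ∉ I`. -/
def separatingWeight (γ δ : ℂ) (k : ℕ) (i j : ι) (z : ι → ℝ) : ℂ :=
  ∑ I ∈ Finset.univ.powersetCard k with i ∈ I ∧ j ∉ I, splitWeight γ δ I z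

lemma map_univ_sdiff (σ : Equiv.Perm ι) (I : Finset ι) :
    (Finset.univ \ I).map σ.toEmbedding = Finset.univ \ I.map σ.toEmbedding := by
  ext i
  simp only [Finset.mem_map_equiv, Finset.mem_sdiff, Finset.mem_univ, true_and]

omit [Fintype ι] in
lemma pairProd_comp_perm (h : ℂ → ℂ) (σ : Equiv.Perm ι) (I : Finset ι) (z : ι → ℂ) :
    pairProd h (z ∘ σ) I = pairProd h z (I.map σ.toEmbedding) := by
  simp only [pairProd, Finset.prod_map, Equiv.coe_toEmbedding, σ.injective.eq_iff, Function.comp]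

lemma splitWeight_comp_perm (γ δ : ℂ) (σ : Equiv.Perm ι) (I : Finset ι) (z : ι → ℝ) :
    splitWeight γ δ I (z ∘ σ) = splitWeight γ δ (I.map σ.toEmbedding) z := by
  have h : (fun i => (((z ∘ σ) i : ℝ) : ℂ)) = (fun i => (z i : ℂ)) ∘ σ := rfl
  rw [splitWeight, h, pairProd_comp_perm, pairProd_comp_perm, map_univ_sdiff, splitWeight]

lemma crossSum_comp_perm (K : ℝ → ℂ) (σ : Equiv.Perm ι) (I : Finset ι) (z : ι → ℝ) :
    crossSum K I (z ∘ σ) = crossSum K (I.map σ.toEmbedding) z := by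
  rw [crossSum, crossSum, ← map_univ_sdiff]
  simp only [Finset.sum_map, Equiv.coe_toEmbedding, Function.comp]

/-- Exhibits the difference of the weights for `(i, j)` and `(j, i)` as an increment under the swap,
to which the `SwapLipschitz` bound applies. -/
lemma separatingWeight_comp_swap (γ δ : ℂ) (k : ℕ) (i j : ι) (z : ι → ℝ) :
    separatingWeight γ δ k i j (z ∘ Equiv.swap i j) = separatingWeight γ δ k j i z := by
  simp only [separatingWeight, splitWeight_comp_perm]
  have hmap : ∀ I : Finset ι, (I.map (Equiv.swap i j).toEmbedding).map
      (Equiv.swap i j).toEmbedding = I := by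
    intro I
    ext a
    simp [Finset.mem_map_equiv]
  refine Finset.sum_bij' (fun I _ => I.map (Equiv.swap i j).toEmbedding)
    (fun I _ => I.map (Equiv.swap i j).toEmbedding) ?_ ?_ (fun I _ => hmap I)
    (fun I _ => hmap I) fun I _ => rfl
  all_goals
    intro I hI
    simp only [Finset.mem_filter, Finset.mem_powersetCard, Finset.subset_univ, true_and,
      Finset.card_map, Finset.mem_map_equiv, Equiv.symm_swap, Equiv.swap_apply_left,
      Equiv.swap_apply_right] at hI ⊢
    exact hI

lemma sum_splitWeight_mul_crossSum (γ δ : ℂ) (k : ℕ) (K : ℝ → ℂ) (z : ι → ℝ) :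
    ∑ I ∈ Finset.univ.powersetCard k, splitWeight γ δ I z * crossSum K I z =
      ∑ i, ∑ j, K (z i - z j) * separatingWeight γ δ k i j z := by
  have h1 : ∀ I : Finset ι, crossSum K I z =
      ∑ i, ∑ j, if i ∈ I ∧ j ∉ I then K (z i - z j) else 0 := by
    intro I
    rw [crossSum, ← Finset.sum_subset (Finset.subset_univ I)]
    · refine Finset.sum_congr rfl fun i hi => ?_
      rw [← Finset.sum_subset (Finset.subset_univ (Finset.univ \ I))]
      · refine Finset.sum_congr rfl fun j hj => ?_
        rw [if_pos ⟨hi, (Finset.mem_sdiff.mp hj).2⟩]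
      · intro j _ hj
        rw [if_neg]
        rintro ⟨_, h⟩
        exact hj (Finset.mem_sdiff.mpr ⟨Finset.mem_univ j, h⟩)
    · intro i _ hi
      exact Finset.sum_eq_zero fun j _ => if_neg fun h => hi h.1
  simp only [h1, separatingWeight, Finset.mul_sum, Finset.sum_filter]
  rw [Finset.sum_comm]
  refine Finset.sum_congr rfl fun i _ => ?_
  rw [Finset.sum_comm]
  refine Finset.sum_congr rfl fun j _ => Finset.sum_congr rfl fun I _ => ?_
  split_ifs <;> ring

/-- Oddness of `K` pairs `(i, j)` with `(j, i)`, so that `K` appears multiplied by a difference of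
weights that is small near its pole. -/
lemma two_mul_sum_splitWeight_mul_crossSum (γ δ : ℂ) (k : ℕ) {K : ℝ → ℂ}
    (hK : ∀ u, K (-u) = -K u) (z : ι → ℝ) :
    2 * ∑ I ∈ Finset.univ.powersetCard k, splitWeight γ δ I z * crossSum K I z =
      ∑ i, ∑ j, K (z i - z j) *
        (separatingWeight γ δ k i j z - separatingWeight γ δ k j i z) := by
  rw [sum_splitWeight_mul_crossSum, two_mul]
  nth_rewrite 2 [Finset.sum_comm]
  simp only [← Finset.sum_add_distrib]
  refine Finset.sum_congr rfl fun i _ => Finset.sum_congr rfl fun j _ => ?_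
  rw [← neg_sub (z i) (z j), hK]
  ring

/-! ### Uniform bounds and the limit `r → 1` -/

section analytic

variable {γ δ : ℂ} (hγ : 0 < γ.im) (hγδ : γ.im < δ.im)
include hγ hγδ

lemma oddProd_ofReal_add_ne_zero (u : ℝ) : oddProd δ (u + γ) ≠ 0 :=
  (isOddTheta_oddProd (hγ.trans hγδ)).ne_zero (notMem_lattice_of_im (by simpa) (by simpa))

lemma contDiff_shiftRatio : ContDiff ℝ 1 fun u : ℝ => shiftRatio (oddProd δ) γ u := by
  have hd : ContDiff ℝ 1 (oddProd δ) :=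
    ((differentiable_oddProd (hγ.trans hγδ)).contDiff (n := 1)).restrict_scalars ℝ
  have h1 : ContDiff ℝ 1 fun u : ℝ => (u : ℂ) := ofRealCLM.contDiff
  simp only [shiftRatio, div_eq_mul_inv]
  exact (hd.comp h1).mul ((hd.comp (h1.add contDiff_const)).inv
    (oddProd_ofReal_add_ne_zero hγ hγδ))

lemma periodic_shiftRatio : (fun u : ℝ => shiftRatio (oddProd δ) γ u).Periodic 1 := by
  intro u
  have hf := isOddTheta_oddProd (hγ.trans hγδ)
  simp only [shiftRatio, ofReal_add, ofReal_one]
  rw [add_right_comm, hf.add_one, hf.add_one, neg_div_neg_eq]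

omit [Fintype ι] in
lemma swapLipschitz_pairProd (i j : ι) (I : Finset ι) : SwapLipschitz i j fun z : ι → ℝ =>
    pairProd (shiftRatio (oddProd δ) γ) (fun i => (z i : ℂ)) I := by
  refine SwapLipschitz.prod _ fun a _ => SwapLipschitz.prod _ fun b _ => ?_
  by_cases hab : a = b
  · simpa only [if_pos hab] using SwapLipschitz.const 1
  · simpa only [if_neg hab, ofReal_sub] using
      SwapLipschitz.comp_sub (contDiff_shiftRatio hγ hγδ) (periodic_shiftRatio hγ hγδ) a b

omit [Fintype ι] in
lemma continuous_pairProd (I : Finset ι) : Continuous fun z : ι → ℝ =>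
    pairProd (shiftRatio (oddProd δ) γ) (fun i => (z i : ℂ)) I := by
  refine continuous_finsetProd _ fun a _ => continuous_finsetProd _ fun b _ => ?_
  by_cases hab : a = b
  · simpa only [if_pos hab] using continuous_const
  · have h : Continuous fun z : ι → ℝ => z a - z b := by fun_prop
    simpa only [if_neg hab, ofReal_sub, Function.comp_def] using
      (contDiff_shiftRatio hγ hγδ).continuous.comp h

lemma continuous_splitWeight (I : Finset ι) :
    Continuous (splitWeight γ δ I : (ι → ℝ) → ℂ) :=
  (continuous_pairProd hγ hγδ I).mul (continuous_pairProd hγ hγδ _)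

lemma exists_norm_separatingWeight_sub_le (k : ℕ) (i j : ι) : ∃ C, ∀ z : ι → ℝ,
    ‖separatingWeight γ δ k i j z - separatingWeight γ δ k j i z‖ ≤ C * ‖e (z i) - e (z j)‖ := by
  have h : SwapLipschitz i j (separatingWeight γ δ k i j) :=
    SwapLipschitz.sum _ fun I _ =>
      (swapLipschitz_pairProd hγ hγδ i j I).mul (swapLipschitz_pairProd hγ hγδ i j _)
  obtain ⟨_, C, hC⟩ := h
  refine ⟨C, fun z => ?_⟩
  have h := hC z
  rw [separatingWeight_comp_swap] at h
  rwa [norm_sub_rev]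

/-- The kernel is at most `B / ‖1 - e(z_i - z_j)‖` off the diagonal, with `B` independent of `r`,
and the weight difference is at most a constant times `‖1 - e(z_i - z_j)‖`. The product supplies the
dominating constant. -/
lemma exists_norm_sum_splitWeight_le (k : ℕ) : ∃ C : ℝ, ∀ r : ℝ, 0 ≤ r → r < 1 → ∀ z : ι → ℝ,
    ‖∑ I ∈ Finset.univ.powersetCard k, splitWeight γ δ I z *
      crossSum (regKernel γ δ r) I z‖ ≤ C := by
  obtain ⟨B, hB⟩ := exists_norm_regKernel_le hγ hγδ
  choose C hC using fun i j : ι => exists_norm_separatingWeight_sub_le hγ hγδ k i j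
  refine ⟨∑ i, ∑ j, |C i j| * B, fun r hr hr1 z => ?_⟩
  set S := ∑ I ∈ Finset.univ.powersetCard k, splitWeight γ δ I z *
    crossSum (regKernel γ δ r) I z with hS
  have h2 : ‖2 * S‖ ≤ ∑ i, ∑ j, |C i j| * B := by
    rw [hS, two_mul_sum_splitWeight_mul_crossSum γ δ k (regKernel_neg γ δ r)]
    refine (norm_sum_le _ _).trans (Finset.sum_le_sum fun i _ => ?_)
    refine (norm_sum_le _ _).trans (Finset.sum_le_sum fun j _ => ?_)
    have h3 := hB r hr hr1 (z i - z j)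
    have h4 := hC i j z
    rw [norm_e_sub_e] at h4
    have h5 : C i j * ‖1 - e ((z i - z j : ℝ) : ℂ)‖ ≤ |C i j| * ‖1 - e ((z i - z j : ℝ) : ℂ)‖ :=
      mul_le_mul_of_nonneg_right (le_abs_self _) (norm_nonneg _)
    rw [norm_mul]
    calc _ ≤ ‖regKernel γ δ r (z i - z j)‖ * (|C i j| * ‖1 - e ((z i - z j : ℝ) : ℂ)‖) :=
          mul_le_mul_of_nonneg_left (h4.trans h5) (norm_nonneg _)
      _ = |C i j| * (‖1 - e ((z i - z j : ℝ) : ℂ)‖ * ‖regKernel γ δ r (z i - z j)‖) := by ring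
      _ ≤ _ := mul_le_mul_of_nonneg_left h3 (abs_nonneg _)
  rw [norm_mul, Complex.norm_two] at h2
  linarith [norm_nonneg S]

lemma sum_splitWeight_logDerivDiff (k : ℕ) {z : ι → ℝ}
    (hz : ∀ i j, i ≠ j → e ((z i - z j : ℝ) : ℂ) ≠ 1) :
    ∑ I ∈ Finset.univ.powersetCard k, splitWeight γ δ I z *
      crossSum (fun u => logDerivDiff (oddProd δ) γ u) I z = 0 := by
  have hδ : 0 < δ.im := hγ.trans hγδ
  have h := (isOddTheta_oddProd hδ).sum_pairProd_logDerivDiff hδ (γ := γ) (s := Finset.univ)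
    (z := fun i => (z i : ℂ)) (fun i _ j _ hij h => ?_) (fun i _ j _ h => ?_)
    -- The coefficients are arbitrary; the indicator selects the sets of size `k`.
    (fun n => if n = k then 1 else 0)
  · rw [Finset.powersetCard_eq_filter, Finset.sum_filter]
    refine Eq.trans (Finset.sum_congr rfl fun I _ => ?_) h
    split_ifs
    · rw [one_mul, splitWeight, crossSum]
      push_cast
      rfl
    · rw [zero_mul]
  · refine hz i j hij ((ofReal_mem_lattice_iff hδ).mp ?_)
    push_cast
    exact h
  · rw [← neg_mem_iff, neg_sub] at h
    exact notMem_lattice_of_im (by simpa) (by simpa) h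

lemma tendsto_sum_splitWeight (k : ℕ) {z : ι → ℝ}
    (hz : ∀ i j, i ≠ j → e ((z i - z j : ℝ) : ℂ) ≠ 1) :
    Tendsto (fun r => ∑ I ∈ Finset.univ.powersetCard k, splitWeight γ δ I z *
      crossSum (regKernel γ δ r) I z) (𝓝[<] 1) (𝓝 0) := by
  have h : Tendsto (fun r => ∑ J ∈ Finset.univ.powersetCard k, splitWeight γ δ J z *
      crossSum (regKernel γ δ r) J z) (𝓝[<] 1)
      (𝓝 (∑ J ∈ Finset.univ.powersetCard k, splitWeight γ δ J z *
        ∑ i ∈ J, ∑ j ∈ Finset.univ \ J, -(2 * Real.pi * I)⁻¹ *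
          logDerivDiff (oddProd δ) γ ((z i - z j : ℝ) : ℂ))) := by
    refine tendsto_finsetSum _ fun J _ => Tendsto.const_mul _ (tendsto_finsetSum _ fun i hi =>
      tendsto_finsetSum _ fun j hj => tendsto_regKernel hγ hγδ (hz i j ?_))
    rintro rfl
    exact (Finset.mem_sdiff.mp hj).2 hi
  have h0 : ∑ J ∈ Finset.univ.powersetCard k, splitWeight γ δ J z *
      ∑ i ∈ J, ∑ j ∈ Finset.univ \ J, -(2 * Real.pi * I)⁻¹ *
        logDerivDiff (oddProd δ) γ ((z i - z j : ℝ) : ℂ) = -(2 * Real.pi * I)⁻¹ * 0 := by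
    rw [← sum_splitWeight_logDerivDiff hγ hγδ k hz, Finset.mul_sum]
    refine Finset.sum_congr rfl fun J _ => ?_
    simp only [← Finset.mul_sum, crossSum]
    ring
  rwa [h0, mul_zero] at h

lemma continuous_regKernel {r : ℝ} (hr : 0 ≤ r) (hr1 : r < 1) :
    Continuous (regKernel γ δ r) := by
  have he : Continuous fun u : ℝ => e u := continuous_e.comp continuous_ofReal
  have he' : Continuous fun u : ℝ => (e u)⁻¹ := he.inv₀ fun u => e_ne_zero _
  have hne : ∀ {w : ℂ}, ‖w‖ = 1 → 1 - r * w ≠ 0 := by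
    intro w hw h
    have := congrArg norm (sub_eq_zero.mp h)
    rw [norm_one, norm_mul, hw, mul_one, norm_real, Real.norm_of_nonneg hr] at this
    linarith
  have h1 : Continuous fun u : ℝ => (r * (e u)⁻¹ / (1 - r * (e u)⁻¹) : ℂ) :=
    (he'.const_mul _).div (continuous_const.sub (he'.const_mul _))
      fun u => hne (norm_inv_e_ofReal u)
  have h2 : Continuous fun u : ℝ => (r * e u / (1 - r * e u) : ℂ) :=
    (he.const_mul _).div (continuous_const.sub (he.const_mul _))
      fun u => hne (norm_e_ofReal u)
  have h3 : Continuous (regularPart γ δ r) :=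
    continuous_tsum (fun n => ((he'.pow _).sub (he.pow _)).const_mul _)
      ((summable_norm_structConst_sub_one hγ hγδ).mul_right 2)
      fun n u => norm_regularPart_term_le hr hr1 u n
  exact (h1.sub h2).add h3

lemma continuous_crossSum {r : ℝ} (hr : 0 ≤ r) (hr1 : r < 1) (I : Finset ι) :
    Continuous (crossSum (regKernel γ δ r) I : (ι → ℝ) → ℂ) :=
  continuous_finsetSum _ fun i _ => continuous_finsetSum _ fun j _ =>
    (continuous_regKernel hγ hγδ hr hr1).comp (by fun_prop)

/-- The regularised bracket integrals vanish in the limit. -/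
lemma tendsto_integral_splitWeight (ε : ℂ) (m : Mode →₀ ℕ) (I₀ : Finset ι) :
    Tendsto (fun r => ∫ z, splitWeight γ δ I₀ z * crossSum (regKernel γ δ r) I₀ z *
      etaCoeff ε m z ∂boxMeasure ι) (𝓝[<] 1) (𝓝 0) := by
  set k := I₀.card with hk
  set N : ℂ := ((Finset.univ.powersetCard k : Finset (Finset ι)).card : ℂ) with hN
  have hN0 : N ≠ 0 := by
    rw [hN, Nat.cast_ne_zero, Finset.card_ne_zero]
    exact ⟨I₀, Finset.mem_powersetCard.mpr ⟨Finset.subset_univ _, rfl⟩⟩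
  have hev : ∀ᶠ r : ℝ in 𝓝[<] 1, 0 ≤ r ∧ r < 1 :=
    (show ∀ᶠ r : ℝ in 𝓝[<] 1, 0 ≤ r from
      nhdsWithin_le_nhds (eventually_ge_nhds one_pos)).and self_mem_nhdsWithin
  obtain ⟨C, hC⟩ := exists_norm_sum_splitWeight_le (ι := ι) hγ hγδ k
  obtain ⟨D, hD⟩ := exists_norm_etaCoeff_le (ι := ι) ε m
  have hlim : Tendsto (fun r => ∫ z, (∑ I ∈ Finset.univ.powersetCard k, splitWeight γ δ I z *
      crossSum (regKernel γ δ r) I z) * etaCoeff ε m z ∂boxMeasure ι) (𝓝[<] 1)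
      (𝓝 (∫ _ : ι → ℝ, (0 : ℂ) ∂boxMeasure ι)) := by
    refine tendsto_integral_filter_of_dominated_convergence (fun _ => C * D) ?_ ?_
      (integrable_const _) ?_
    · filter_upwards [hev] with r hr
      refine Continuous.aestronglyMeasurable ?_
      exact (continuous_finsetSum _ fun I _ => (continuous_splitWeight hγ hγδ I).mul
        (continuous_crossSum hγ hγδ hr.1 hr.2 I)).mul (continuous_etaCoeff ε m)
    · filter_upwards [hev] with r hr
      refine Eventually.of_forall fun z => ?_
      rw [norm_mul]
      exact mul_le_mul (hC r hr.1 hr.2 z) (hD z) (norm_nonneg _)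
        ((norm_nonneg _).trans (hC r hr.1 hr.2 z))
    · filter_upwards [ae_boxMeasure_ne] with z hz
      simpa only [zero_mul] using
        (tendsto_sum_splitWeight hγ hγδ k hz).mul_const (etaCoeff ε m z)
  rw [integral_zero] at hlim
  have hlim2 := hlim.const_mul N⁻¹
  rw [mul_zero] at hlim2
  refine hlim2.congr' ?_
  filter_upwards [hev] with r hr
  -- A permutation carries `I₀` to any other set of the same size, and both the measure and
  -- `etaCoeff` are invariant. The integral for `I₀` is thus the average over all such sets, which
  -- accounts for `N⁻¹`.
  have hI : ∀ I ∈ (Finset.univ.powersetCard k : Finset (Finset ι)),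
      ∫ z, splitWeight γ δ I z * crossSum (regKernel γ δ r) I z * etaCoeff ε m z ∂boxMeasure ι =
      ∫ z, splitWeight γ δ I₀ z * crossSum (regKernel γ δ r) I₀ z *
        etaCoeff ε m z ∂boxMeasure ι := by
    intro I hI
    obtain ⟨σ, hσ⟩ : ∃ σ : Equiv.Perm ι, I₀.map σ.toEmbedding = I := by
      have hcard : Fintype.card {x // x ∈ I₀} = Fintype.card {x // x ∈ I} := by
        rw [Fintype.card_coe, Fintype.card_coe, (Finset.mem_powersetCard.mp hI).2]
      obtain ⟨τ⟩ := Fintype.card_eq.mp hcard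
      refine ⟨τ.extendSubtype, ?_⟩
      refine Finset.eq_of_subset_of_card_le ?_ ?_
      · intro x hx
        rw [Finset.mem_map] at hx
        obtain ⟨y, hy, rfl⟩ := hx
        exact τ.extendSubtype_mem y hy
      · rw [Finset.card_map, (Finset.mem_powersetCard.mp hI).2]
    rw [← integral_comp_perm σ fun z => splitWeight γ δ I₀ z *
      crossSum (regKernel γ δ r) I₀ z * etaCoeff ε m z]
    simp only [splitWeight_comp_perm, crossSum_comp_perm, etaCoeff_comp_perm, hσ]
  simp only [Finset.sum_mul]
  rw [integral_finsetSum]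
  · rw [Finset.sum_congr rfl hI, Finset.sum_const, nsmul_eq_mul, ← hN, ← mul_assoc,
      inv_mul_cancel₀ hN0, one_mul]
  · intro I _
    exact integrable_boxMeasure (((continuous_splitWeight hγ hγδ I).mul
      (continuous_crossSum hγ hγδ hr.1 hr.2 I)).mul (continuous_etaCoeff ε m))

end analytic

end weights

/-! ### The bracket of two Hamiltonians as a limit of regularised integrals -/

/-- By oddness each factor with `i < j` is the product of the ratios `f(x) / f(x + γ)` at `x_i -
x_j` and `x_j - x_i`; the constant `c` occurs squared above and below and cancels. -/
lemma kernel_eq_pairProd {γ δ : ℂ} (hδ : 0 < δ.im) {c : ℂ} (hc : c ≠ 0)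
    (hθ : ∀ x, theta δ x = c * oddProd δ x) {n : ℕ} (x : Fin n → ℝ) :
    kernel γ δ x =
      pairProd (shiftRatio (oddProd δ) γ) (fun i => (x i : ℂ)) Finset.univ := by
  have hf := isOddTheta_oddProd hδ
  set h := shiftRatio (oddProd δ) γ with hh
  have h1 : pairProd h (fun i => (x i : ℂ)) Finset.univ =
      ∏ i, ∏ j ∈ {i}ᶜ, h (x i - x j) := by
    refine Finset.prod_congr rfl fun i _ => ?_
    rw [Fintype.prod_eq_mul_prod_compl i, if_pos rfl, one_mul]
    refine Finset.prod_congr rfl fun j hj => if_neg fun hij => ?_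
    exact Finset.mem_compl.mp hj (Finset.mem_singleton.mpr hij.symm)
  rw [h1, ← Finset.prod_prod_Ioi_mul_eq_prod_prod_off_diag fun a b => h (x b - x a), kernel]
  refine Finset.prod_congr rfl fun i _ => Finset.prod_congr rfl fun j _ => ?_
  have h2 : oddProd δ ((x j : ℂ) - x i) = -oddProd δ (x i - x j) := by
    rw [← hf.neg, neg_sub]
  have h3 : oddProd δ ((x j : ℂ) - x i + γ) = -oddProd δ (x i - x j - γ) := by
    rw [← hf.neg]
    congr 1
    ring
  simp only [hθ, hh, shiftRatio, h2, h3]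
  rw [neg_div_neg_eq, div_mul_div_comm, ← sq, mul_pow,
    show ∀ a b : ℂ, c * a * (c * b) = c ^ 2 * (a * b) by intros; ring,
    mul_div_mul_left _ _ (pow_ne_zero 2 hc)]

lemma hamiltonianSeries_eq_zero {γ δ ε : ℂ} {k : ℕ} (hθ : ∀ x, theta δ x = 0) :
    hamiltonianSeries γ δ ε k = 0 := by
  have h : prefactor γ δ k = 0 := by
    rw [prefactor, hθ (k * γ), mul_zero, zero_div, mul_zero]
  ext m
  change prefactor γ δ k * _ = 0
  rw [h, zero_mul]

lemma coeff_pderiv_hamiltonianSeries (γ δ ε : ℂ) (k : ℕ) (n : Mode) (a : Mode →₀ ℕ) :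
    MvPowerSeries.coeff a (MvPowerSeries.pderiv ℂ n (hamiltonianSeries γ δ ε k)) =
      prefactor γ δ k *
        ∫ x, kernel γ δ x * modeSum n x * etaCoeff ε a x ∂boxMeasure (Fin k) := by
  rw [MvPowerSeries.coeff_pderiv, boxMeasure_eq]
  change prefactor γ δ k * (∫ x : Fin k → ℝ in Set.univ.pi fun _ => Set.Ioc (-1 / 2 : ℝ) (1 / 2),
    kernel γ δ x * etaCoeff ε (a + Finsupp.single n 1) x) * _ = _
  rw [mul_assoc, ← integral_mul_const]
  simp only [mul_assoc, etaCoeff_add_single]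

section

variable {k l : ℕ}

/-- The variables of the first Hamiltonian. -/
def leftVars (k l : ℕ) : Finset (Fin k ⊕ Fin l) := Finset.univ.map Function.Embedding.inl

lemma univ_sdiff_leftVars :
    Finset.univ \ leftVars k l = Finset.univ.map Function.Embedding.inr := by
  ext i
  cases i <;> simp [leftVars]

lemma crossSum_leftVars (K : ℝ → ℂ) (z : Fin k ⊕ Fin l → ℝ) :
    crossSum K (leftVars k l) z = ∑ i, ∑ j, K (z (Sum.inl i) - z (Sum.inr j)) := by
  rw [crossSum, univ_sdiff_leftVars, leftVars]
  simp only [Finset.sum_map, Function.Embedding.inl_apply, Function.Embedding.inr_apply]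

lemma pairProd_map {ι κ : Type*} [DecidableEq ι] [DecidableEq κ] (h : ℂ → ℂ) (φ : ι ↪ κ)
    (z : κ → ℂ) (s : Finset ι) : pairProd h z (s.map φ) = pairProd h (z ∘ φ) s := by
  simp only [pairProd, Finset.prod_map, φ.injective.eq_iff, Function.comp]

lemma splitWeight_leftVars {γ δ : ℂ} (hδ : 0 < δ.im) {c : ℂ} (hc : c ≠ 0)
    (hθ : ∀ x, theta δ x = c * oddProd δ x) (z : Fin k ⊕ Fin l → ℝ) :
    splitWeight γ δ (leftVars k l) z =
      kernel γ δ (z ∘ Sum.inl) * kernel γ δ (z ∘ Sum.inr) := by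
  rw [splitWeight, univ_sdiff_leftVars, leftVars, pairProd_map, pairProd_map,
    kernel_eq_pairProd hδ hc hθ, kernel_eq_pairProd hδ hc hθ]
  rfl

lemma crossSum_mode (a : ℂ) (n : ℤ) (z : Fin k ⊕ Fin l → ℝ) :
    crossSum (fun u => a * e (-(n * u))) (leftVars k l) z =
      a * (modeSum n (z ∘ Sum.inl) * modeSum (-n) (z ∘ Sum.inr)) := by
  rw [crossSum_leftVars, modeSum, modeSum, Finset.sum_mul_sum]
  simp only [Finset.mul_sum, Function.comp, ← e_add]
  refine Finset.sum_congr rfl fun i _ => Finset.sum_congr rfl fun j _ => ?_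
  congr 2
  push_cast
  ring

variable {γ δ : ℂ} (hγ : 0 < γ.im) (hγδ : γ.im < δ.im)
include hγ hγδ

lemma exists_norm_splitWeight_le {ι : Type*} [Fintype ι] [DecidableEq ι] [Nonempty ι]
    (J : Finset ι) : ∃ M, ∀ z : ι → ℝ, ‖splitWeight γ δ J z‖ ≤ M :=
  have i := Classical.arbitrary ι
  ((swapLipschitz_pairProd hγ hγδ i i J).mul (swapLipschitz_pairProd hγ hγδ i i _)).1

/-- The free scalar `t` will be `r^{|n|}`. The Cauchy product of the two differentiated integrals
becomes, by Fubini and `etaCoeff_sum`, one integral over all `k + l` variables. -/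
lemma bracketTerm_hamiltonianSeries (ε : ℂ) {c : ℂ} (hc : c ≠ 0)
    (hθ : ∀ x, theta δ x = c * oddProd δ x) (m : Mode →₀ ℕ) (n : Mode) (t : ℂ) :
    structConst γ δ n * MvPowerSeries.coeff m
        (MvPowerSeries.pderiv ℂ n (hamiltonianSeries γ δ ε k) *
          MvPowerSeries.pderiv ℂ n.opp (hamiltonianSeries γ δ ε l)) * t =
      prefactor γ δ k * prefactor γ δ l * ∫ z, splitWeight γ δ (leftVars k l) z *
        crossSum (fun u => structConst γ δ n * t * e (-((n : ℤ) * u))) (leftVars k l) z *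
          etaCoeff ε m z ∂boxMeasure (Fin k ⊕ Fin l) := by
  have hδ : 0 < δ.im := hγ.trans hγδ
  have hker : ∀ q : ℕ, Continuous fun x : Fin q → ℝ => kernel γ δ x := fun q => by
    simp only [kernel_eq_pairProd hδ hc hθ]
    exact continuous_pairProd hγ hγδ _
  set F : (Mode →₀ ℕ) → (Fin k → ℝ) → ℂ := fun a x =>
    kernel γ δ x * modeSum n x * etaCoeff ε a x with hF
  set G : (Mode →₀ ℕ) → (Fin l → ℝ) → ℂ := fun a y =>
    kernel γ δ y * modeSum n.opp y * etaCoeff ε a y with hG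
  have hFc : ∀ a, Continuous (F a) := fun a =>
    ((hker k).mul (continuous_modeSum _)).mul (continuous_etaCoeff ε a)
  have hGc : ∀ a, Continuous (G a) := fun a =>
    ((hker l).mul (continuous_modeSum _)).mul (continuous_etaCoeff ε a)
  have hint : ∫ z, splitWeight γ δ (leftVars k l) z *
        crossSum (fun u => structConst γ δ n * t * e (-((n : ℤ) * u))) (leftVars k l) z *
          etaCoeff ε m z ∂boxMeasure (Fin k ⊕ Fin l) =
      structConst γ δ n * t * ∑ ab ∈ Finset.HasAntidiagonal.antidiagonal m,
        (∫ x, F ab.1 x ∂boxMeasure (Fin k)) * ∫ y, G ab.2 y ∂boxMeasure (Fin l) := by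
    simp only [← integral_sum_mul]
    rw [← integral_finsetSum, ← integral_const_mul]
    · refine integral_congr_ae (Eventually.of_forall fun z => ?_)
      simp only [splitWeight_leftVars hδ hc hθ, crossSum_mode, etaCoeff_sum ε m z, hF, hG,
        Finset.mul_sum, Mode.coe_opp]
      exact Finset.sum_congr rfl fun ab _ => by ring
    · intro ab _
      refine integrable_boxMeasure (((hFc _).comp ?_).mul ((hGc _).comp ?_))
      all_goals exact continuous_pi fun i => continuous_apply _
  rw [hint, MvPowerSeries.coeff_mul]
  simp only [coeff_pderiv_hamiltonianSeries, Finset.mul_sum, Finset.sum_mul]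
  exact Finset.sum_congr rfl fun ab _ => by ring

/-- For `r < 1` the series of `‖c_n‖ r^{|n|}` converges and all other factors are bounded, so the
sum over modes may be taken under the integral. -/
lemma hasSum_integral_crossSum {ι : Type*} [Fintype ι] [DecidableEq ι] [Nonempty ι] (ε : ℂ)
    (m : Mode →₀ ℕ) (J : Finset ι) {r : ℝ} (hr : 0 ≤ r) (hr1 : r < 1) :
    HasSum (fun n : Mode => ∫ z, splitWeight γ δ J z * crossSum
        (fun u => structConst γ δ n * (r : ℂ) ^ (n : ℤ).natAbs * e (-((n : ℤ) * u))) J z *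
          etaCoeff ε m z ∂boxMeasure ι)
      (∫ z, splitWeight γ δ J z * crossSum (regKernel γ δ r) J z *
        etaCoeff ε m z ∂boxMeasure ι) := by
  obtain ⟨M, hM⟩ := exists_norm_splitWeight_le hγ hγδ J
  obtain ⟨D, hD⟩ := exists_norm_etaCoeff_le (ι := ι) ε m
  set a : Mode → ℂ := fun n => structConst γ δ n * (r : ℂ) ^ (n : ℤ).natAbs with ha
  have hcross : ∀ n z, ‖crossSum (fun u => a n * e (-((n : ℤ) * u))) J z‖ ≤
      ∑ _i ∈ J, ∑ _j ∈ Finset.univ \ J, ‖a n‖ := by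
    intro n z
    refine (norm_sum_le _ _).trans (Finset.sum_le_sum fun i _ => ?_)
    refine (norm_sum_le _ _).trans (Finset.sum_le_sum fun j _ => le_of_eq ?_)
    have := norm_e_ofReal (-((n : ℤ) * (z i - z j)))
    push_cast at this
    rw [norm_mul]
    push_cast
    rw [this, mul_one]
  have hbound : Summable fun n : Mode => M * (∑ _i ∈ J, ∑ _j ∈ Finset.univ \ J, ‖a n‖) * D :=
    ((summable_sum fun _ _ => summable_sum fun _ _ =>
      summable_norm_structConst_mul_pow hγ hγδ hr hr1).mul_left M).mul_right D
  refine hasSum_integral_of_dominated_convergence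
    (fun n _ => M * (∑ _i ∈ J, ∑ _j ∈ Finset.univ \ J, ‖a n‖) * D) (fun n => ?_)
    (fun n => Eventually.of_forall fun z => ?_) (Eventually.of_forall fun _ => hbound)
    (integrable_const _) (Eventually.of_forall fun z => ?_)
  · have hcr : Continuous fun z : ι → ℝ => crossSum (fun u => a n * e (-((n : ℤ) * u))) J z :=
      continuous_finsetSum _ fun i _ => continuous_finsetSum _ fun j _ =>
        (continuous_e.comp (by fun_prop)).const_mul _
    exact (((continuous_splitWeight hγ hγδ J).mul hcr).mul
      (continuous_etaCoeff ε m)).aestronglyMeasurable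
  · rw [norm_mul, norm_mul]
    have hM0 : 0 ≤ M := (norm_nonneg _).trans (hM z)
    exact mul_le_mul (mul_le_mul (hM z) (hcross n z) (norm_nonneg _) hM0) (hD z) (norm_nonneg _)
      (mul_nonneg hM0 ((norm_nonneg _).trans (hcross n z)))
  · refine ((hasSum_sum fun i _ => hasSum_sum fun j _ => ?_).mul_left _).mul_right _
    exact hasSum_regKernel hγ hγδ hr hr1 _

/-- For a fixed monomial only finitely many terms are nonzero, so the regularised sum is a
polynomial in `r` whose value at `1` is the coefficient of the bracket. For `0 ≤ r < 1` it equals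
the regularised integral, which tends to zero. -/
lemma finsum_bracketTerm_eq_zero (ε : ℂ) (hk : 0 < k) {c : ℂ} (hc : c ≠ 0)
    (hθ : ∀ x, theta δ x = c * oddProd δ x) (m : Mode →₀ ℕ) :
    ∑ᶠ n : Mode, structConst γ δ n * MvPowerSeries.coeff m
      (MvPowerSeries.pderiv ℂ n (hamiltonianSeries γ δ ε k) *
        MvPowerSeries.pderiv ℂ n.opp (hamiltonianSeries γ δ ε l)) = 0 := by
  have : Nonempty (Fin k ⊕ Fin l) := ⟨Sum.inl ⟨0, hk⟩⟩
  set T : Mode → ℂ := fun n => structConst γ δ n * MvPowerSeries.coeff m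
    (MvPowerSeries.pderiv ℂ n (hamiltonianSeries γ δ ε k) *
      MvPowerSeries.pderiv ℂ n.opp (hamiltonianSeries γ δ ε l)) with hT
  have hfin : (Function.support T).Finite :=
    finite_support_bracketTerm γ δ (hamiltonian γ δ ε k).2 _ m
  set S := hfin.toFinset with hS
  have hev : ∀ᶠ r : ℝ in 𝓝[<] 1, 0 ≤ r ∧ r < 1 :=
    (show ∀ᶠ r : ℝ in 𝓝[<] 1, 0 ≤ r from
      nhdsWithin_le_nhds (eventually_ge_nhds one_pos)).and self_mem_nhdsWithin
  have h1 : Tendsto (fun r : ℝ => ∑ n ∈ S, T n * (r : ℂ) ^ (n : ℤ).natAbs) (𝓝[<] 1)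
      (𝓝 (∑ᶠ n, T n)) := by
    have hcont : Continuous fun r : ℝ => ∑ n ∈ S, T n * (r : ℂ) ^ (n : ℤ).natAbs := by fun_prop
    have := (hcont.tendsto 1).mono_left (nhdsWithin_le_nhds (s := Set.Iio 1))
    simpa only [ofReal_one, one_pow, mul_one, finsum_eq_sum T hfin] using this
  have h2 : Tendsto (fun r : ℝ => ∑ n ∈ S, T n * (r : ℂ) ^ (n : ℤ).natAbs) (𝓝[<] 1) (𝓝 0) := by
    have h3 := (tendsto_integral_splitWeight hγ hγδ ε m (leftVars k l)).const_mul
      (prefactor γ δ k * prefactor γ δ l)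
    rw [mul_zero] at h3
    refine h3.congr' ?_
    filter_upwards [hev] with r hr
    have h4 := (hasSum_integral_crossSum hγ hγδ ε m (leftVars k l) hr.1 hr.2).mul_left
      (prefactor γ δ k * prefactor γ δ l)
    simp only [← bracketTerm_hamiltonianSeries hγ hγδ ε hc hθ] at h4
    refine h4.unique (hasSum_sum_of_ne_finset_zero fun n hn => ?_)
    have hn0 : T n = 0 := by
      by_contra h
      exact hn (hfin.mem_toFinset.mpr h)
    exact mul_eq_zero_of_left hn0 _
  exact tendsto_nhds_unique h1 h2

end

end EllipticILW

end

theorem mainTheorem3 (γ δ ε : ℂ) (hγ : 0 < γ.im) (hγδ : γ.im < δ.im) (k l : ℕ)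
    (hk : 0 < k) (hl : 0 < l) :
    EllipticILW.poissonBracket γ δ (EllipticILW.hamiltonian γ δ ε k)
      (EllipticILW.hamiltonian γ δ ε l) = 0 := by
  obtain ⟨c, hθ⟩ := EllipticILW.exists_theta_eq_mul_oddProd (hγ.trans hγδ)
  ext m
  rw [EllipticILW.coe_poissonBracket, EllipticILW.coeff_bracketFun, ZeroMemClass.coe_zero,
    map_zero]
  -- Nonvanishing of `c` is not needed: if `c = 0`, the theta function is zero and so is the
  -- numerator of the prefactor, hence `I_k = 0`.
  by_cases hc : c = 0
  · have h : EllipticILW.hamiltonianSeries γ δ ε k = 0 :=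
      EllipticILW.hamiltonianSeries_eq_zero fun x => by rw [hθ, hc, zero_mul]
    simp only [EllipticILW.hamiltonian, h, map_zero, zero_mul, mul_zero, finsum_zero]
  · exact EllipticILW.finsum_bracketTerm_eq_zero hγ hγδ ε hk hc hθ m
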